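/- Let $X=\{x\in W^{1,2}(0,1):\int_0^1x\,d\xi=0\}$ with inner product $(x,y)_X=\int_0^1x'y'\,d\xi$, and let $U=X'$ be its dual space with the dual inner product. An element $x\in L^p(0,1)$, $p\ge 1$, with $\int_0^1 x\,d\xi=0$ (we write $x\in\tilde L^p(0,1)$) is identified with the functional $y\mapsto\int_0^1xy\,d\xi$ in $U$. Let $B:X\to U$, $Bx(y)=\int_0^1x'y'\,d\xi$, and $Q=B^{-2}:U\to U$. Then $f_k=k\pi\sqrt2\cos(k\pi\,\cdot)$, $k\ge1$, is an orthonormal basis of $U$ with $Qf_k=(\pi k)^{-4}f_k$, and $Q^\theta$ denotes the operator with $Q^\theta f_k=(\pi k)^{-4\theta}f_k$. Let $\alpha_1>\frac34$, let $Q_1=Q^{\alpha_1}$, and let $\mu_1$ be the centered Gaussian measure on $U$ with covariance operator $Q_1$. For $\theta\ge 0$ let $W^{1,2}_{Q^\theta}(U;\mu_1)$ be the domain of the closure, again denoted $Q^\theta D$, of the operator $F\mapsto Q^\theta DF$ from $L^2(U;\mu_1)$ to $L^2(U;\mu_1;U)$ defined on the functions $F(u)=\psi((u,f_1)_U,\dots,(u,f_n)_U)$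 with $n\in\mathbb N$ and $\psi\in C_b^\infty(\mathbb R^n)$ (smooth, bounded with all derivatives). Let $\phi\in C^1(\mathbb R)$ be bounded from below and suppose that there are $A_1\in(0,\infty)$ and $p\in[1,\infty)$ with $|\phi'(t)|\le A_1(1+|t|^{p-1})$ for all $t\in\mathbb R$. Define $\Phi_1:U\to(-\infty,\infty]$ by $\Phi_1(u)=\int_0^1\phi(u(\xi))\,d\xi$ if $u\in\tilde L^p(0,1)$ and $\Phi_1(u)=\infty$ otherwise. Then: 1. $\Phi_1\in W^{1,2}_{Q^{\tilde\alpha}}(U;\mu_1)$ for all $\tilde\alpha\in(\frac38,\infty)$. 2. If $\phi$ is convex, then $\Phi_1$ satisfies the following convex approximation assumption: $\inf_U\Phi_1>-\infty$, and there are convex functions $\Phi_n,\Phi_{(m,n)}:U\to\mathbb R$, $m,n\in\mathbb N$, such that (i) for $\mu_1$-almost all $u\in U$: $\lim_{m\to\infty}\Phi_{(m,n)}(u)=\Phi_n(u)$ for all $n$; $\inf_U\Phi_1\le\Phi_{(m,n)}(u)$ for all $m,n$; and $\lim_{n\to\infty}\Phi_n(u)=\Phi_1(u)$; (ii) each $\Phi_{(m,n)}$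 is Fréchet differentiable with Lipschitz continuous gradient; (iii) for every $\theta\in[0,\infty)$ with $\Phi_1\in W^{1,2}_{Q_1^\theta}(U;\mu_1)$ and every $i$, $\lim_{n\to\infty}\lim_{m\to\infty}\|(Q_1^\theta D\Phi_{(m,n)}-Q_1^\theta D\Phi_1,f_i)_U\|_{L^2(U;\mu_1)}=0$. 3. If $\phi'$ is bounded (in particular if $p=1$), then $\|Q^{\tilde\alpha}D\Phi_1\|_{L^\infty(U;\mu_1)}<\infty$ for all $\tilde\alpha\in(\frac38,\infty)$. -/

import Mathlib

open MeasureTheory Set Filter Topology ProbabilityTheory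
open scoped ENNReal NNReal ContDiff

noncomputable section
namespace GaussianSobolev

/-- The power `T^θ` of the operator `T` that is diagonal with respect to the orthonormal basis `b`,
with `T (b k) = ev k • b k`: `T^θ x = ∑ₖ (ev k)^θ (b k, x) b k`. -/
def diagPow {H : Type*} [NormedAddCommGroup H] [InnerProductSpace ℝ H] (b : ℕ → H) (ev : ℕ → ℝ)
    (θ : ℝ) (x : H) : H :=
  ∑' k, (ev k ^ θ * inner ℝ (b k) x) • b k

/-- `μ` is the centered Gaussian measure on `H` with covariance operator `C`. -/
structure IsCenteredGaussian {H : Type*} [NormedAddCommGroup H] [InnerProductSpace ℝ H]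
    [MeasurableSpace H] [BorelSpace H] (μ : Measure H) (C : H → H) : Prop where
  isGaussian : IsGaussian μ
  mean_zero : ∫ x, x ∂μ = 0
  cov_eq : ∀ x y : H, covarianceBilin μ x y = inner ℝ (C x) y

/-- The space `FC_b^∞(b)`: functions `x ↦ ψ ((b 0, x), …, (b (n - 1), x))` where `ψ : ℝⁿ → ℝ` is
smooth and bounded with all its derivatives. -/
def IsSmoothCylinder {H : Type*} [NormedAddCommGroup H] [InnerProductSpace ℝ H] (b : ℕ → H)
    (F : H → ℝ) : Prop :=
  ∃ (n : ℕ) (ψ : (Fin n → ℝ) → ℝ), ContDiff ℝ ∞ ψ ∧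
    (∀ k : ℕ, ∃ C : ℝ, ∀ z, ‖iteratedFDeriv ℝ k ψ z‖ ≤ C) ∧
    F = fun x => ψ fun i => inner ℝ (b i) x

/-- `TDΦ = G`, where `TD` is the closure in `L²(μ) × L²(μ; H)` of `F ↦ T ∘ ∇F`, defined on
`FC_b^∞(b)`. The extended real function `Φ` stands for its class modulo `μ`-null sets, so it has to
be `μ`-a.e. finite. -/
def IsSobolevGrad {H : Type*} [NormedAddCommGroup H] [InnerProductSpace ℝ H] [CompleteSpace H]
    [MeasurableSpace H] (μ : Measure H) (b : ℕ → H) (T : H → H) (Φ : H → EReal) (G : H → H) :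
    Prop :=
  MemLp G 2 μ ∧ ∃ h : H → ℝ, MemLp h 2 μ ∧ (∀ᵐ x ∂μ, Φ x = (h x : EReal)) ∧
    ∃ F : ℕ → H → ℝ, (∀ j, IsSmoothCylinder b (F j)) ∧
      Tendsto (fun j => eLpNorm (fun x => F j x - h x) 2 μ) atTop (𝓝 0) ∧
      Tendsto (fun j => eLpNorm (fun x => T (gradient (F j) x) - G x) 2 μ) atTop (𝓝 0)

/-- `Φ ∈ W^{1,2}_T(H; μ)`. -/
def MemSobolev {H : Type*} [NormedAddCommGroup H] [InnerProductSpace ℝ H] [CompleteSpace H]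
    [MeasurableSpace H] (μ : Measure H) (b : ℕ → H) (T : H → H) (Φ : H → EReal) : Prop :=
  ∃ G : H → H, IsSobolevGrad μ b T Φ G

/-- The convex approximation assumption on the potential `Φ`, for a Gaussian measure `μ` whose
covariance operator has the eigenbasis `b` and the eigenvalues `ev`. Limits as `(m, n) → ∞` are
iterated limits: first `m → ∞`, then `n → ∞`. -/
structure ConvexApproximable {H : Type*} [NormedAddCommGroup H] [InnerProductSpace ℝ H]
    [CompleteSpace H] [MeasurableSpace H] (μ : Measure H) (b : ℕ → H) (ev : ℕ → ℝ)
    (Φ : H → EReal) : Prop where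
  bddBelow : ⊥ < ⨅ y, Φ y
  exists_approx : ∃ (Φn : ℕ → H → ℝ) (Φmn : ℕ → ℕ → H → ℝ),
    (∀ n, ConvexOn ℝ univ (Φn n)) ∧ (∀ m n, ConvexOn ℝ univ (Φmn m n)) ∧
    (∀ᵐ x ∂μ,
      (∀ n, Tendsto (fun m => Φmn m n x) atTop (𝓝 (Φn n x))) ∧
      (∀ m n, ⨅ y, Φ y ≤ (Φmn m n x : EReal)) ∧
      Tendsto (fun n => (Φn n x : EReal)) atTop (𝓝 (Φ x))) ∧
    (∀ m n, Differentiable ℝ (Φmn m n) ∧ ∃ K : ℝ≥0, LipschitzWith K (gradient (Φmn m n))) ∧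
    (∀ θ : ℝ, 0 ≤ θ → ∀ G : H → H, IsSobolevGrad μ b (diagPow b ev θ) Φ G → ∀ i,
      ∃ c : ℕ → ℝ≥0∞,
        (∀ n, Tendsto (fun m => eLpNorm
            (fun x => inner ℝ (diagPow b ev θ (gradient (Φmn m n) x) - G x) (b i)) 2 μ)
          atTop (𝓝 (c n))) ∧
        Tendsto c atTop (𝓝 0))

end GaussianSobolev

namespace CahnHilliard

/-- Lebesgue measure on the interval `(0,1)`. -/
abbrev lam : Measure ℝ := volume.restrict (Ioo (0 : ℝ) 1)

/-- The Hilbert space `L²(0,1)`. -/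
abbrev L2 : Type := Lp ℝ 2 lam

/-- `g` is the weak derivative of `x` on `(0,1)`. -/
def IsWeakDeriv (x g : ℝ → ℝ) : Prop :=
  ∀ η : ℝ → ℝ, ContDiff ℝ ∞ η → HasCompactSupport η → tsupport η ⊆ Ioo 0 1 →
    ∫ t, x t * deriv η t ∂lam = -∫ t, g t * η t ∂lam

lemma integral_lam (h : ℝ → ℝ) : ∫ t, h t ∂lam = ∫ t in (0 : ℝ)..1, h t := by
  rw [intervalIntegral.integral_of_le zero_le_one, integral_Ioc_eq_integral_Ioo]

lemma L2.integrable (x : L2) : Integrable x lam :=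
  (Lp.memLp x).integrable one_le_two

lemma integral_mul_eq_inner (x y : L2) : ∫ t, x t * y t ∂lam = inner ℝ x y := by
  rw [L2.inner_def]; simp [mul_comm]

lemma integrable_mul_of_continuous {x h : ℝ → ℝ} (hx : Integrable x lam) (hh : Continuous h) :
    Integrable (fun t => x t * h t) lam := by
  obtain ⟨C, hC⟩ := isCompact_Icc.exists_bound_of_continuousOn (s := Icc (0 : ℝ) 1) hh.continuousOn
  refine hx.mul_bdd (c := C) hh.aestronglyMeasurable ?_
  filter_upwards [ae_restrict_mem measurableSet_Ioo] with t ht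
  exact hC t ⟨ht.1.le, ht.2.le⟩

lemma ae_eq_const_of_weakDeriv_zero {x : ℝ → ℝ} (hx : Integrable x lam)
    (h : IsWeakDeriv x 0) : ∃ c : ℝ, x =ᵐ[lam] fun _ => c := by
  let B : ContDiffBump (1 / 2 : ℝ) := ⟨1 / 8, 1 / 4, by norm_num, by norm_num⟩
  let ψ : ℝ → ℝ := B.normed volume
  have hψ : ContDiff ℝ ∞ ψ := B.contDiff_normed
  have hψs : tsupport ψ = Icc (1 / 4) (3 / 4) := by
    rw [B.tsupport_normed_eq, Real.closedBall_eq_Icc]; norm_num [B]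
  have hψi : ∫ t, ψ t = 1 := B.integral_normed
  let c : ℝ := ∫ t, x t * ψ t ∂lam
  refine ⟨c, ?_⟩
  have key : ∀ᵐ t ∂(volume : Measure ℝ), t ∈ Ioo (0 : ℝ) 1 → x t - c = 0 := by
    have hloc : IntegrableOn (fun t => x t - c) (Ioo 0 1) volume :=
      hx.sub (integrable_const c)
    refine isOpen_Ioo.ae_eq_zero_of_integral_contDiff_smul_eq_zero hloc.locallyIntegrableOn ?_
    intro w hw hwc hws
    let I : ℝ := ∫ t, w t
    let w1 : ℝ → ℝ := fun t => w t - I * ψ t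
    have hw1 : ContDiff ℝ ∞ w1 := hw.sub (contDiff_const.mul hψ)
    let K : Set ℝ := tsupport w ∪ tsupport ψ
    have hK : IsCompact K := hwc.isCompact.union (by rw [hψs]; exact isCompact_Icc)
    have hKn : K.Nonempty := ⟨1 / 2, Or.inr (by rw [hψs]; norm_num)⟩
    have hKs : K ⊆ Ioo 0 1 := by
      refine union_subset hws ?_
      rw [hψs]; intro t ht; exact ⟨by linarith [ht.1], by linarith [ht.2]⟩
    obtain ⟨a, haK, ha⟩ := hK.exists_isLeast hKn
    obtain ⟨b, hbK, hb⟩ := hK.exists_isGreatest hKn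
    have hw1K : ∀ t, t ∉ K → w1 t = 0 := by
      intro t ht
      have h1 : w t = 0 := image_eq_zero_of_notMem_tsupport (fun h => ht (Or.inl h))
      have h2 : ψ t = 0 := image_eq_zero_of_notMem_tsupport (fun h => ht (Or.inr h))
      simp [w1, h1, h2]
    have hw1i : ∫ t, w1 t = 0 := by
      have h1 : Integrable w := hw.continuous.integrable_of_hasCompactSupport hwc
      have h2 : Integrable ψ := B.integrable_normed
      simp only [w1]
      rw [integral_sub h1 (h2.const_mul I), integral_const_mul, hψi]
      simp [I]
    let η : ℝ → ℝ := fun t => ∫ s in (0 : ℝ)..t, w1 s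
    have hηd : ∀ t, HasDerivAt η (w1 t) t := fun t =>
      intervalIntegral.integral_hasDerivAt_right (hw1.continuous.intervalIntegrable _ _)
        (hw1.continuous.stronglyMeasurableAtFilter _ _) hw1.continuous.continuousAt
    have hηd' : deriv η = w1 := funext fun t => (hηd t).deriv
    have hη : ContDiff ℝ ∞ η := by
      rw [contDiff_infty_iff_deriv, hηd']
      exact ⟨fun t => (hηd t).differentiableAt, hw1⟩
    have hηs : tsupport η ⊆ Icc a b := by
      refine closure_minimal ?_ isClosed_Icc
      intro t ht
      by_contra hcon
      apply ht
      rcases lt_or_ge t a with hta | hta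
      · have h0 : ∀ s ∈ uIcc 0 t, w1 s = 0 := by
          intro s hs
          apply hw1K
          intro hsK
          have h1 := ha hsK
          have h2 := (hKs haK).1
          rcases le_total 0 t with h | h
          · rw [uIcc_of_le h] at hs; linarith [hs.2]
          · rw [uIcc_of_ge h] at hs; linarith [hs.2]
        simp only [η]
        rw [intervalIntegral.integral_congr (g := fun _ => 0) h0]; simp
      · have htb : b < t := by
          by_contra h; exact hcon ⟨hta, not_lt.mp h⟩
        simp only [η]
        rw [intervalIntegral.integral_eq_integral_of_support_subset, hw1i]
        intro s hs
        have hsK : s ∈ K := by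
          by_contra h; exact hs (hw1K s h)
        exact ⟨(hKs hsK).1, (hb hsK).trans htb.le⟩
    have hηc : HasCompactSupport η :=
      isCompact_Icc.of_isClosed_subset (isClosed_tsupport η) hηs
    have := h η hη hηc (hηs.trans fun t ht => ⟨(hKs haK).1.trans_le ht.1, ht.2.trans_lt (hKs hbK).2⟩)
    rw [hηd'] at this
    have hxw := integrable_mul_of_continuous hx hw.continuous
    have hxψ := integrable_mul_of_continuous hx hψ.continuous
    have hwI : ∫ t, w t ∂lam = I := by
      exact setIntegral_eq_integral_of_forall_compl_eq_zero fun t ht =>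
        image_eq_zero_of_notMem_tsupport fun h => ht (hws h)
    have e1 : ∫ t, x t * w1 t ∂lam = ∫ t, x t * w t ∂lam - I * c := by
      have : (fun t => x t * w1 t) = fun t => x t * w t - I * (x t * ψ t) := by
        funext t; simp only [w1]; ring
      rw [this, integral_sub hxw (hxψ.const_mul I), integral_const_mul]
    have e2 : ∫ t, x t * w t ∂lam = I * c := by
      rw [e1] at this; simp at this; linarith
    have e3 : ∫ t, w t • (x t - c) = ∫ t, w t • (x t - c) ∂lam := by
      symm
      exact setIntegral_eq_integral_of_forall_compl_eq_zero fun t ht => by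
        rw [image_eq_zero_of_notMem_tsupport fun h => ht (hws h)]; simp
    rw [e3]
    have : (fun t => w t • (x t - c)) = fun t => x t * w t - c * w t := by
      funext t; simp only [smul_eq_mul]; ring
    have hwi : Integrable w lam :=
      (hw.continuous.integrable_of_hasCompactSupport hwc).mono_measure Measure.restrict_le_self
    rw [this, integral_sub hxw (hwi.const_mul c), integral_const_mul, e2, hwI]
    ring
  rw [← ae_restrict_iff' measurableSet_Ioo] at key
  filter_upwards [key] with t ht
  linarith

/-- The primitive `t ↦ ∫₀ᵗ g`. -/
def prim (g : ℝ → ℝ) (t : ℝ) : ℝ := ∫ s in (0 : ℝ)..t, g s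

lemma intervalIntegrable_of_lam {g : ℝ → ℝ} (hg : Integrable g lam) :
    IntervalIntegrable g volume 0 1 := by
  rw [intervalIntegrable_iff_integrableOn_Ioo_of_le zero_le_one]; exact hg

lemma prim_ibp {g η : ℝ → ℝ} (hg : Integrable g lam) (hη : ContDiff ℝ 1 η) :
    ∫ t, prim g t * deriv η t ∂lam
      = prim g 1 * η 1 - ∫ t, g t * η t ∂lam := by
  have hi := intervalIntegrable_of_lam hg
  have hac : AbsolutelyContinuousOnInterval (prim g) 0 1 :=
    hi.absolutelyContinuousOnInterval_intervalIntegral (c := 0) (by simp)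
  have hηac : AbsolutelyContinuousOnInterval η 0 1 := by
    obtain ⟨K, hK⟩ := hη.contDiffOn.exists_lipschitzOnWith one_ne_zero
      (convex_uIcc (0 : ℝ) 1) isCompact_uIcc
    exact hK.absolutelyContinuousOnInterval
  have h0 : prim g 0 = 0 := by simp [prim]
  rw [integral_lam, integral_lam, hac.integral_mul_deriv_eq_deriv_mul hηac, h0]
  have : ∫ t in (0 : ℝ)..1, deriv (prim g) t * η t = ∫ t in (0 : ℝ)..1, g t * η t := by
    apply intervalIntegral.integral_congr_ae
    filter_upwards [hi.ae_hasDerivAt_integral] with t ht htm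
    have := (ht (uIoc_subset_uIcc htm) 0 (by simp)).deriv
    rw [← this]; rfl
  rw [this]; ring

lemma continuousOn_prim {g : ℝ → ℝ} (hg : Integrable g lam) :
    ContinuousOn (prim g) (Icc 0 1) := by
  have hac : AbsolutelyContinuousOnInterval (prim g) 0 1 :=
    (intervalIntegrable_of_lam hg).absolutelyContinuousOnInterval_intervalIntegral (c := 0) (by simp)
  simpa [uIcc_of_le] using hac.continuousOn

lemma abs_prim_le (g : L2) {t : ℝ} (ht : t ∈ Icc (0 : ℝ) 1) : |prim g t| ≤ ‖g‖ := by
  have h1 : |prim g t| ≤ ∫ s, |g s| ∂lam := by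
    rw [integral_lam]
    calc |prim g t| ≤ ∫ s in (0 : ℝ)..t, |g s| :=
          intervalIntegral.abs_integral_le_integral_abs ht.1
      _ ≤ _ := by
          apply intervalIntegral.integral_mono_interval le_rfl ht.1 ht.2
          · exact Eventually.of_forall fun s => abs_nonneg _
          · exact (intervalIntegrable_of_lam (L2.integrable g)).abs
  refine h1.trans ?_
  have h2 : (∫ s, |g s| ∂lam) = (eLpNorm g 1 lam).toReal := by
    rw [eLpNorm_one_eq_lintegral_enorm, ← integral_norm_eq_lintegral_enorm (Lp.aestronglyMeasurable g)]
    rfl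
  rw [h2, Lp.norm_def]
  refine ENNReal.toReal_mono (Lp.eLpNorm_ne_top g) ?_
  have := eLpNorm_le_eLpNorm_mul_rpow_measure_univ (p := 1) (q := 2) (μ := lam)
    one_le_two (Lp.aestronglyMeasurable g)
  simpa using this


/-- The pairs `(x, x')` with `x ∈ W^{1,2}(0,1)` and `∫ x = 0`. -/
def sobolevPairs : Submodule ℝ (L2 × L2) where
  carrier := {z | IsWeakDeriv z.1 z.2 ∧ ∫ t, z.1 t ∂lam = 0}
  zero_mem' := by
    constructor
    · intro η _ _ _
      have h : ((0 : L2) : ℝ → ℝ) =ᵐ[lam] 0 := Lp.coeFn_zero _ _ _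
      have h1 : ∫ t, ((0 : L2) : ℝ → ℝ) t * deriv η t ∂lam = 0 :=
        integral_eq_zero_of_ae (by filter_upwards [h] with t ht; rw [ht]; simp)
      have h2 : ∫ t, ((0 : L2) : ℝ → ℝ) t * η t ∂lam = 0 :=
        integral_eq_zero_of_ae (by filter_upwards [h] with t ht; rw [ht]; simp)
      simp only [Prod.fst_zero, Prod.snd_zero]
      rw [h1, h2, neg_zero]
    · exact integral_eq_zero_of_ae (Lp.coeFn_zero _ _ _)
  add_mem' := by
    rintro ⟨x, g⟩ ⟨x', g'⟩ ⟨h1, h2⟩ ⟨h1', h2'⟩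
    have hx := Lp.coeFn_add x x'
    have hg := Lp.coeFn_add g g'
    constructor
    · intro η hη hc hs
      have a1 := h1 η hη hc hs
      have a2 := h1' η hη hc hs
      have hd : Continuous (deriv η) := hη.continuous_deriv (by simp)
      simp only [Prod.fst_add, Prod.snd_add] at a1 a2 ⊢
      rw [integral_congr_ae (g := fun t => x t * deriv η t + x' t * deriv η t)
          (by filter_upwards [hx] with t ht; rw [ht, Pi.add_apply, add_mul]),
        integral_congr_ae (f := fun t => (g + g' : L2) t * η t) (g := fun t => g t * η t + g' t * η t)
          (by filter_upwards [hg] with t ht; rw [ht, Pi.add_apply, add_mul]),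
        integral_add (integrable_mul_of_continuous (L2.integrable x) hd)
          (integrable_mul_of_continuous (L2.integrable x') hd),
        integral_add (integrable_mul_of_continuous (L2.integrable g) hη.continuous)
          (integrable_mul_of_continuous (L2.integrable g') hη.continuous), a1, a2]
      ring
    · simp only [Prod.fst_add] at h2 h2' ⊢
      rw [integral_congr_ae hx]
      simp only [Pi.add_apply]
      rw [integral_add (L2.integrable x) (L2.integrable x'), h2, h2', add_zero]
  smul_mem' := by
    rintro c ⟨x, g⟩ ⟨h1, h2⟩
    have hx := Lp.coeFn_smul c x
    have hg := Lp.coeFn_smul c g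
    constructor
    · intro η hη hc hs
      have a1 := h1 η hη hc hs
      simp only [Prod.smul_fst, Prod.smul_snd] at a1 ⊢
      rw [integral_congr_ae (g := fun t => c * (x t * deriv η t))
          (by filter_upwards [hx] with t ht; rw [ht, Pi.smul_apply, smul_eq_mul, mul_assoc]),
        integral_congr_ae (f := fun t => (c • g : L2) t * η t) (g := fun t => c * (g t * η t))
          (by filter_upwards [hg] with t ht; rw [ht, Pi.smul_apply, smul_eq_mul, mul_assoc]),
        integral_const_mul, integral_const_mul, a1]
      ring
    · simp only [Prod.smul_fst] at h2 ⊢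
      rw [integral_congr_ae hx]
      simp only [Pi.smul_apply, smul_eq_mul]
      rw [integral_const_mul, h2, mul_zero]

/-- The space `X` of all `x ∈ W^{1,2}(0,1)` with `∫ x = 0`; it is normed below by the inner
product `(x, y) ↦ ∫ x' y'` (and not by the norm of `L² × L²`). -/
def X : Type := sobolevPairs

namespace X

instance : AddCommGroup X := inferInstanceAs (AddCommGroup sobolevPairs)
instance : Module ℝ X := inferInstanceAs (Module ℝ sobolevPairs)

/-- The underlying function of an element of `X`. -/
def toL2 (x : X) : L2 := (Subtype.val (p := fun z => z ∈ sobolevPairs) x).1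

/-- The weak derivative of an element of `X`. -/
def weakDeriv (x : X) : L2 := (Subtype.val (p := fun z => z ∈ sobolevPairs) x).2

/-- The element of `X` with given underlying function and weak derivative. -/
def mk (x g : L2) (h : IsWeakDeriv x g) (h0 : ∫ t, x t ∂lam = 0) : X :=
  (⟨(x, g), h, h0⟩ : sobolevPairs)

lemma isWeakDeriv (x : X) : IsWeakDeriv x.toL2 x.weakDeriv :=
  (Subtype.property (p := fun z => z ∈ sobolevPairs) x).1

lemma integral_eq_zero (x : X) : ∫ t, x.toL2 t ∂lam = 0 :=
  (Subtype.property (p := fun z => z ∈ sobolevPairs) x).2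

lemma ext' {x y : X} (h : x.toL2 = y.toL2) (h' : x.weakDeriv = y.weakDeriv) : x = y :=
  Subtype.ext (p := fun z => z ∈ sobolevPairs) (Prod.ext h h')

lemma toL2_add (x y : X) : (x + y).toL2 = x.toL2 + y.toL2 := rfl
lemma toL2_smul (c : ℝ) (x : X) : (c • x).toL2 = c • x.toL2 := rfl
lemma weakDeriv_add (x y : X) : (x + y).weakDeriv = x.weakDeriv + y.weakDeriv := rfl
lemma weakDeriv_smul (c : ℝ) (x : X) : (c • x).weakDeriv = c • x.weakDeriv := rfl

end X

lemma prim_isWeakDeriv {g : ℝ → ℝ} (hg : Integrable g lam) (c : ℝ) :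
    IsWeakDeriv (fun t => prim g t - c) g := by
  intro η hη hc hs
  have h1 : η 1 = 0 := image_eq_zero_of_notMem_tsupport fun h => by simpa using (hs h).2
  have h0 : η 0 = 0 := image_eq_zero_of_notMem_tsupport fun h => by simpa using (hs h).1
  have hη1 : ContDiff ℝ 1 η := hη.of_le (by simp)
  have hd : Continuous (deriv η) := hη.continuous_deriv (by simp)
  have hint : Integrable (fun t => prim g t * deriv η t) lam :=
    (((continuousOn_prim hg).mul hd.continuousOn).integrableOn_Icc).mono_set Ioo_subset_Icc_self
  have hdi : Integrable (deriv η) lam :=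
    (hd.continuousOn.integrableOn_Icc (a := 0) (b := 1)).mono_set Ioo_subset_Icc_self
  have hz : ∫ t, deriv η t ∂lam = 0 := by
    rw [integral_lam, intervalIntegral.integral_deriv_eq_sub
      (fun t _ => (hη1.differentiable one_ne_zero) t) (hd.intervalIntegrable _ _), h0, h1, sub_zero]
  have : (fun t => (prim g t - c) * deriv η t) = fun t => prim g t * deriv η t - c * deriv η t := by
    funext t; ring
  rw [this, integral_sub hint (hdi.const_mul c), integral_const_mul, hz, prim_ibp hg hη1, h1]
  ring

lemma X.ae_eq (x : X) : x.toL2 =ᵐ[lam]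
    fun t => prim x.weakDeriv t - ∫ s, prim x.weakDeriv s ∂lam := by
  have hg := L2.integrable x.weakDeriv
  have hpi : Integrable (prim x.weakDeriv) lam :=
    (continuousOn_prim hg).integrableOn_Icc.mono_set Ioo_subset_Icc_self
  have hpi0 : Integrable (fun t => prim x.weakDeriv t - 0) lam := by simpa using hpi
  obtain ⟨c, hc⟩ := ae_eq_const_of_weakDeriv_zero
    (x := fun t => x.toL2 t - (prim x.weakDeriv t - 0)) ((L2.integrable _).sub hpi0) (by
      intro η hη hcs hs
      have hd : Continuous (deriv η) := hη.continuous_deriv (by simp)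
      have e : ∀ t, (x.toL2 t - (prim x.weakDeriv t - 0)) * deriv η t
          = x.toL2 t * deriv η t - (prim x.weakDeriv t - 0) * deriv η t := fun t => sub_mul _ _ _
      simp only [e]
      rw [integral_sub (integrable_mul_of_continuous (L2.integrable _) hd)
        (integrable_mul_of_continuous hpi0 hd), x.isWeakDeriv η hη hcs hs,
        prim_isWeakDeriv hg 0 η hη hcs hs]
      simp)
  have hci : ∫ t, (x.toL2 t - (prim x.weakDeriv t - 0)) ∂lam = c := by
    rw [integral_congr_ae hc]; simp
  rw [integral_sub (L2.integrable _) hpi0, x.integral_eq_zero] at hci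
  simp only [sub_zero, zero_sub] at hci
  filter_upwards [hc] with t ht
  simp only [sub_zero] at ht
  rw [← sub_eq_zero, sub_sub_eq_add_sub]
  linarith

namespace X

/-- The inner product `(x, y) ↦ ∫ x' y'` on `X`. -/
@[reducible] def core : InnerProductSpace.Core ℝ X where
  inner x y := ∫ t, x.weakDeriv t * y.weakDeriv t ∂lam
  conj_inner_symm x y := by simp [mul_comm]
  re_inner_nonneg x := integral_nonneg fun t => mul_self_nonneg _
  add_left x y z := by
    simp only [integral_mul_eq_inner, weakDeriv_add, inner_add_left]
  smul_left x y r := by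
    simp only [integral_mul_eq_inner, weakDeriv_smul, inner_smul_left]
  definite x h := by
    have hw : x.weakDeriv = 0 := by
      rw [integral_mul_eq_inner] at h; exact inner_self_eq_zero.mp h
    refine ext' ?_ hw
    have h0 : ∀ t ∈ Icc (0 : ℝ) 1, prim x.weakDeriv t = 0 := by
      intro t ht
      have := abs_prim_le x.weakDeriv ht
      rw [hw, norm_zero] at this
      rw [hw]
      exact abs_nonpos_iff.mp this
    have hi : ∫ s, prim x.weakDeriv s ∂lam = 0 :=
      setIntegral_eq_zero_of_forall_eq_zero fun t ht => h0 t ⟨ht.1.le, ht.2.le⟩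
    refine Lp.ext (x.ae_eq.trans ?_)
    refine EventuallyEq.trans ?_ (Lp.coeFn_zero ℝ 2 lam).symm
    filter_upwards [ae_restrict_mem measurableSet_Ioo] with t ht
    rw [hi, h0 t ⟨ht.1.le, ht.2.le⟩]; simp

instance : NormedAddCommGroup X := core.toNormedAddCommGroup
instance : InnerProductSpace ℝ X := InnerProductSpace.ofCore core.toCore

lemma inner_eq (x y : X) : inner ℝ x y = ∫ t, x.weakDeriv t * y.weakDeriv t ∂lam := rfl

lemma norm_eq (x : X) : ‖x‖ = ‖x.weakDeriv‖ := by
  rw [@norm_eq_sqrt_real_inner X, @norm_eq_sqrt_real_inner L2, inner_eq, integral_mul_eq_inner]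

/-- Differentiation `X → L²(0,1)`, a linear isometry. -/
def derivL : X →ₗᵢ[ℝ] L2 where
  toFun := weakDeriv
  map_add' := weakDeriv_add
  map_smul' := weakDeriv_smul
  norm_map' x := (norm_eq x).symm

lemma derivL_surjective : Function.Surjective derivL := by
  intro g
  have hg := L2.integrable g
  let c : ℝ := ∫ s, prim g s ∂lam
  have hm : MemLp (fun t => prim g t - c) 2 lam := by
    refine MemLp.of_bound (C := ‖g‖ + |c|) ?_ ?_
    · exact (((continuousOn_prim hg).mono Ioo_subset_Icc_self).aestronglyMeasurable
        measurableSet_Ioo).sub aestronglyMeasurable_const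
    · filter_upwards [ae_restrict_mem measurableSet_Ioo] with t ht
      exact (norm_sub_le _ _).trans (add_le_add (abs_prim_le g ⟨ht.1.le, ht.2.le⟩) le_rfl)
  have he := hm.coeFn_toLp
  refine ⟨mk hm.toLp g ?_ ?_, rfl⟩
  · intro η hη hc hs
    rw [← prim_isWeakDeriv hg c η hη hc hs]
    exact integral_congr_ae (by filter_upwards [he] with t ht; rw [ht])
  · have hpi : Integrable (prim g) lam :=
      (continuousOn_prim hg).integrableOn_Icc.mono_set Ioo_subset_Icc_self
    rw [integral_congr_ae he, integral_sub hpi (integrable_const c)]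
    simp [c]

instance : CompleteSpace X :=
  (LinearIsometryEquiv.ofSurjective derivL derivL_surjective).toIsometryEquiv.completeSpace

/-- The embedding `X → L²(0,1)`. -/
def incl : X →L[ℝ] L2 :=
  LinearMap.mkContinuous ⟨⟨toL2, toL2_add⟩, toL2_smul⟩ 2 fun x => by
    have hb : ∀ᵐ t ∂lam, ‖x.toL2 t‖ ≤ 2 * ‖x‖ := by
      have hc : |∫ s, prim x.weakDeriv s ∂lam| ≤ ‖x‖ := by
        have := norm_setIntegral_le_of_norm_le_const (μ := volume) (s := Ioo (0 : ℝ) 1)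
          (f := prim x.weakDeriv) (C := ‖x‖) (by simp)
          (fun t ht => by
            rw [norm_eq]; exact abs_prim_le x.weakDeriv ⟨ht.1.le, ht.2.le⟩)
        simpa using this
      filter_upwards [x.ae_eq, ae_restrict_mem measurableSet_Ioo] with t ht htm
      rw [ht]
      refine (norm_sub_le _ _).trans ?_
      have h1 := abs_prim_le x.weakDeriv (t := t) ⟨htm.1.le, htm.2.le⟩
      rw [← norm_eq] at h1
      rw [Real.norm_eq_abs, Real.norm_eq_abs]
      linarith
    have := Lp.norm_le_of_ae_bound (p := 2) (μ := lam) (f := x.toL2) (by positivity) hb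
    simpa [measureUnivNNReal] using this

end X

/-- The dual space of `X`, with its canonical (operator) norm and inner product. -/
abbrev U : Type := StrongDual ℝ X

instance : InnerProductSpace ℝ U where
  inner u v := inner ℝ ((InnerProductSpace.toDual ℝ X).symm u) ((InnerProductSpace.toDual ℝ X).symm v)
  norm_sq_eq_re_inner u := by
    simp
  conj_inner_symm u v := inner_conj_symm (𝕜 := ℝ) _ _
  add_left u v w := by simp [inner_add_left]
  smul_left u v r := by simp [inner_smul_left]

/-- The isometric isomorphism `B : X → U`, `Bx(y) = ∫ x' y'`. -/
def B : X ≃L[ℝ] U := (InnerProductSpace.toDual ℝ X).toContinuousLinearEquiv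

lemma B_apply (x y : X) : B x y = ∫ t, x.weakDeriv t * y.weakDeriv t ∂lam := rfl

/-- The element `y ↦ ∫ x y` of `U` that is identified with `x ∈ L²(0,1)`. -/
def ofL2 : L2 →L[ℝ] U :=
  (ContinuousLinearMap.compL ℝ X L2 ℝ).flip X.incl ∘L innerSL ℝ

lemma ofL2_apply (x : L2) (y : X) : ofL2 x y = ∫ t, x t * y.toL2 t ∂lam := by
  rw [integral_mul_eq_inner]; rfl

/-- The inverse of `B`, regarded as a bounded operator on `U ⊇ X`. -/
def Binv : U →L[ℝ] U := ofL2 ∘L X.incl ∘L (B.symm : U →L[ℝ] X)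

/-- The operator `Q = -(-B²)⁻¹ = B⁻²` on `U`. -/
def Q : U →L[ℝ] U := Binv ∘L Binv

/-- The function `√2 cos((k+1)π ·)`; indices are shifted by one, so that they start at `0`. -/
def eFun (k : ℕ) (t : ℝ) : ℝ := √2 * Real.cos ((k + 1) * Real.pi * t)

lemma eFun_memLp (k : ℕ) : MemLp (eFun k) 2 lam := by
  refine MemLp.of_bound (C := √2) (by unfold eFun; fun_prop) (Eventually.of_forall fun t => ?_)
  rw [eFun, norm_mul, Real.norm_of_nonneg (Real.sqrt_nonneg _)]
  exact mul_le_of_le_one_right (Real.sqrt_nonneg _) (Real.abs_cos_le_one _)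

/-- `√2 cos((k+1)π ·)` as an element of `L²(0,1)`. -/
def eL2 (k : ℕ) : L2 := (eFun_memLp k).toLp

/-- The orthonormal basis `f_k = kπ e_k`, `k ≥ 1`, of `U` that diagonalizes `Q`. -/
def fBasis (k : ℕ) : U := ((k + 1) * Real.pi) • ofL2 (eL2 k)

/-- The eigenvalue `(π(k+1))⁻⁴` of `Q`, belonging to `fBasis k`. -/
def eig (k : ℕ) : ℝ := 1 / (Real.pi * (k + 1)) ^ 4

lemma X.ibp (y : X) {η : ℝ → ℝ} (hη : ContDiff ℝ 1 η) (h0 : η 0 = 0) (h1 : η 1 = 0) :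
    ∫ t, y.toL2 t * deriv η t ∂lam = -∫ t, y.weakDeriv t * η t ∂lam := by
  have hg := L2.integrable y.weakDeriv
  have hd : Continuous (deriv η) := hη.continuous_deriv le_rfl
  have hint : Integrable (fun t => prim y.weakDeriv t * deriv η t) lam :=
    (((continuousOn_prim hg).mul hd.continuousOn).integrableOn_Icc).mono_set Ioo_subset_Icc_self
  have hdi : Integrable (deriv η) lam :=
    (hd.continuousOn.integrableOn_Icc (a := 0) (b := 1)).mono_set Ioo_subset_Icc_self
  have hz : ∫ t, deriv η t ∂lam = 0 := by
    rw [integral_lam, intervalIntegral.integral_deriv_eq_sub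
      (fun t _ => (hη.differentiable one_ne_zero) t) (hd.intervalIntegrable _ _), h0, h1, sub_zero]
  rw [integral_congr_ae (g := fun t => prim y.weakDeriv t * deriv η t
      - (∫ s, prim y.weakDeriv s ∂lam) * deriv η t)
      (by filter_upwards [y.ae_eq] with t ht; rw [ht, sub_mul]),
    integral_sub hint (hdi.const_mul _), integral_const_mul, hz, prim_ibp hg hη, h1]
  ring

lemma Binv_fBasis (k : ℕ) : Binv (fBasis k) = (1 / (Real.pi * (k + 1)) ^ 2) • fBasis k := by
  have hk : (0 : ℝ) < (k + 1) * Real.pi := by positivity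
  set a : ℝ := (k + 1) * Real.pi with ha
  let s : ℝ → ℝ := fun t => √2 * Real.sin (a * t)
  have hs : ContDiff ℝ ∞ s := by unfold s; fun_prop
  have hsd : ∀ t, HasDerivAt s (a * eFun k t) t := by
    intro t
    have := ((Real.hasDerivAt_sin (a * t)).comp t ((hasDerivAt_id t).const_mul a)).const_mul √2
    refine (show HasDerivAt s _ t from this).congr_deriv ?_
    simp only [eFun, ← ha]; ring
  have hed : ∀ t, HasDerivAt (eFun k) (-(a * s t)) t := by
    intro t
    have := ((Real.hasDerivAt_cos (a * t)).comp t ((hasDerivAt_id t).const_mul a)).const_mul √2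
    refine (show HasDerivAt (eFun k) _ t from this).congr_deriv ?_
    simp only [s]; ring
  have hs0 : s 0 = 0 := by simp [s]
  have hs1 : s 1 = 0 := by
    have := Real.sin_nat_mul_pi (k + 1)
    push_cast at this
    simp [s, ha, this]
  have hsm : MemLp (fun t => -(a * s t)) 2 lam := by
    refine MemLp.of_bound (C := a * √2) (by unfold s; fun_prop) (Eventually.of_forall fun t => ?_)
    rw [norm_neg, norm_mul, Real.norm_of_nonneg hk.le, norm_mul,
      Real.norm_of_nonneg (Real.sqrt_nonneg _)]
    gcongr
    exact mul_le_of_le_one_right (Real.sqrt_nonneg _) (Real.abs_sin_le_one _)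
  have hec : ContDiff ℝ ∞ (eFun k) := by unfold eFun; fun_prop
  have heq : eL2 k =ᵐ[lam] eFun k := (eFun_memLp k).coeFn_toLp
  have hsq := hsm.coeFn_toLp
  have hdse : deriv s = fun t => a * eFun k t := funext fun t => (hsd t).deriv
  have hmean : ∫ t, eL2 k t ∂lam = 0 := by
    rw [integral_congr_ae heq]
    have : ∫ t, deriv s t ∂lam = 0 := by
      rw [integral_lam, intervalIntegral.integral_deriv_eq_sub
        (fun t _ => (hsd t).differentiableAt)
        ((hs.continuous_deriv (by simp)).intervalIntegrable _ _), hs0, hs1, sub_zero]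
    rw [hdse, integral_const_mul] at this
    exact (mul_eq_zero.mp this).resolve_left hk.ne'
  have hweak : IsWeakDeriv (eL2 k) (hsm.toLp : L2) := by
    intro η hη hc hsupp
    have h1 : η 1 = 0 := image_eq_zero_of_notMem_tsupport fun h => by simpa using (hsupp h).2
    have h0 : η 0 = 0 := image_eq_zero_of_notMem_tsupport fun h => by simpa using (hsupp h).1
    rw [integral_congr_ae (g := fun t => eFun k t * deriv η t)
        (by filter_upwards [heq] with t ht; rw [ht]),
      integral_congr_ae (f := fun t => (hsm.toLp : L2) t * η t) (g := fun t => -(a * s t) * η t)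
        (by filter_upwards [hsq] with t ht; rw [ht]),
      integral_lam, integral_lam,
      intervalIntegral.integral_mul_deriv_eq_deriv_mul (fun t _ => hed t)
        (fun t _ => ((hη.differentiable (by simp)) t).hasDerivAt)
        ((by fun_prop : Continuous fun t => -(a * s t)).intervalIntegrable _ _)
        ((hη.continuous_deriv (by simp)).intervalIntegrable _ _), h0, h1]
    simp
  let e : X := X.mk (eL2 k) hsm.toLp hweak hmean
  have hB : B e = a • fBasis k := by
    ext y
    rw [B_apply, fBasis, _root_.smul_apply, _root_.smul_apply, ofL2_apply, ← ha]
    have h1 := y.ibp (hs.of_le (by simp)) hs0 hs1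
    rw [hdse] at h1
    rw [integral_congr_ae (g := fun t => -(a * (y.weakDeriv t * s t)))
        (by
          filter_upwards [hsq] with t ht
          change (hsm.toLp : L2) t * _ = _
          rw [ht]; ring),
      integral_congr_ae (f := fun t => eL2 k t * y.toL2 t)
        (g := fun t => eFun k t * y.toL2 t) (by filter_upwards [heq] with t ht; rw [ht]),
      integral_neg, integral_const_mul, ← mul_neg, ← h1, smul_eq_mul, smul_eq_mul,
      show (fun t => y.toL2 t * (a * eFun k t)) = fun t => a * (eFun k t * y.toL2 t) from
        funext fun t => by ring, integral_const_mul]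
  have hf : fBasis k = B (a⁻¹ • e) := by
    rw [map_smul, hB, smul_smul, inv_mul_cancel₀ hk.ne', one_smul]
  have h2 : Binv (fBasis k) = a⁻¹ • ofL2 (eL2 k) := by
    conv_lhs => rw [hf]
    simp only [Binv, ContinuousLinearMap.comp_apply, ContinuousLinearEquiv.coe_coe,
      ContinuousLinearEquiv.symm_apply_apply, map_smul]
    rfl
  rw [h2, fBasis, smul_smul, ← ha]
  congr 1
  rw [mul_comm Real.pi, ← ha]
  field_simp

lemma Q_fBasis (k : ℕ) : Q (fBasis k) = eig k • fBasis k := by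
  rw [Q, ContinuousLinearMap.comp_apply, Binv_fBasis, map_smul, Binv_fBasis, smul_smul]
  congr 1
  rw [eig]
  field_simp

/-- The power `Q^θ`. -/
def Qpow (θ : ℝ) : U → U := GaussianSobolev.diagPow fBasis eig θ

/-- `u ∈ U` is (identified with) the element `x` of `L^p(0,1)` with `∫ x = 0`. -/
def IsIdentified (p : ℝ) (x : ℝ → ℝ) (u : U) : Prop :=
  MemLp x (ENNReal.ofReal p) lam ∧ ∫ t, x t ∂lam = 0 ∧ ∀ y : X, u y = ∫ t, x t * y.toL2 t ∂lam

open Classical in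
/-- The potential `Φ₁`: `∫₀¹ φ(u(ξ)) dξ` if `u` is in `L^p(0,1)` with mean zero, and `∞` otherwise. -/
def Phi1 (φ : ℝ → ℝ) (p : ℝ) (u : U) : EReal :=
  if h : ∃ x, IsIdentified p x u then ((∫ t, φ (h.choose t) ∂lam : ℝ) : EReal) else ⊤

end CahnHilliard

end

open MeasureTheory Set Filter Topology ProbabilityTheory
open scoped ENNReal NNReal ContDiff

noncomputable section

/-! Expand `u` in the basis: the truncated expansion `modeSum s (u, t)` is, for fixed `t`, a
centered Gaussian variable whose variance is at most `2 ∑ freq k ^ 2 * eig k ^ α₁`. Since `freq k ^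
2 * eig k ^ s = freq k ^ (2 - 4 * s)`, the series converges for `s > 3/4`
(`summable_freq_sq_mul_eig`). Summing over blocks with geometrically decaying variance shows that
along a subsequence `N` the mode sums converge almost everywhere on `U × (0,1)` to a function `Z`
and are dominated by some `Y ∈ L^{2p}` (`exists_process`, `IsModeLimit`). Almost every `u` is then
identified with `Z (u, ·)`, so the potential is `∫ φ (Z (u, t)) dt`.

For membership in the Sobolev space, `φ` is replaced by smooth compactly supported functions and `u`
by its truncation, with a common index. The coordinates of the gradient are `modeCoeff (φ' ∘ Z)`,
bounded by `√2 * freq k` times the `L¹` norm of `φ' ∘ Z`. Applying `Q^α` makes them square summable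
as soon as `2α > 3/4`: the same series gives the second threshold (`norm_smoothed_le`,
`norm_Qpow_avgGrad_sub_le`). Dominated convergence with weight `(1 + |Y|) ^ p ∈ L²` then yields
convergence of the functions and of the gradients (`IsModeLimit.isSobolevGrad`).

The other two claims concern an arbitrary gradient `G`, possibly for another power, so its
coordinates have to be identified. Gaussian integration by parts along an eigenvector gives a weak
formulation that depends only on the potential; testing with sines and cosines determines each
coordinate up to the factor `ev i ^ θ` (`IsSobolevGrad.inner_ae_eq`). A bounded `φ'` then bounds `G`
through `norm_smoothed_le`. For convex `φ`, the monotone function `φ'` is clipped and averaged,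
which gives convex functions with bounded Lipschitz derivative and unchanged value at `0`; Jensen's
inequality for the mean-zero mode sums provides the lower bound (`exists_convex_approx`, `le_avg`).
-/

/-! ### Differentiation under the integral sign, to all orders. -/

lemma integrable_fderiv_apply_of_bounded {α E G : Type*} [MeasurableSpace α] {ν : Measure α}
    [IsFiniteMeasure ν] [NormedAddCommGroup E] [NormedSpace ℝ E] [NormedAddCommGroup G]
    [NormedSpace ℝ G] {g : α → E → G} {z : E}
    (hdm : AEStronglyMeasurable (fun t => fderiv ℝ (g t) z) ν) {C : ℝ}
    (hdb : ∀ t, ‖fderiv ℝ (g t) z‖ ≤ C) (v : E) :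
    Integrable (fun t => fderiv ℝ (g t) z v) ν :=
  (Integrable.of_bound hdm C (Eventually.of_forall hdb)).apply_continuousLinearMap v

/-- The measure is finite, so the constant `C` is a dominating function. Describing `L` by its
values only lets callers supply it as a curried multilinear map or as the inner product with a
gradient. -/
lemma hasFDerivAt_integral_of_bounded {α E G : Type*} [MeasurableSpace α] {ν : Measure α}
    [IsFiniteMeasure ν] [NormedAddCommGroup E] [NormedSpace ℝ E] [NormedAddCommGroup G]
    [NormedSpace ℝ G] {g : α → E → G} (hg : ∀ t, Differentiable ℝ (g t))
    (hm : ∀ z, AEStronglyMeasurable (fun t => g t z) ν) {z : E}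
    (hint : Integrable (fun t => g t z) ν)
    (hdm : AEStronglyMeasurable (fun t => fderiv ℝ (g t) z) ν) {C : ℝ}
    (hdb : ∀ t y, ‖fderiv ℝ (g t) y‖ ≤ C) {L : E →L[ℝ] G}
    (hL : ∀ v, L v = ∫ t, fderiv ℝ (g t) z v ∂ν) :
    HasFDerivAt (fun z => ∫ t, g t z ∂ν) L z := by
  have hi := Integrable.of_bound hdm C (Eventually.of_forall fun t => hdb t z)
  have : L = ∫ t, fderiv ℝ (g t) z ∂ν := by
    ext v
    rw [hL, ContinuousLinearMap.integral_apply hi]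
  rw [this]
  exact hasFDerivAt_integral_of_dominated_of_fderiv_le (bound := fun _ => C)
    (F' := fun z t => fderiv ℝ (g t) z) (s := univ) univ_mem (Eventually.of_forall hm) hint hdm
    (Eventually.of_forall fun t y _ => hdb t y) (integrable_const _)
    (Eventually.of_forall fun t y _ => (hg t y).hasFDerivAt)

/-- The integrals of the iterated derivatives form a Taylor series of the integral; each is
differentiable by domination with the bound for the next order. -/
lemma contDiff_integral_of_bounded {α E : Type*} [MeasurableSpace α] {ν : Measure α}
    [IsFiniteMeasure ν] [NormedAddCommGroup E] [NormedSpace ℝ E] {F : α → E → ℝ}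
    (hF : ∀ t, ContDiff ℝ ∞ (F t))
    (hm : ∀ k z, AEStronglyMeasurable (fun t => iteratedFDeriv ℝ k (F t) z) ν)
    (hb : ∀ k : ℕ, ∃ C : ℝ, ∀ t z, ‖iteratedFDeriv ℝ k (F t) z‖ ≤ C) :
    ContDiff ℝ ∞ (fun z => ∫ t, F t z ∂ν) ∧
      ∀ k : ℕ, ∃ C : ℝ, ∀ z, ‖iteratedFDeriv ℝ k (fun z => ∫ t, F t z ∂ν) z‖ ≤ C := by
  choose C hC using hb
  have hint : ∀ k z, Integrable (fun t => iteratedFDeriv ℝ k (F t) z) ν := fun k z =>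
    Integrable.of_bound (hm k z) (C k) (Eventually.of_forall fun t => hC k t z)
  have hder : ∀ (k : ℕ) (z : E), HasFDerivAt (fun z => ∫ t, iteratedFDeriv ℝ k (F t) z ∂ν)
      (∫ t, iteratedFDeriv ℝ (k + 1) (F t) z ∂ν).curryLeft z := by
    intro k z
    have hd : ∀ t, fderiv ℝ (iteratedFDeriv ℝ k (F t)) z
        = (continuousMultilinearCurryLeftEquiv ℝ (fun _ : Fin (k + 1) => E) ℝ)
            (iteratedFDeriv ℝ (k + 1) (F t) z) := by
      intro t
      simp only [fderiv_iteratedFDeriv, Function.comp_apply]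
    have hdm : AEStronglyMeasurable (fun t => fderiv ℝ (iteratedFDeriv ℝ k (F t)) z) ν := by
      simp only [hd]
      exact (LinearIsometryEquiv.continuous _).comp_aestronglyMeasurable (hm (k + 1) z)
    have hdb : ∀ t y, ‖fderiv ℝ (iteratedFDeriv ℝ k (F t)) y‖ ≤ C (k + 1) := fun t y => by
      rw [norm_fderiv_iteratedFDeriv]
      exact hC (k + 1) t y
    refine hasFDerivAt_integral_of_bounded (fun t => (hF t).differentiable_iteratedFDeriv
      (m := k) (by exact_mod_cast WithTop.coe_lt_top _)) (hm k) (hint k z) hdm hdb fun v => ?_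
    ext m
    have hi : Integrable (fun t => fderiv ℝ (iteratedFDeriv ℝ k (F t)) z v) ν :=
      integrable_fderiv_apply_of_bounded hdm (fun t => hdb t z) v
    rw [ContinuousMultilinearMap.curryLeft_apply,
      ContinuousMultilinearMap.integral_apply (hint (k + 1) z),
      ContinuousMultilinearMap.integral_apply hi]
    simp only [hd]
    rfl
  have hT : HasFTaylorSeriesUpTo ∞ (fun z => ∫ t, F t z ∂ν)
      (fun z k => ∫ t, iteratedFDeriv ℝ k (F t) z ∂ν) := by
    refine ⟨fun z => ?_, fun k _ z => hder k z, fun k _ => ?_⟩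
    · rw [ContinuousMultilinearMap.curry0, ContinuousMultilinearMap.integral_apply (hint 0 z)]
      simp
    · exact continuous_iff_continuousAt.mpr fun z => (hder k z).continuousAt
  refine ⟨hT.contDiff, fun k => ⟨C k * ν.real univ, fun z => ?_⟩⟩
  rw [← hT.eq_iteratedFDeriv (by exact_mod_cast le_top) z]
  exact norm_integral_le_of_norm_le_const (Eventually.of_forall fun t => hC k t z)

lemma iteratedFDeriv_comp_dual {E : Type*} [NormedAddCommGroup E] [NormedSpace ℝ E] {f : ℝ → ℝ}
    (hf : ContDiff ℝ ∞ f) (L : E →L[ℝ] ℝ) (k : ℕ) (z : E) :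
    iteratedFDeriv ℝ k (fun z => f (L z)) z
      = (iteratedFDeriv ℝ k f (L z)).compContinuousLinearMap fun _ => L :=
  L.iteratedFDeriv_comp_right hf z (by exact_mod_cast le_top)

/-- By the chain rule the `k`-th derivative of the integrand is that of `f` precomposed with `w t`:
continuous in `t`, and bounded by `C * W ^ k`. This is what turns averages over `(0,1)` into smooth
cylinder functions. -/
lemma contDiff_integral_comp_dual {E : Type*} [NormedAddCommGroup E] [NormedSpace ℝ E]
    {ν : Measure ℝ} [IsFiniteMeasure ν] {f : ℝ → ℝ} (hf : ContDiff ℝ ∞ f)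
    (hb : ∀ k : ℕ, ∃ C : ℝ, ∀ x, ‖iteratedFDeriv ℝ k f x‖ ≤ C) {w : ℝ → E →L[ℝ] ℝ}
    (hw : Continuous w) {W : ℝ} (hW : ∀ t, ‖w t‖ ≤ W) :
    ContDiff ℝ ∞ (fun z => ∫ t, f (w t z) ∂ν) ∧
      ∀ k : ℕ, ∃ C : ℝ, ∀ z, ‖iteratedFDeriv ℝ k (fun z => ∫ t, f (w t z) ∂ν) z‖ ≤ C := by
  refine contDiff_integral_of_bounded (F := fun t z => f (w t z))
    (fun t => hf.comp (w t).contDiff) (fun k z => ?_) fun k => ?_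
  · refine Continuous.aestronglyMeasurable ?_
    simp only [iteratedFDeriv_comp_dual hf]
    have h1 : Continuous fun t => iteratedFDeriv ℝ k f (w t z) :=
      (hf.continuous_iteratedFDeriv (m := k) (by exact_mod_cast le_top)).comp
        (hw.clm_apply continuous_const)
    have h2 : Continuous fun t =>
        ContinuousMultilinearMap.compContinuousLinearMapContinuousMultilinear ℝ
          (fun _ : Fin k => E) (fun _ : Fin k => ℝ) ℝ (fun _ => w t) :=
      (ContinuousMultilinearMap.cont _).comp (continuous_pi fun _ => hw)
    exact h2.clm_apply h1
  · obtain ⟨C, hC⟩ := hb k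
    have hC0 : 0 ≤ C := (norm_nonneg _).trans (hC 0)
    refine ⟨C * W ^ k, fun t z => ?_⟩
    rw [iteratedFDeriv_comp_dual hf]
    refine (ContinuousMultilinearMap.norm_compContinuousLinearMap_le _ _).trans ?_
    rw [Finset.prod_const, Finset.card_univ, Fintype.card_fin]
    exact mul_le_mul (hC _) (pow_le_pow_left₀ (norm_nonneg _) (hW t) k) (by positivity) hC0

lemma iteratedFDeriv_bounded_of_hasCompactSupport {f : ℝ → ℝ} (hf : ContDiff ℝ ∞ f)
    (hc : HasCompactSupport f) (k : ℕ) : ∃ C : ℝ, ∀ x, ‖iteratedFDeriv ℝ k f x‖ ≤ C :=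
  (hc.iteratedFDeriv k).exists_bound_of_continuous
    (hf.continuous_iteratedFDeriv (m := k) (by exact_mod_cast le_top))

/-! ### Smooth and convex approximation of scalar functions. -/

lemma one_add_abs_rpow_le {p x y : ℝ} (hp : 0 ≤ p) (h : |y - x| ≤ 1) :
    (1 + |y|) ^ p ≤ 2 ^ p * (1 + |x|) ^ p := by
  rw [← Real.mul_rpow (by norm_num) (by positivity)]
  refine Real.rpow_le_rpow (by positivity) ?_ hp
  have := abs_sub_abs_le_abs_sub y x
  have := abs_nonneg x
  linarith

/-- A bump function of radius `1 / (j + 1)`. -/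
def mollifier (j : ℕ) : ContDiffBump (0 : ℝ) where
  rIn := 1 / (2 * (j + 1))
  rOut := 1 / (j + 1)
  rIn_pos := by positivity
  rIn_lt_rOut := by
    rw [div_lt_div_iff₀ (by positivity) (by positivity)]
    nlinarith [(j.cast_nonneg : (0 : ℝ) ≤ j)]

/-- The convolution of `g` with a normed bump function of radius `1 / (j + 1)`. -/
def mollify (j : ℕ) (g : ℝ → ℝ) : ℝ → ℝ :=
  convolution ((mollifier j).normed volume) g (ContinuousLinearMap.lsmul ℝ ℝ) volume

lemma contDiff_mollify (j : ℕ) {g : ℝ → ℝ} (hg : Continuous g) : ContDiff ℝ ∞ (mollify j g) :=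
  (ContDiffBump.hasCompactSupport_normed _).contDiff_convolution_left _
    (ContDiffBump.contDiff_normed _) hg.locallyIntegrable

lemma hasCompactSupport_mollify (j : ℕ) {g : ℝ → ℝ} (hg : HasCompactSupport g) :
    HasCompactSupport (mollify j g) :=
  HasCompactSupport.convolution _ (ContDiffBump.hasCompactSupport_normed _) hg

lemma deriv_mollify (j : ℕ) {g : ℝ → ℝ} (hg : ContDiff ℝ 1 g) (hc : HasCompactSupport g) :
    deriv (mollify j g) = mollify j (deriv g) :=
  funext fun x => (hc.hasDerivAt_convolution_right _
    (ContDiffBump.continuous_normed _).locallyIntegrable hg x).deriv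

/-- Mollification averages over a ball of radius at most `1`, which costs only the factor `2 ^ p`,
uniformly in `j`. -/
lemma abs_mollify_le (j : ℕ) {g : ℝ → ℝ} (hg : Continuous g) {C p : ℝ} (hp : 0 ≤ p)
    (hb : ∀ t, |g t| ≤ C * (1 + |t|) ^ p) (x : ℝ) :
    |mollify j g x| ≤ C * 2 ^ p * (1 + |x|) ^ p := by
  have hC : 0 ≤ C := by simpa using (abs_nonneg _).trans (hb 0)
  have := dist_convolution_le (μ := volume) (z₀ := (0 : ℝ)) (x₀ := x)
    (ε := C * 2 ^ p * (1 + |x|) ^ p) (by positivity)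
    (ContDiffBump.support_normed_eq (μ := volume) (mollifier j)).subset (ContDiffBump.nonneg_normed _) (ContDiffBump.integral_normed _)
    hg.aestronglyMeasurable (g := g) ?_
  · simpa [mollify] using this
  · intro y hy
    rw [Metric.mem_ball, Real.dist_eq] at hy
    have h1 : |y - x| ≤ 1 := by
      refine hy.le.trans ?_
      change 1 / ((j : ℝ) + 1) ≤ 1
      rw [div_le_one (by positivity)]
      linarith [(j.cast_nonneg : (0 : ℝ) ≤ j)]
    rw [dist_zero_right, Real.norm_eq_abs]
    refine (hb y).trans ?_
    rw [mul_assoc]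
    exact mul_le_mul_of_nonneg_left (one_add_abs_rpow_le hp h1) hC

lemma tendsto_mollify {g : ℕ → ℝ → ℝ} (hg : ∀ j, Continuous (g j)) {x z : ℝ}
    (hcg : Tendsto (Function.uncurry g) (atTop ×ˢ 𝓝 x) (𝓝 z)) {xs : ℕ → ℝ}
    (hx : Tendsto xs atTop (𝓝 x)) : Tendsto (fun j => mollify j (g j) (xs j)) atTop (𝓝 z) :=
  ContDiffBump.convolution_tendsto_right (by exact tendsto_one_div_add_atTop_nhds_zero_nat)
    (Eventually.of_forall fun j => (hg j).aestronglyMeasurable) hcg hx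

/-- Cut `φ` off at scale `j + 1`, then mollify at scale `1 / (j + 1)`. Compact support bounds every
derivative for fixed `j`, while the growth bounds are uniform in `j`. Convergence along moving
points `xs` is required because `f j` will be evaluated at the `j`-th mode sum rather than at its
limit. -/
lemma exists_smooth_approx {φ : ℝ → ℝ} (hφ : ContDiff ℝ 1 φ) {C p : ℝ} (hp : 0 ≤ p)
    (hb : ∀ t, |φ t| ≤ C * (1 + |t|) ^ p) (hb' : ∀ t, |deriv φ t| ≤ C * (1 + |t|) ^ p) :
    ∃ f : ℕ → ℝ → ℝ, (∀ j, ContDiff ℝ ∞ (f j)) ∧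
      (∀ j k, ∃ C' : ℝ, ∀ x, ‖iteratedFDeriv ℝ k (f j) x‖ ≤ C') ∧
      (∃ C' : ℝ, ∀ j t, |f j t| ≤ C' * (1 + |t|) ^ p ∧ |deriv (f j) t| ≤ C' * (1 + |t|) ^ p) ∧
      (∀ (x : ℝ) (xs : ℕ → ℝ), Tendsto xs atTop (𝓝 x) →
        Tendsto (fun j => f j (xs j)) atTop (𝓝 (φ x)) ∧
        Tendsto (fun j => deriv (f j) (xs j)) atTop (𝓝 (deriv φ x))) := by
  have hC : 0 ≤ C := by simpa using (abs_nonneg _).trans (hb 0)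
  let χ : ContDiffBump (0 : ℝ) := ⟨1, 2, by norm_num, by norm_num⟩
  have hχ : ContDiff ℝ 1 χ := χ.contDiff
  obtain ⟨K, hK⟩ := (χ.hasCompactSupport.deriv).exists_bound_of_continuous
    (hχ.continuous_deriv le_rfl)
  have hK0 : 0 ≤ K := (norm_nonneg _).trans (hK 0)
  have hφd : Differentiable ℝ φ := hφ.differentiable one_ne_zero
  let ψ : ℕ → ℝ → ℝ := fun j t => χ ((j + 1 : ℝ)⁻¹ * t) * φ t
  have hψ : ∀ j, ContDiff ℝ 1 (ψ j) := fun j =>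
    (hχ.comp (contDiff_const.mul contDiff_id)).mul hφ
  have hψc : ∀ j, HasCompactSupport (ψ j) := fun j => by
    refine HasCompactSupport.mul_right ?_
    exact χ.hasCompactSupport.comp_smul (c := ((j : ℝ) + 1)⁻¹) (by positivity)
  have hψd : ∀ j t, deriv (ψ j) t = (j + 1 : ℝ)⁻¹ * deriv χ ((j + 1 : ℝ)⁻¹ * t) * φ t
      + χ ((j + 1 : ℝ)⁻¹ * t) * deriv φ t := by
    intro j t
    have h1 : HasDerivAt (fun t => χ ((j + 1 : ℝ)⁻¹ * t))
        (deriv χ ((j + 1 : ℝ)⁻¹ * t) * (j + 1 : ℝ)⁻¹) t := by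
      have := ((hχ.differentiable one_ne_zero) ((j + 1 : ℝ)⁻¹ * t)).hasDerivAt
      exact this.comp t (by simpa using (hasDerivAt_id t).const_mul (j + 1 : ℝ)⁻¹)
    exact (h1.mul (hφd t).hasDerivAt).deriv.trans (by ring)
  have hχ1 : ∀ s, |χ s| ≤ 1 := fun s => by
    rw [abs_of_nonneg χ.nonneg]; exact χ.le_one
  have hψb : ∀ j t, |ψ j t| ≤ (K + 1) * C * (1 + |t|) ^ p := by
    intro j t
    rw [abs_mul]
    calc _ ≤ 1 * (C * (1 + |t|) ^ p) :=
          mul_le_mul (hχ1 _) (hb t) (abs_nonneg _) zero_le_one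
      _ ≤ _ := by
          rw [mul_assoc]
          exact mul_le_mul_of_nonneg_right (by linarith) (by positivity)
  have hψb' : ∀ j t, |deriv (ψ j) t| ≤ (K + 1) * C * (1 + |t|) ^ p := by
    intro j t
    rw [hψd]
    have hj : |(j + 1 : ℝ)⁻¹| ≤ 1 := by
      rw [abs_of_nonneg (by positivity)]
      exact inv_le_one_of_one_le₀ (by linarith [(j.cast_nonneg : (0 : ℝ) ≤ j)])
    have h1 : |(j + 1 : ℝ)⁻¹ * deriv χ ((j + 1 : ℝ)⁻¹ * t) * φ t| ≤ 1 * K * (C * (1 + |t|) ^ p) := by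
      rw [abs_mul, abs_mul]
      exact mul_le_mul (mul_le_mul hj (hK _) (abs_nonneg _) zero_le_one) (hb t) (abs_nonneg _)
        (by positivity)
    have h2 : |χ ((j + 1 : ℝ)⁻¹ * t) * deriv φ t| ≤ 1 * (C * (1 + |t|) ^ p) := by
      rw [abs_mul]
      exact mul_le_mul (hχ1 _) (hb' t) (abs_nonneg _) zero_le_one
    refine (abs_add_le _ _).trans ?_
    linarith
  -- Near any point the cut-off is eventually inactive. Equality on a neighbourhood of `q.2`, not
  -- just at `q.2`, makes the derivatives agree as well.
  have hev : ∀ x : ℝ, ∀ᶠ q : ℕ × ℝ in atTop ×ˢ 𝓝 x, ∀ᶠ y in 𝓝 q.2, ψ q.1 y = φ y := by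
    intro x
    have h1 : ∀ᶠ j : ℕ in atTop, |x| + 1 < (j : ℝ) + 1 :=
      (tendsto_natCast_atTop_atTop.atTop_add tendsto_const_nhds).eventually_gt_atTop _
    have h2 : ∀ᶠ y : ℝ in 𝓝 x, |y| < |x| + 1 :=
      (continuous_abs.tendsto x).eventually_lt_const (by linarith)
    filter_upwards [h1.prod_mk h2] with q hq
    filter_upwards [(continuous_abs.tendsto q.2).eventually_lt_const hq.2] with y hy
    have : χ ((q.1 + 1 : ℝ)⁻¹ * y) = 1 := by
      refine χ.one_of_mem_closedBall ?_
      rw [Metric.mem_closedBall, dist_zero_right, norm_mul, norm_inv, Real.norm_eq_abs,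
        Real.norm_eq_abs, abs_of_pos (by positivity : (0 : ℝ) < q.1 + 1)]
      change _ ≤ (1 : ℝ)
      rw [inv_mul_le_one₀ (by positivity)]
      linarith [hq.1]
    simp [ψ, this]
  refine ⟨fun j => mollify j (ψ j), fun j => contDiff_mollify j (hψ j).continuous, fun j k =>
    iteratedFDeriv_bounded_of_hasCompactSupport (contDiff_mollify j (hψ j).continuous)
      (hasCompactSupport_mollify j (hψc j)) k, ⟨(K + 1) * C * 2 ^ p, fun j t => ⟨?_, ?_⟩⟩,
    fun x xs hx => ⟨?_, ?_⟩⟩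
  · exact abs_mollify_le j (hψ j).continuous hp (hψb j) t
  · rw [deriv_mollify j (hψ j) (hψc j)]
    exact abs_mollify_le j ((hψ j).continuous_deriv le_rfl) hp (hψb' j) t
  · refine tendsto_mollify (fun j => (hψ j).continuous) ?_ hx
    refine Tendsto.congr' (f₁ := fun q : ℕ × ℝ => φ q.2) ?_
      ((hφ.continuous.tendsto x).comp tendsto_snd)
    filter_upwards [hev x] with q hq
    exact hq.self_of_nhds.symm
  · have : (fun j => deriv (mollify j (ψ j)) (xs j)) = fun j => mollify j (deriv (ψ j)) (xs j) := by
      funext j; rw [deriv_mollify j (hψ j) (hψc j)]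
    rw [this]
    refine tendsto_mollify (g := fun j => deriv (ψ j))
      (fun j => (hψ j).continuous_deriv le_rfl) ?_ hx
    refine Tendsto.congr' (f₁ := fun q : ℕ × ℝ => deriv φ q.2) ?_
      (((hφ.continuous_deriv le_rfl).tendsto x).comp tendsto_snd)
    filter_upwards [hev x] with q hq
    exact (EventuallyEq.deriv_eq hq).symm

/-- The construction acts on the monotone function `φ'`: clipping its argument makes it bounded,
averaging it over a short window makes it Lipschitz, and both keep it monotone, so the primitives
are convex. Prescribing the value at `0` prepares the lower bound by Jensen's inequality. -/
lemma exists_convex_approx {φ : ℝ → ℝ} (hφ : ContDiff ℝ 1 φ) (hconv : ConvexOn ℝ univ φ)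
    {C p : ℝ} (hp : 1 ≤ p) (hb : ∀ t, |deriv φ t| ≤ C * (1 + |t|) ^ (p - 1)) :
    ∃ f : ℕ → ℝ → ℝ, (∀ m, ContDiff ℝ 1 (f m)) ∧ (∀ m, ConvexOn ℝ univ (f m)) ∧
      (∀ m, f m 0 = φ 0) ∧ (∀ m, ∃ M, ∀ t, |deriv (f m) t| ≤ M) ∧
      (∀ m, ∃ K : ℝ≥0, LipschitzWith K (deriv (f m))) ∧
      (∃ C' : ℝ, ∀ m t, |f m t| ≤ C' * (1 + |t|) ^ p ∧ |deriv (f m) t| ≤ C' * (1 + |t|) ^ p) ∧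
      (∀ t, Tendsto (fun m => f m t) atTop (𝓝 (φ t))) ∧
      (∀ t, Tendsto (fun m => deriv (f m) t) atTop (𝓝 (deriv φ t))) := by
  have hC : 0 ≤ C := by simpa using (abs_nonneg _).trans (hb 0)
  have hφd : Differentiable ℝ φ := hφ.differentiable one_ne_zero
  have hdc : Continuous (deriv φ) := hφ.continuous_deriv le_rfl
  have hdm : Monotone (deriv φ) := fun x y hxy =>
    hconv.monotoneOn_deriv (fun x _ => hφd x) (mem_univ x) (mem_univ y) hxy
  have hq : 0 ≤ p - 1 := by linarith
  let clip : ℕ → ℝ → ℝ := fun m t => max (-m) (min m t)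
  have hclip : ∀ m t, |clip m t| ≤ |t| := by
    intro m t
    have hm : (0 : ℝ) ≤ m := m.cast_nonneg
    rw [abs_le]
    constructor
    · exact le_max_of_le_right (le_min (by linarith [abs_nonneg t]) (neg_abs_le t))
    · exact max_le (by linarith [abs_nonneg t]) ((min_le_right _ _).trans (le_abs_self t))
  have hclip' : ∀ m t, |clip m t| ≤ m := by
    intro m t
    have hm : (0 : ℝ) ≤ m := m.cast_nonneg
    exact abs_le.mpr ⟨le_max_left _ _, max_le (by linarith) (min_le_left _ _)⟩
  have hclipm : ∀ m, Monotone (clip m) := fun m x y hxy =>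
    max_le_max le_rfl (min_le_min le_rfl hxy)
  let g : ℕ → ℝ → ℝ := fun m t => deriv φ (clip m t)
  have hgc : ∀ m, Continuous (g m) := fun m => hdc.comp (by unfold clip; fun_prop)
  have hgm : ∀ m, Monotone (g m) := fun m => hdm.comp (hclipm m)
  have hgM : ∀ m t, |g m t| ≤ C * (1 + m) ^ (p - 1) := fun m t => (hb _).trans
    (mul_le_mul_of_nonneg_left (Real.rpow_le_rpow (by positivity) (by linarith [hclip' m t]) hq) hC)
  have hgb : ∀ m t, |g m t| ≤ C * (1 + |t|) ^ (p - 1) := fun m t => (hb _).trans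
    (mul_le_mul_of_nonneg_left (Real.rpow_le_rpow (by positivity) (by linarith [hclip m t]) hq) hC)
  let A : ℕ → ℝ → ℝ := fun m t => ∫ s in (0 : ℝ)..t, g m s
  have hA : ∀ m t, HasDerivAt (A m) (g m t) t := fun m t =>
    intervalIntegral.integral_hasDerivAt_right ((hgc m).intervalIntegrable _ _)
      ((hgc m).stronglyMeasurableAtFilter _ _) (hgc m).continuousAt
  let δ : ℕ → ℝ := fun m => 1 / ((m : ℝ) + 1)
  have hδ : ∀ m, 0 < δ m := fun m => by positivity
  have hδ1 : ∀ m, δ m ≤ 1 := fun m => by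
    rw [div_le_one (by positivity)]; linarith [(m.cast_nonneg : (0 : ℝ) ≤ m)]
  -- The mean of `g m` over `[t, t + δ m]`, as a difference quotient of its primitive. Its
  -- derivative is a difference quotient of the bounded function `g m`, hence bounded; by the mean
  -- value theorem it equals `g m` at an intermediate point, which yields growth and convergence.
  let a : ℕ → ℝ → ℝ := fun m t => (A m (t + δ m) - A m t) / δ m
  have ha : ∀ m t, ∃ c ∈ Ioo t (t + δ m), a m t = g m c := by
    intro m t
    obtain ⟨c, hc, h⟩ := exists_hasDerivAt_eq_slope (A m) (g m) (a := t) (b := t + δ m)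
      (by linarith [hδ m]) (fun s _ => (hA m s).continuousAt.continuousWithinAt)
      (fun s _ => hA m s)
    refine ⟨c, hc, ?_⟩
    rw [h]; simp [a]
  have haM : ∀ m t, |a m t| ≤ C * (1 + m) ^ (p - 1) := fun m t => by
    obtain ⟨c, -, h⟩ := ha m t
    rw [h]; exact hgM m c
  have had : ∀ m t, HasDerivAt (a m) ((g m (t + δ m) - g m t) / δ m) t := fun m t =>
    (((hA m (t + δ m)).comp_add_const t (δ m)).sub (hA m t)).div_const _
  have hac : ∀ m, Continuous (a m) := fun m =>
    continuous_iff_continuousAt.mpr fun t => (had m t).continuousAt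
  have ham : ∀ m, Monotone (a m) := fun m => monotone_of_deriv_nonneg
    (fun t => (had m t).differentiableAt) fun t => by
      rw [(had m t).deriv]
      exact div_nonneg (sub_nonneg.mpr (hgm m (by linarith [hδ m]))) (hδ m).le
  have hab : ∀ m t, |a m t| ≤ C * 2 ^ (p - 1) * (1 + |t|) ^ (p - 1) := by
    intro m t
    obtain ⟨c, hc, h⟩ := ha m t
    rw [h, mul_assoc]
    refine (hgb m c).trans (mul_le_mul_of_nonneg_left (one_add_abs_rpow_le hq ?_) hC)
    rw [abs_of_nonneg (by linarith [hc.1])]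
    linarith [hc.2, hδ1 m]
  have hat : ∀ t, Tendsto (fun m => a m t) atTop (𝓝 (deriv φ t)) := by
    intro t
    choose c hc h using fun m => ha m t
    have hct : Tendsto c atTop (𝓝 t) := by
      refine tendsto_of_tendsto_of_tendsto_of_le_of_le tendsto_const_nhds
        (h := fun m => t + δ m) ?_ (fun m => (hc m).1.le) (fun m => (hc m).2.le)
      simpa [δ] using tendsto_one_div_add_atTop_nhds_zero_nat.const_add t
    refine ((hdc.tendsto t).comp hct).congr' ?_
    -- From this index on the clipping is inactive on `[t, t + 1]`, which contains the intermediate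
    -- point.
    filter_upwards [eventually_ge_atTop ⌈|t| + 1⌉₊] with m hm
    have hm' : |t| + 1 ≤ m := (Nat.le_ceil _).trans (by exact_mod_cast hm)
    have hcm : |c m| ≤ m := by
      rw [abs_le]
      constructor
      · linarith [(hc m).1, neg_abs_le t]
      · linarith [(hc m).2, hδ1 m, le_abs_self t]
    rw [h]
    simp only [Function.comp_apply, g, clip]
    rw [min_eq_right (abs_le.mp hcm).2, max_eq_right (abs_le.mp hcm).1]
  let f : ℕ → ℝ → ℝ := fun m t => φ 0 + ∫ s in (0 : ℝ)..t, a m s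
  have hf : ∀ m t, HasDerivAt (f m) (a m t) t := fun m t =>
    (intervalIntegral.integral_hasDerivAt_right ((hac m).intervalIntegrable _ _)
      ((hac m).stronglyMeasurableAtFilter _ _) (hac m).continuousAt).const_add _
  have hfd : ∀ m, deriv (f m) = a m := fun m => funext fun t => (hf m t).deriv
  have hpow : ∀ t : ℝ, (1 + |t|) ^ (p - 1) ≤ (1 + |t|) ^ p := fun t =>
    Real.rpow_le_rpow_of_exponent_le (by linarith [abs_nonneg t]) (by linarith)
  have hpow1 : ∀ t : ℝ, 1 ≤ (1 + |t|) ^ p := fun t =>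
    Real.one_le_rpow (by linarith [abs_nonneg t]) (by linarith)
  have hC2 : 0 ≤ C * 2 ^ (p - 1) := by positivity
  refine ⟨f, fun m => ?_, fun m => ?_, fun m => by simp [f], fun m => ?_, fun m => ?_,
    ⟨|φ 0| + C * 2 ^ (p - 1), fun m t => ⟨?_, ?_⟩⟩, fun t => ?_, fun t => ?_⟩
  · rw [contDiff_one_iff_deriv, hfd]
    exact ⟨fun t => (hf m t).differentiableAt, hac m⟩
  · exact Monotone.convexOn_univ_of_deriv (fun t => (hf m t).differentiableAt)
      (by rw [hfd]; exact ham m)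
  · rw [hfd]; exact ⟨_, haM m⟩
  · rw [hfd]
    have hK : 0 ≤ 2 * (C * (1 + (m : ℝ)) ^ (p - 1)) / δ m := by have := hδ m; positivity
    refine ⟨Real.toNNReal (2 * (C * (1 + (m : ℝ)) ^ (p - 1)) / δ m),
      lipschitzWith_of_nnnorm_deriv_le (fun t => (had m t).differentiableAt)
      fun t => ?_⟩
    rw [← NNReal.coe_le_coe, coe_nnnorm, Real.coe_toNNReal _ hK, (had m t).deriv, norm_div, Real.norm_of_nonneg (hδ m).le]
    refine div_le_div_of_nonneg_right ?_ (hδ m).le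
    refine (norm_sub_le _ _).trans ?_
    have := hgM m t
    have := hgM m (t + δ m)
    simp only [Real.norm_eq_abs]
    linarith
  · have h1 : ‖∫ s in (0 : ℝ)..t, a m s‖ ≤ C * 2 ^ (p - 1) * (1 + |t|) ^ (p - 1) * |t - 0| := by
      refine intervalIntegral.norm_integral_le_of_norm_le_const fun s hs => ?_
      have hst : |s| ≤ |t| := by
        rcases le_total 0 t with h | h
        · rw [uIoc_of_le h] at hs
          rw [abs_of_pos hs.1, abs_of_nonneg h]; exact hs.2
        · rw [uIoc_of_ge h] at hs
          rw [abs_of_nonpos hs.2, abs_of_nonpos h]; linarith [hs.1]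
      refine (hab m s).trans (mul_le_mul_of_nonneg_left ?_ hC2)
      exact Real.rpow_le_rpow (by positivity) (by linarith) hq
    -- Integrating a bound of order `p - 1` over an interval of length `|t|` raises the order to
    -- `p`.
    have h2 : (1 + |t|) ^ (p - 1) * |t| ≤ (1 + |t|) ^ p := by
      have e : (1 + |t|) ^ p = (1 + |t|) ^ (p - 1) * (1 + |t|) := by
        rw [← Real.rpow_add_one (by positivity)]; ring_nf
      rw [e]
      exact mul_le_mul_of_nonneg_left (by linarith) (by positivity)
    refine (abs_add_le _ _).trans ?_
    rw [sub_zero, mul_assoc, Real.norm_eq_abs] at h1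
    have h3 := mul_le_mul_of_nonneg_left h2 hC2
    have h4 := mul_le_mul_of_nonneg_left (hpow1 t) (abs_nonneg (φ 0))
    linarith
  · rw [hfd]
    refine (hab m t).trans ?_
    have h3 := mul_le_mul_of_nonneg_left (hpow t) hC2
    have h4 : 0 ≤ |φ 0| * (1 + |t|) ^ p := by positivity
    linarith
  · have h1 : Tendsto (fun m => ∫ s in (0 : ℝ)..t, a m s) atTop
        (𝓝 (∫ s in (0 : ℝ)..t, deriv φ s)) := by
      refine intervalIntegral.tendsto_integral_filter_of_dominated_convergence
        (fun s => C * 2 ^ (p - 1) * (1 + |s|) ^ (p - 1))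
        (Eventually.of_forall fun m => (hac m).aestronglyMeasurable)
        (Eventually.of_forall fun m => Eventually.of_forall fun s _ => hab m s) ?_
        (Eventually.of_forall fun s _ => hat s)
      refine Continuous.intervalIntegrable (continuous_const.mul ?_) _ _
      exact (continuous_const.add continuous_abs).rpow_const fun s => Or.inr hq
    rw [intervalIntegral.integral_deriv_eq_sub (fun s _ => hφd s)
      (hdc.intervalIntegrable _ _)] at h1
    simpa [f] using h1.const_add (φ 0)
  · simp only [hfd]; exact hat t

/-! ### Gaussian integration by parts. -/

lemma hasDerivAt_gaussianPDFReal_zero {v : ℝ≥0} (hv : v ≠ 0) (x : ℝ) :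
    HasDerivAt (gaussianPDFReal 0 v) (-(x / v) * gaussianPDFReal 0 v x) x := by
  have hv' : (v : ℝ) ≠ 0 := by exact_mod_cast hv
  simp only [gaussianPDFReal_def]
  have h1 : HasDerivAt (fun x : ℝ => -(x - 0) ^ 2 / (2 * v)) (-(x / v)) x := by
    have := (((hasDerivAt_id x).sub_const 0).pow 2).neg.div_const (2 * (v : ℝ))
    refine (this.congr_deriv ?_)
    simp
    field_simp
  refine (h1.exp.const_mul _).congr_deriv ?_
  ring

/-- Gaussian integration by parts on the line. -/
lemma integral_deriv_gaussianReal {v : ℝ≥0} (hv : v ≠ 0) {h h' : ℝ → ℝ}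
    (hd : ∀ x, HasDerivAt h (h' x) x) (hm : Measurable h') {C : ℝ} (hb : ∀ x, |h x| ≤ C)
    (hb' : ∀ x, |h' x| ≤ C) :
    ∫ x, h' x ∂(gaussianReal 0 v) = (v : ℝ)⁻¹ * ∫ x, x * h x ∂(gaussianReal 0 v) := by
  have hv' : (v : ℝ) ≠ 0 := by exact_mod_cast hv
  have hc : Continuous h := continuous_iff_continuousAt.mpr fun x => (hd x).continuousAt
  have hp := integrable_gaussianPDFReal 0 v
  have hxp : Integrable (fun x => x * gaussianPDFReal 0 v x) := by
    have h1 : Integrable (fun x : ℝ => x) (gaussianReal 0 v) :=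
      (memLp_id_gaussianReal 1).integrable le_rfl
    rw [gaussianReal_of_var_ne_zero _ hv, integrable_withDensity_iff_integrable_smul'
      (measurable_gaussianPDF _ _) (ae_of_all _ fun _ => gaussianPDF_lt_top)] at h1
    simpa [mul_comm] using h1
  rw [integral_gaussianReal_eq_integral_smul hv, integral_gaussianReal_eq_integral_smul hv]
  simp only [smul_eq_mul]
  have key := integral_mul_deriv_eq_deriv_mul_of_integrable (u := gaussianPDFReal 0 v)
    (u' := fun x => -(x / v) * gaussianPDFReal 0 v x) (v := h) (v' := h')
    (fun x _ => hasDerivAt_gaussianPDFReal_zero hv x) (fun x _ => hd x)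
    (hp.mul_bdd (c := C) hm.aestronglyMeasurable (Eventually.of_forall hb'))
    (by
      have := (hxp.const_mul (-(v : ℝ)⁻¹)).mul_bdd (c := C) hc.aestronglyMeasurable
        (Eventually.of_forall hb)
      refine this.congr (Eventually.of_forall fun x => ?_)
      simp only [Pi.mul_apply]
      field_simp)
    (hp.mul_bdd (c := C) hc.aestronglyMeasurable (Eventually.of_forall hb))
  rw [key, ← integral_neg, ← integral_const_mul]
  refine integral_congr_ae (Eventually.of_forall fun x => ?_)
  simp only
  field_simp

namespace GaussianSobolev

variable {H : Type*} [NormedAddCommGroup H] [InnerProductSpace ℝ H] [CompleteSpace H]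
  [SecondCountableTopology H] [MeasurableSpace H] [BorelSpace H] {μ : Measure H}

lemma map_inner_eq_gaussianReal [IsGaussian μ] (h0 : ∫ x, x ∂μ = 0) (w : H) :
    μ.map (fun u => inner ℝ w u) = gaussianReal 0 (covarianceBilin μ w w).toNNReal := by
  have h1 := IsGaussian.map_eq_gaussianReal (μ := μ) (innerSL ℝ w)
  have h2 : ∫ x, innerSL ℝ w x ∂μ = 0 := by
    rw [IsGaussian.integral_dual, h0, map_zero]
  rw [h2, show Var[innerSL ℝ w; μ] = covarianceBilin μ w w from
    (covarianceBilin_self IsGaussian.memLp_two_id w).symm] at h1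
  exact h1

/-- If `b` is a unit eigenvector of the covariance, the coordinate along `b` and the complementary
component are independent. -/
lemma indepFun_coord [IsGaussian μ] {b : H} (hb : ‖b‖ = 1) {l : ℝ}
    (hcov : ∀ y, covarianceBilin μ b y = l * inner ℝ b y) :
    IndepFun (fun u => inner ℝ b u) (fun u => u - (inner ℝ b u : ℝ) • b) μ := by
  have hG : HasGaussianLaw (fun u => ((inner ℝ b u : ℝ), u - (inner ℝ b u : ℝ) • b)) μ := by
    let L : H →L[ℝ] ℝ × H :=
      (innerSL ℝ b).prod (ContinuousLinearMap.id ℝ H - (innerSL ℝ b).smulRight b)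
    exact (IsGaussian.hasGaussianLaw_id (μ := μ)).map L
  -- The pair is jointly Gaussian, so it suffices that covariances vanish; they are multiples of `l
  -- * (⟪b, y⟫ - ⟪b, y⟫ * ‖b‖ ^ 2) = 0`.
  refine hG.indepFun_of_covariance_inner fun x y => ?_
  have h1 : ∀ u : H, inner ℝ y (u - (inner ℝ b u : ℝ) • b)
      = inner ℝ (y - (inner ℝ b y : ℝ) • b) u := by
    intro u
    rw [inner_sub_right, inner_sub_left, inner_smul_left, inner_smul_right, real_inner_comm y b]
    simp [mul_comm]
  have h2 : ∀ u : H, inner ℝ x (inner ℝ b u : ℝ) = x * (inner ℝ b u : ℝ) := fun u => by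
    simp [mul_comm]
  simp only [h1, h2]
  rw [covariance_const_mul_left, ← covarianceBilin_apply_eq_cov IsGaussian.memLp_two_id, hcov,
    inner_sub_right, inner_smul_right, real_inner_self_eq_norm_sq, hb]
  simp

/-- By independence the joint law of the coordinate and the remainder is a product, and Fubini
disintegrates `μ` along the lines parallel to `b`. -/
lemma integral_eq_integral_prod_coord [IsGaussian μ] (h0 : ∫ x, x ∂μ = 0) {b : H} (hb : ‖b‖ = 1)
    {l : ℝ≥0} (hcov : ∀ y, covarianceBilin μ b y = l * inner ℝ b y) {f : ℝ × H → ℝ}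
    (hf : Measurable f)
    (hi : Integrable (fun u => f (inner ℝ b u, u - (inner ℝ b u : ℝ) • b)) μ) :
    ∫ u, f (inner ℝ b u, u - (inner ℝ b u : ℝ) • b) ∂μ
      = ∫ w, ∫ z, f (z, w) ∂(gaussianReal 0 l)
        ∂(μ.map fun u => u - (inner ℝ b u : ℝ) • b) := by
  have hm1 : Measurable fun u : H => (inner ℝ b u : ℝ) := by fun_prop
  have hm2 : Measurable fun u : H => u - (inner ℝ b u : ℝ) • b := by fun_prop
  have hl : (covarianceBilin μ b b).toNNReal = l := by
    rw [hcov, real_inner_self_eq_norm_sq, hb]; simp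
  have h1 := (indepFun_iff_map_prod_eq_prod_map_map hm1.aemeasurable hm2.aemeasurable).mp
    (indepFun_coord hb hcov)
  rw [map_inner_eq_gaussianReal h0, hl] at h1
  have := Measure.isProbabilityMeasure_map (μ := μ) hm2.aemeasurable
  rw [← integral_prod_symm, ← h1, integral_map (hm1.prodMk hm2).aemeasurable
    hf.aestronglyMeasurable]
  rw [← h1, integrable_map_measure hf.aestronglyMeasurable (hm1.prodMk hm2).aemeasurable]
  exact hi

/-- Gaussian integration by parts in the direction of a unit eigenvector of the covariance. -/
lemma integral_deriv_direction [IsGaussian μ] (h0 : ∫ x, x ∂μ = 0) {b : H} (hb : ‖b‖ = 1)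
    {l : ℝ≥0} (hl : l ≠ 0) (hcov : ∀ y, covarianceBilin μ b y = l * inner ℝ b y) {F F' : H → ℝ}
    (hd : ∀ u, HasDerivAt (fun s : ℝ => F (u + s • b)) (F' u) 0) (hF : Measurable F)
    (hF' : Measurable F') {C : ℝ} (hC : ∀ u, |F u| ≤ C) (hC' : ∀ u, |F' u| ≤ C) :
    ∫ u, F' u ∂μ = (l : ℝ)⁻¹ * ∫ u, inner ℝ b u * F u ∂μ := by
  have hre : ∀ u : H, u - (inner ℝ b u : ℝ) • b + (inner ℝ b u : ℝ) • b = u := fun u => by simp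
  have hiF' : Integrable F' μ := Integrable.of_bound hF'.aestronglyMeasurable C
    (Eventually.of_forall hC')
  have hib : Integrable (fun u => (inner ℝ b u : ℝ) * F u) μ :=
    Integrable.mul_bdd (c := C) (IsGaussian.integrable_dual μ (innerSL ℝ b))
      hF.aestronglyMeasurable (Eventually.of_forall hC)
  have e1 := integral_eq_integral_prod_coord h0 hb hcov (f := fun q => F' (q.2 + q.1 • b))
    (hF'.comp (by fun_prop)) (by simpa only [hre] using hiF')
  have e2 := integral_eq_integral_prod_coord h0 hb hcov (f := fun q => q.1 * F (q.2 + q.1 • b))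
    (measurable_fst.mul (hF.comp (by fun_prop))) (by simpa only [hre] using hib)
  simp only [hre] at e1 e2
  rw [e1, e2, ← integral_const_mul]
  refine integral_congr_ae (Eventually.of_forall fun w => ?_)
  refine integral_deriv_gaussianReal hl (h := fun z => F (w + z • b)) (fun z => ?_)
    (hF'.comp (by fun_prop)) (fun z => hC _) fun z => hC' _
  have h1 := hd (w + z • b)
  -- The derivative is given at parameter `0` from the base point `w + z • b`; translating the
  -- parameter turns it into the derivative at `z` along the line through `w`.
  rw [← sub_self z] at h1
  have h2 := HasDerivAt.comp_sub_const z z h1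
  refine h2.congr_of_eventuallyEq (Eventually.of_forall fun s => ?_)
  simp only [add_assoc, ← add_smul]
  congr 2
  simp
end GaussianSobolev

/-! ### Diagonal operators and uniqueness of the coordinates of a Sobolev gradient. -/

namespace GaussianSobolev

variable {H : Type*} [NormedAddCommGroup H] [InnerProductSpace ℝ H]

section Orthonormal

variable [CompleteSpace H]

lemma summable_smul_of_orthonormal {b : ℕ → H} (hb : Orthonormal ℝ b) {c : ℕ → ℝ}
    (hc : Summable fun k => c k ^ 2) : Summable fun k => c k • b k := by
  have h := (hb.orthogonalFamily).summable_iff_norm_sq_summable (fun k => c k)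
  simp only [LinearIsometry.toSpanSingleton_apply, Real.norm_eq_abs, sq_abs] at h
  exact h.mpr hc

lemma inner_tsum_smul_of_orthonormal {b : ℕ → H} (hb : Orthonormal ℝ b) {c : ℕ → ℝ}
    (hc : Summable fun k => c k ^ 2) (i : ℕ) : inner ℝ (b i) (∑' k, c k • b k) = c i := by
  have h := (innerSL ℝ (b i)).map_tsum (summable_smul_of_orthonormal hb hc)
  rw [innerSL_apply_apply] at h
  rw [h, tsum_eq_single i]
  · simp [hb.1 i]
  · intro k hk
    simp [hb.2 hk.symm]

lemma norm_tsum_smul_of_orthonormal {b : ℕ → H} (hb : Orthonormal ℝ b) {c : ℕ → ℝ}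
    (hc : Summable fun k => c k ^ 2) : ‖∑' k, c k • b k‖ ^ 2 = ∑' k, c k ^ 2 := by
  have hs := summable_smul_of_orthonormal hb hc
  rw [← real_inner_self_eq_norm_sq]
  have h := (innerSL ℝ (∑' k, c k • b k)).map_tsum hs
  rw [innerSL_apply_apply] at h
  rw [h]
  refine tsum_congr fun k => ?_
  rw [innerSL_apply_apply, inner_smul_right, real_inner_comm,
    inner_tsum_smul_of_orthonormal hb hc, sq]

omit [CompleteSpace H] in
lemma summable_inner_sq {b : ℕ → H} (hb : Orthonormal ℝ b) (x : H) :
    Summable fun k => (inner ℝ (b k) x : ℝ) ^ 2 := by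
  simpa using hb.inner_products_summable (x := x)

omit [CompleteSpace H] in
lemma summable_diagPow_coeff {b : ℕ → H} (hb : Orthonormal ℝ b) {ev : ℕ → ℝ} (h0 : ∀ k, 0 ≤ ev k)
    (h1 : ∀ k, ev k ≤ 1) {θ : ℝ} (hθ : 0 ≤ θ) (x : H) :
    Summable fun k => (ev k ^ θ * inner ℝ (b k) x) ^ 2 := by
  refine Summable.of_nonneg_of_le (fun k => sq_nonneg _) (fun k => ?_) (summable_inner_sq hb x)
  rw [mul_pow]
  refine mul_le_of_le_one_left (sq_nonneg _) ?_
  exact pow_le_one₀ (Real.rpow_nonneg (h0 k) _) (Real.rpow_le_one (h0 k) (h1 k) hθ)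

/-- With eigenvalues in `[0, 1]` and `θ ≥ 0` the coefficients stay square summable. This matters
because `diagPow` is a `tsum`, which takes the default value `0` on a divergent series. -/
lemma inner_diagPow {b : ℕ → H} (hb : Orthonormal ℝ b) {ev : ℕ → ℝ} (h0 : ∀ k, 0 ≤ ev k)
    (h1 : ∀ k, ev k ≤ 1) {θ : ℝ} (hθ : 0 ≤ θ) (x : H) (i : ℕ) :
    inner ℝ (b i) (diagPow b ev θ x) = ev i ^ θ * inner ℝ (b i) x :=
  inner_tsum_smul_of_orthonormal hb (summable_diagPow_coeff hb h0 h1 hθ x) i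

end Orthonormal

section Cylinder

lemma IsSmoothCylinder.contDiff_and_bounded {b : ℕ → H} {F : H → ℝ} (hF : IsSmoothCylinder b F) :
    ContDiff ℝ ∞ F ∧ ∃ C, ∀ u, |F u| ≤ C ∧ ‖fderiv ℝ F u‖ ≤ C := by
  obtain ⟨n, ψ, hψ, hb, rfl⟩ := hF
  let P : H →L[ℝ] (Fin n → ℝ) := ContinuousLinearMap.pi fun i => innerSL ℝ (b i)
  have hP : (fun x : H => ψ fun i : Fin n => inner ℝ (b i) x) = ψ ∘ P := rfl
  rw [hP]
  obtain ⟨C0, hC0⟩ := hb 0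
  obtain ⟨C1, hC1⟩ := hb 1
  have hC1' : 0 ≤ C1 := (norm_nonneg _).trans (hC1 0)
  refine ⟨hψ.comp P.contDiff, max C0 (C1 * ‖P‖), fun u => ⟨le_max_of_le_left ?_,
    le_max_of_le_right ?_⟩⟩
  · simpa [norm_iteratedFDeriv_zero] using hC0 (P u)
  · rw [fderiv_comp u (hψ.differentiable (by simp) _) P.differentiableAt, P.fderiv]
    refine (ContinuousLinearMap.opNorm_comp_le _ _).trans ?_
    refine mul_le_mul_of_nonneg_right ?_ (norm_nonneg _)
    simpa [norm_iteratedFDeriv_one] using hC1 (P u)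

end Cylinder

variable [CompleteSpace H] [SecondCountableTopology H] [MeasurableSpace H] [BorelSpace H]
  {μ : Measure H}

/-- An integrable function whose Fourier transform with respect to `μ` vanishes is zero. -/
lemma ae_eq_zero_of_fourier [IsFiniteMeasure μ] {g : H → ℝ} (hg : Integrable g μ)
    (hcos : ∀ v, ∫ u, g u * Real.cos (inner ℝ u v) ∂μ = 0)
    (hsin : ∀ v, ∫ u, g u * Real.sin (inner ℝ u v) ∂μ = 0) : g =ᵐ[μ] 0 := by
  have hfin1 : IsFiniteMeasure (μ.withDensity fun u => ENNReal.ofReal (g u)) :=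
    isFiniteMeasure_withDensity_ofReal hg.2
  have hfin2 : IsFiniteMeasure (μ.withDensity fun u => ENNReal.ofReal (-g u)) :=
    isFiniteMeasure_withDensity_ofReal hg.neg.2
  have hchar : ∀ {f : H → ℝ}, Integrable f μ → ∀ v,
      charFun (μ.withDensity fun u => ENNReal.ofReal (f u)) v
        = ∫ u, ((max (f u) 0 : ℝ) : ℂ) * Complex.exp (inner ℝ u v * Complex.I) ∂μ := by
    intro f hf v
    rw [charFun_apply, integral_withDensity_eq_integral_toReal_smul₀
      hf.1.aemeasurable.ennreal_ofReal (Eventually.of_forall fun _ => ENNReal.ofReal_lt_top)]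
    refine integral_congr_ae (Eventually.of_forall fun u => ?_)
    simp only [ENNReal.toReal_ofReal', Complex.real_smul]
  have hint : ∀ {f : H → ℝ}, Integrable f μ → ∀ v,
      Integrable (fun u => (f u : ℂ) * Complex.exp (inner ℝ u v * Complex.I)) μ := by
    intro f hf v
    refine hf.ofReal.mul_bdd (c := 1) ?_ (Eventually.of_forall fun u => ?_)
    · exact (by fun_prop : Continuous fun u : H =>
        Complex.exp ((inner ℝ u v : ℝ) * Complex.I)).aestronglyMeasurable
    · rw [Complex.norm_exp_ofReal_mul_I]
  -- The measures with densities `g⁺` and `g⁻` have the same characteristic function, hence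
  -- coincide; as one of the two densities vanishes at each point, both are zero almost everywhere.
  have heq : (μ.withDensity fun u => ENNReal.ofReal (g u))
      = μ.withDensity fun u => ENNReal.ofReal (-g u) := by
    refine Measure.ext_of_charFun (funext fun v => ?_)
    have hneg : Integrable (fun u => -g u) μ := hg.neg
    rw [hchar hg, hchar hneg, ← sub_eq_zero,
      ← integral_sub (hint hg.pos_part v) (hint hneg.pos_part v)]
    have h1 : ∀ u, ((max (g u) 0 : ℝ) : ℂ) * Complex.exp (inner ℝ u v * Complex.I)
        - ((max (-g u) 0 : ℝ) : ℂ) * Complex.exp (inner ℝ u v * Complex.I)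
        = ((g u * Real.cos (inner ℝ u v) : ℝ) : ℂ)
          + ((g u * Real.sin (inner ℝ u v) : ℝ) : ℂ) * Complex.I := by
      intro u
      rw [← sub_mul, ← Complex.ofReal_sub, show max (g u) 0 - max (-g u) 0 = g u by
        rcases le_total 0 (g u) with h | h
        · rw [max_eq_left h, max_eq_right (by linarith)]; ring
        · rw [max_eq_right h, max_eq_left (by linarith)]; ring,
        Complex.exp_mul_I, ← Complex.ofReal_cos, ← Complex.ofReal_sin]
      push_cast
      ring
    have hc : Integrable (fun u => g u * Real.cos (inner ℝ u v)) μ :=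
      hg.mul_bdd (c := 1) (by fun_prop : Continuous fun u : H =>
        Real.cos (inner ℝ u v)).aestronglyMeasurable
        (Eventually.of_forall fun u => Real.abs_cos_le_one _)
    have hs : Integrable (fun u => g u * Real.sin (inner ℝ u v)) μ :=
      hg.mul_bdd (c := 1) (by fun_prop : Continuous fun u : H =>
        Real.sin (inner ℝ u v)).aestronglyMeasurable
        (Eventually.of_forall fun u => Real.abs_sin_le_one _)
    simp only [h1]
    refine (integral_add hc.ofReal (hs.ofReal.mul_const _)).trans ?_
    rw [integral_mul_const, integral_complex_ofReal,
      integral_complex_ofReal, hcos, hsin]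
    simp
  have h2 := (withDensity_eq_iff hg.1.aemeasurable.ennreal_ofReal
    hg.neg.1.aemeasurable.ennreal_ofReal (by
      have := hfin1.measure_univ_lt_top
      rw [withDensity_apply _ MeasurableSet.univ, setLIntegral_univ] at this
      exact this.ne)).mp heq
  filter_upwards [h2] with u hu
  simp only [Pi.neg_apply] at hu
  rcases le_total 0 (g u) with h | h
  · rw [ENNReal.ofReal_of_nonpos (by linarith : -g u ≤ 0), ENNReal.ofReal_eq_zero] at hu
    exact le_antisymm hu h
  · rw [ENNReal.ofReal_of_nonpos h, eq_comm, ENNReal.ofReal_eq_zero] at hu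
    exact le_antisymm h (neg_nonpos.mp hu)

lemma tendsto_integral_mul_of_eLpNorm {α : Type*} [MeasurableSpace α] {ν : Measure α}
    {f : ℕ → α → ℝ} {g k : α → ℝ} (hf : ∀ j, MemLp (f j) 2 ν) (hg : MemLp g 2 ν)
    (hk : MemLp k 2 ν) (h : Tendsto (fun j => eLpNorm (fun x => f j x - g x) 2 ν) atTop (𝓝 0)) :
    Tendsto (fun j => ∫ x, f j x * k x ∂ν) atTop (𝓝 (∫ x, g x * k x ∂ν)) := by
  refine tendsto_integral_of_L1' _ (hg.integrable_mul hk).1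
    (Eventually.of_forall fun j => (hf j).integrable_mul hk) ?_
  refine tendsto_of_tendsto_of_tendsto_of_le_of_le tendsto_const_nhds
    (h := fun j => eLpNorm (fun x => f j x - g x) 2 ν * eLpNorm k 2 ν) ?_ (fun j => bot_le)
    fun j => ?_
  · simpa using ENNReal.Tendsto.mul_const h (Or.inr hk.2.ne)
  · have := eLpNorm_smul_le_mul_eLpNorm (p := 2) (q := 2) (r := 1) (μ := ν) hk.1
      ((hf j).sub hg).1
    refine le_trans (le_of_eq ?_) this
    congr 1
    funext x
    simp [sub_mul]


/-- The weak formulation of the `i`-th component of the Sobolev gradient. -/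
lemma IsSobolevGrad.integral_inner_mul [IsGaussian μ] (h0 : ∫ x, x ∂μ = 0) {b : ℕ → H}
    (hb : Orthonormal ℝ b) {ev : ℕ → ℝ} (hev0 : ∀ k, 0 ≤ ev k) (hev1 : ∀ k, ev k ≤ 1) {θ : ℝ}
    (hθ : 0 ≤ θ) {Φ : H → EReal} {G : H → H} (hG : IsSobolevGrad μ b (diagPow b ev θ) Φ G) {h : H → ℝ}
    (hh : ∀ᵐ x ∂μ, Φ x = (h x : EReal)) {i : ℕ} {l : ℝ≥0} (hl : l ≠ 0)
    (hcov : ∀ y, covarianceBilin μ (b i) y = l * inner ℝ (b i) y) {η η' : H → ℝ}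
    (hη : ∀ u, HasDerivAt (fun s : ℝ => η (u + s • b i)) (η' u) 0) (hηc : Continuous η)
    (hηc' : Continuous η') {C : ℝ} (hC : ∀ u, |η u| ≤ C) (hC' : ∀ u, |η' u| ≤ C) :
    ∫ u, inner ℝ (b i) (G u) * η u ∂μ
      = ev i ^ θ * ∫ u, h u * ((l : ℝ)⁻¹ * (inner ℝ (b i) u * η u) - η' u) ∂μ := by
  obtain ⟨hGm, h₁, hh₁m, hh₁, F, hF, hFh, hFG⟩ := hG
  have hC0 : 0 ≤ C := (abs_nonneg _).trans (hC 0)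
  have hhe : h =ᵐ[μ] h₁ := by
    filter_upwards [hh, hh₁] with u hu hu'
    rw [hu] at hu'
    exact_mod_cast hu'
  have hFd : ∀ j, Differentiable ℝ (F j) := fun j =>
    (hF j).contDiff_and_bounded.1.differentiable (by simp)
  have hFdc : ∀ j, Continuous fun u => fderiv ℝ (F j) u (b i) := fun j =>
    ((hF j).contDiff_and_bounded.1.continuous_fderiv (by simp)).clm_apply continuous_const
  have hFm : ∀ j, MemLp (F j) 2 μ := fun j => by
    obtain ⟨K, hK⟩ := (hF j).contDiff_and_bounded.2
    exact MemLp.of_bound (hFd j).continuous.aestronglyMeasurable K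
      (Eventually.of_forall fun u => (hK u).1)
  have hFdm : ∀ j, MemLp (fun u => fderiv ℝ (F j) u (b i)) 2 μ := fun j => by
    obtain ⟨K, hK⟩ := (hF j).contDiff_and_bounded.2
    refine MemLp.of_bound (hFdc j).aestronglyMeasurable K (Eventually.of_forall fun u => ?_)
    refine ((fderiv ℝ (F j) u).le_opNorm _).trans ?_
    rw [hb.1 i, mul_one]
    exact (hK u).2
  have hinner : ∀ j u, inner ℝ (b i) (diagPow b ev θ (gradient (F j) u))
      = ev i ^ θ * fderiv ℝ (F j) u (b i) := fun j u => by
    rw [inner_diagPow hb hev0 hev1 hθ, real_inner_comm, gradient, InnerProductSpace.toDual_symm_apply]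
  have hηm : MemLp η 2 μ := MemLp.of_bound hηc.aestronglyMeasurable C (Eventually.of_forall hC)
  have hξ : MemLp (fun u => (inner ℝ (b i) u : ℝ)) 2 μ :=
    IsGaussian.memLp_dual μ (innerSL ℝ (b i)) 2 (by simp)
  have hk : MemLp (fun u => (l : ℝ)⁻¹ * (inner ℝ (b i) u * η u) - η' u) 2 μ := by
    refine MemLp.sub (MemLp.const_mul ?_ _)
      (MemLp.of_bound hηc'.aestronglyMeasurable C (Eventually.of_forall hC'))
    refine MemLp.of_le_mul (c := C) hξ (hξ.1.mul hηm.1) (Eventually.of_forall fun u => ?_)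
    rw [norm_mul, mul_comm]
    exact mul_le_mul_of_nonneg_right (hC u) (norm_nonneg _)
  have hGi : MemLp (fun u => (inner ℝ (b i) (G u) : ℝ)) 2 μ :=
    hGm.const_inner (b i)
  have key : ∀ j, ∫ u, (ev i ^ θ * fderiv ℝ (F j) u (b i)) * η u ∂μ
      = ev i ^ θ * ∫ u, F j u * ((l : ℝ)⁻¹ * (inner ℝ (b i) u * η u) - η' u) ∂μ := by
    intro j
    obtain ⟨K, hK⟩ := (hF j).contDiff_and_bounded.2
    have hK0 : 0 ≤ K := (norm_nonneg _).trans (hK 0).2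
    have hDb : ∀ u, |fderiv ℝ (F j) u (b i)| ≤ K := fun u => by
      refine ((fderiv ℝ (F j) u).le_opNorm _).trans ?_
      rw [hb.1 i, mul_one]
      exact (hK u).2
    -- Integrating the derivative of the product `F j * η` moves the derivative off `F j`, so the
    -- right-hand side passes to the limit with only the `L²` convergence of `F j`.
    have hibp := integral_deriv_direction (μ := μ) h0 (hb.1 i) hl hcov (F := fun u => F j u * η u)
      (F' := fun u => fderiv ℝ (F j) u (b i) * η u + F j u * η' u) (C := K * C + K * C)
      (fun u => by
        have h1 : HasDerivAt (fun s : ℝ => F j (u + s • b i)) (fderiv ℝ (F j) u (b i)) 0 := by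
          have h2 : HasDerivAt (fun s : ℝ => u + s • b i) (b i) 0 := by
            simpa using ((hasDerivAt_id (0 : ℝ)).smul_const (b i)).const_add u
          have h3 := (hFd j (u + (0 : ℝ) • b i)).hasFDerivAt.comp_hasDerivAt (0 : ℝ) h2
          exact h3.congr_deriv (by simp)
        exact (h1.mul (hη u)).congr_deriv (by simp))
      ((hFd j).continuous.mul hηc).measurable
      (((hFdc j).mul hηc).add ((hFd j).continuous.mul hηc')).measurable
      (fun u => by
        rw [abs_mul]
        have := mul_le_mul (hK u).1 (hC u) (abs_nonneg _) hK0
        have : 0 ≤ K * C := by positivity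
        linarith)
      (fun u => by
        refine (abs_add_le _ _).trans (add_le_add ?_ ?_)
        · rw [abs_mul]; exact mul_le_mul (hDb u) (hC u) (abs_nonneg _) hK0
        · rw [abs_mul]; exact mul_le_mul (hK u).1 (hC' u) (abs_nonneg _) hK0)
    have hη'm : MemLp η' 2 μ :=
      MemLp.of_bound hηc'.aestronglyMeasurable C (Eventually.of_forall hC')
    have i1 : Integrable (fun u => fderiv ℝ (F j) u (b i) * η u) μ :=
      (hFdm j).integrable_mul hηm
    have i2 : Integrable (fun u => F j u * η' u) μ := (hFm j).integrable_mul hη'm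
    have i3 : Integrable (fun u => inner ℝ (b i) u * (F j u * η u)) μ := by
      refine (hξ.integrable one_le_two).mul_bdd (c := K * C)
        ((hFm j).1.mul hηm.1) (Eventually.of_forall fun u => ?_)
      rw [norm_mul]
      exact mul_le_mul (hK u).1 (hC u) (norm_nonneg _) hK0
    rw [integral_add i1 i2] at hibp
    have e1 : ∀ u, F j u * ((l : ℝ)⁻¹ * (inner ℝ (b i) u * η u) - η' u)
        = (l : ℝ)⁻¹ * (inner ℝ (b i) u * (F j u * η u)) - F j u * η' u := fun u => by ring
    simp only [e1, mul_assoc]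
    rw [integral_const_mul, integral_sub (i3.const_mul _) i2, integral_const_mul]
    congr 1
    linarith
  have lim1 := tendsto_integral_mul_of_eLpNorm (fun j => (hFdm j).const_mul (ev i ^ θ)) hGi hηm (by
    refine tendsto_of_tendsto_of_tendsto_of_le_of_le tendsto_const_nhds hFG (fun j => bot_le)
      fun j => eLpNorm_mono fun u => ?_
    rw [← hinner, ← inner_sub_right]
    refine (norm_inner_le_norm _ _).trans ?_
    rw [hb.1 i, one_mul])
  have lim2 := tendsto_integral_mul_of_eLpNorm hFm hh₁m hk hFh
  have e2 : ∫ u, h u * ((l : ℝ)⁻¹ * (inner ℝ (b i) u * η u) - η' u) ∂μ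
      = ∫ u, h₁ u * ((l : ℝ)⁻¹ * (inner ℝ (b i) u * η u) - η' u) ∂μ :=
    integral_congr_ae (by filter_upwards [hhe] with u hu; rw [hu])
  rw [e2]
  simp only [key] at lim1
  exact tendsto_nhds_unique lim1 (lim2.const_mul _)

/-- The components of the Sobolev gradient are determined by the function, up to the factor
given by the operator `T`. -/
lemma IsSobolevGrad.inner_ae_eq [IsGaussian μ] (h0 : ∫ x, x ∂μ = 0) {b : ℕ → H}
    (hb : Orthonormal ℝ b) {ev ev' : ℕ → ℝ} (hev0 : ∀ k, 0 < ev k) (hev1 : ∀ k, ev k ≤ 1)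
    (hev0' : ∀ k, 0 < ev' k) (hev1' : ∀ k, ev' k ≤ 1) {θ θ' : ℝ}
    (hθ : 0 ≤ θ) (hθ' : 0 ≤ θ') {Φ : H → EReal} {G G' : H → H}
    (hG : IsSobolevGrad μ b (diagPow b ev θ) Φ G) (hG' : IsSobolevGrad μ b (diagPow b ev' θ') Φ G')
    {i : ℕ} {l : ℝ≥0} (hl : l ≠ 0)
    (hcov : ∀ y, covarianceBilin μ (b i) y = l * inner ℝ (b i) y) :
    (fun u => (ev i ^ θ)⁻¹ * inner ℝ (b i) (G u))
      =ᵐ[μ] fun u => (ev' i ^ θ')⁻¹ * inner ℝ (b i) (G' u) := by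
  obtain ⟨h, -, hh, -⟩ := hG.2
  have hp : ev i ^ θ ≠ 0 := (Real.rpow_pos_of_pos (hev0 i) _).ne'
  have hp' : ev' i ^ θ' ≠ 0 := (Real.rpow_pos_of_pos (hev0' i) _).ne'
  have hGi : Integrable (fun u => (inner ℝ (b i) (G u) : ℝ)) μ :=
    (hG.1.const_inner (b i)).integrable one_le_two
  have hGi' : Integrable (fun u => (inner ℝ (b i) (G' u) : ℝ)) μ :=
    (hG'.1.const_inner (b i)).integrable one_le_two
  -- After division by the powers of the eigenvalues, the two weak formulations have the same
  -- right-hand side, since it involves only `h`. The difference of the rescaled coordinates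
  -- therefore annihilates all admissible `η`, in particular the sines and cosines needed for
  -- `ae_eq_zero_of_fourier`.
  have hz : ∀ η η' : H → ℝ, (∀ u, HasDerivAt (fun s : ℝ => η (u + s • b i)) (η' u) 0) →
      Continuous η → Continuous η' → (∃ C, (∀ u, |η u| ≤ C) ∧ ∀ u, |η' u| ≤ C) →
      ∫ u, ((ev i ^ θ)⁻¹ * inner ℝ (b i) (G u) - (ev' i ^ θ')⁻¹ * inner ℝ (b i) (G' u)) * η u ∂μ
        = 0 := by
    rintro η η' hη hηc hηc' ⟨C, hC, hC'⟩
    have h1 := hG.integral_inner_mul h0 hb (fun k => (hev0 k).le) hev1 hθ hh hl hcov hη hηc hηc'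
      hC hC'
    have h2 := hG'.integral_inner_mul h0 hb (fun k => (hev0' k).le) hev1' hθ' hh hl hcov hη hηc
      hηc' hC hC'
    have e : ∀ u, ((ev i ^ θ)⁻¹ * inner ℝ (b i) (G u) - (ev' i ^ θ')⁻¹ * inner ℝ (b i) (G' u)) * η u
        = (ev i ^ θ)⁻¹ * (inner ℝ (b i) (G u) * η u)
          - (ev' i ^ θ')⁻¹ * (inner ℝ (b i) (G' u) * η u) := fun u => by ring
    simp only [e]
    rw [integral_sub, integral_const_mul, integral_const_mul, h1, h2, ← mul_assoc, ← mul_assoc,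
      inv_mul_cancel₀ hp, inv_mul_cancel₀ hp', sub_self]
    · exact (hGi.mul_bdd (c := C) hηc.aestronglyMeasurable (Eventually.of_forall hC)).const_mul _
    · exact (hGi'.mul_bdd (c := C) hηc.aestronglyMeasurable (Eventually.of_forall hC)).const_mul _
  have hline : ∀ u v : H, HasDerivAt (fun s : ℝ => (inner ℝ (u + s • b i) v : ℝ))
      (inner ℝ (b i) v) 0 := by
    intro u v
    simp only [inner_add_left, inner_smul_left, conj_trivial]
    simpa using ((hasDerivAt_id (0 : ℝ)).mul_const (inner ℝ (b i) v : ℝ)).const_add (inner ℝ u v)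
  have hae := ae_eq_zero_of_fourier ((hGi.const_mul (ev i ^ θ)⁻¹).sub (hGi'.const_mul (ev' i ^ θ')⁻¹))
    (fun v => hz (fun u => Real.cos (inner ℝ u v))
      (fun u => -Real.sin (inner ℝ u v) * inner ℝ (b i) v)
      (fun u => by simpa using (hline u v).cos) (by fun_prop) (by fun_prop)
      ⟨max 1 |inner ℝ (b i) v|, fun u => (Real.abs_cos_le_one _).trans (le_max_left _ _), fun u => by
        rw [abs_mul, abs_neg]
        exact (mul_le_of_le_one_left (abs_nonneg _) (Real.abs_sin_le_one _)).trans
          (le_max_right _ _)⟩)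
    (fun v => hz (fun u => Real.sin (inner ℝ u v))
      (fun u => Real.cos (inner ℝ u v) * inner ℝ (b i) v)
      (fun u => by simpa using (hline u v).sin) (by fun_prop) (by fun_prop)
      ⟨max 1 |inner ℝ (b i) v|, fun u => (Real.abs_sin_le_one _).trans (le_max_left _ _), fun u => by
        rw [abs_mul]
        exact (mul_le_of_le_one_left (abs_nonneg _) (Real.abs_cos_le_one _)).trans
          (le_max_right _ _)⟩)
  filter_upwards [hae] with u hu
  exact sub_eq_zero.mp hu

end GaussianSobolev

/-! ### Functions as functionals, and completeness of the cosine basis of `U`. -/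

namespace CahnHilliard

lemma ae_eq_zero_of_forall_test {d : ℝ → ℝ} (hd : Integrable d lam)
    (h : ∀ w : ℝ → ℝ, ContDiff ℝ ∞ w → HasCompactSupport w → tsupport w ⊆ Ioo 0 1 →
      ∫ t, d t * w t ∂lam = 0) : d =ᵐ[lam] 0 := by
  have key : ∀ᵐ t ∂(volume : Measure ℝ), t ∈ Ioo (0 : ℝ) 1 → d t = 0 := by
    have hloc : IntegrableOn d (Ioo 0 1) volume := hd
    refine isOpen_Ioo.ae_eq_zero_of_integral_contDiff_smul_eq_zero hloc.locallyIntegrableOn ?_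
    intro w hw hwc hws
    have e3 : ∫ t, w t • d t = ∫ t, w t • d t ∂lam := by
      symm
      exact setIntegral_eq_integral_of_forall_compl_eq_zero fun t ht => by
        rw [image_eq_zero_of_notMem_tsupport fun h => ht (hws h)]; simp
    rw [e3, ← h w hw hwc hws]
    simp only [smul_eq_mul, mul_comm]
  rw [← ae_restrict_iff' measurableSet_Ioo] at key
  exact key

/-- Take the element of `X` with weak derivative `w'`; it differs from `w` by a constant because `w
0 = 0`. Such constants are invisible to mean-zero functions, which are therefore determined by their
action on `X`. -/
lemma exists_X_of_test {w : ℝ → ℝ} (hw : ContDiff ℝ ∞ w) (hws : tsupport w ⊆ Ioo 0 1) :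
    ∃ (y : X) (c : ℝ), y.toL2 =ᵐ[lam] fun t => w t - c := by
  have hd : Continuous (deriv w) := hw.continuous_deriv (by simp)
  obtain ⟨C, hC⟩ := isCompact_Icc.exists_bound_of_continuousOn (s := Icc (0 : ℝ) 1) hd.continuousOn
  have hm : MemLp (deriv w) 2 lam := by
    refine MemLp.of_bound hd.aestronglyMeasurable C ?_
    filter_upwards [ae_restrict_mem measurableSet_Ioo] with t ht
    exact hC t ⟨ht.1.le, ht.2.le⟩
  obtain ⟨y, hy⟩ := X.derivL_surjective hm.toLp
  have hy' : y.weakDeriv = hm.toLp := hy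
  refine ⟨y, ∫ s, prim y.weakDeriv s ∂lam, ?_⟩
  have hw0 : w 0 = 0 := image_eq_zero_of_notMem_tsupport fun h => by simpa using (hws h).1
  filter_upwards [y.ae_eq, ae_restrict_mem measurableSet_Ioo] with t ht htm
  rw [ht]
  congr 1
  have h1 : prim y.weakDeriv t = ∫ s in (0 : ℝ)..t, deriv w s := by
    refine intervalIntegral.integral_congr_ae ?_
    have h2 := (ae_restrict_iff' measurableSet_Ioo).mp hm.coeFn_toLp
    filter_upwards [h2] with s hs hst
    rw [uIoc_of_le htm.1.le] at hst
    rw [hy']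
    exact hs ⟨hst.1, hst.2.trans_lt htm.2⟩
  rw [h1, intervalIntegral.integral_deriv_eq_sub
    (fun s _ => (hw.differentiable (by simp)) s) (hd.intervalIntegrable _ _), hw0, sub_zero]

lemma ae_eq_zero_of_forall_X {d : ℝ → ℝ} (hd : Integrable d lam) (h0 : ∫ t, d t ∂lam = 0)
    (h : ∀ y : X, ∫ t, d t * y.toL2 t ∂lam = 0) : d =ᵐ[lam] 0 := by
  refine ae_eq_zero_of_forall_test hd fun w hw _ hws => ?_
  obtain ⟨y, c, hy⟩ := exists_X_of_test hw hws
  have h1 := h y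
  rw [integral_congr_ae (g := fun t => d t * w t - c * d t)
    (by filter_upwards [hy] with t ht; rw [ht]; ring),
    integral_sub (integrable_mul_of_continuous hd hw.continuous) (hd.const_mul c),
    integral_const_mul, h0] at h1
  simpa using h1

lemma X.integrable_mul {x : ℝ → ℝ} (hx : Integrable x lam) (y : X) :
    Integrable (fun t => x t * y.toL2 t) lam := by
  refine hx.mul_bdd (c := 2 * ‖y‖) (Lp.aestronglyMeasurable _) ?_
  have hc : |∫ s, prim y.weakDeriv s ∂lam| ≤ ‖y‖ := by
    have := norm_setIntegral_le_of_norm_le_const (μ := volume) (s := Ioo (0 : ℝ) 1)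
      (f := prim y.weakDeriv) (C := ‖y‖) (by simp)
      (fun t ht => by
        rw [X.norm_eq]; exact abs_prim_le y.weakDeriv ⟨ht.1.le, ht.2.le⟩)
    simpa using this
  filter_upwards [y.ae_eq, ae_restrict_mem measurableSet_Ioo] with t ht htm
  rw [ht]
  refine (norm_sub_le _ _).trans ?_
  have h1 := abs_prim_le y.weakDeriv (t := t) ⟨htm.1.le, htm.2.le⟩
  rw [← X.norm_eq] at h1
  rw [Real.norm_eq_abs, Real.norm_eq_abs]
  linarith

lemma IsIdentified.integrable {p : ℝ} (hp : 1 ≤ p) {x : ℝ → ℝ} {u : U} (h : IsIdentified p x u) :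
    Integrable x lam :=
  h.1.integrable (by rwa [ENNReal.one_le_ofReal])

/-- Two representatives differ by an integrable mean-zero function that annihilates `X`. Hence the
choice made in `Phi1` is immaterial. -/
lemma IsIdentified.ae_eq {p : ℝ} (hp : 1 ≤ p) {x x' : ℝ → ℝ} {u : U} (h : IsIdentified p x u)
    (h' : IsIdentified p x' u) : x =ᵐ[lam] x' := by
  have hi := h.integrable hp
  have hi' := h'.integrable hp
  have := ae_eq_zero_of_forall_X (hi.sub hi')
    (by simp only [Pi.sub_apply]; rw [integral_sub hi hi', h.2.1, h'.2.1, sub_zero]) (fun y => by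
      simp only [Pi.sub_apply, sub_mul]
      rw [integral_sub (X.integrable_mul hi y) (X.integrable_mul hi' y), ← h.2.2, ← h'.2.2,
        sub_self])
  filter_upwards [this] with t ht
  exact sub_eq_zero.mp ht

lemma Phi1_eq_of_isIdentified (φ : ℝ → ℝ) {p : ℝ} (hp : 1 ≤ p) {x : ℝ → ℝ} {u : U}
    (h : IsIdentified p x u) : Phi1 φ p u = ((∫ t, φ (x t) ∂lam : ℝ) : EReal) := by
  have hex : ∃ x, IsIdentified p x u := ⟨x, h⟩
  rw [Phi1, dif_pos hex]
  congr 1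
  refine integral_congr_ae ?_
  filter_upwards [hex.choose_spec.ae_eq hp h] with t ht
  rw [ht]

/-- The frequency `(k + 1) π`. -/
def freq (k : ℕ) : ℝ := (k + 1) * Real.pi

lemma freq_pos (k : ℕ) : 0 < freq k := by unfold freq; positivity

lemma continuous_eFun (k : ℕ) : Continuous (eFun k) := by unfold eFun; fun_prop

lemma abs_eFun_le (k : ℕ) (t : ℝ) : |eFun k t| ≤ √2 := by
  rw [eFun, abs_mul, abs_of_nonneg (Real.sqrt_nonneg _)]
  exact mul_le_of_le_one_right (Real.sqrt_nonneg _) (Real.abs_cos_le_one _)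

lemma eL2_ae (k : ℕ) : eL2 k =ᵐ[lam] eFun k := (eFun_memLp k).coeFn_toLp

lemma integral_cos_mul_pi (n : ℤ) (hn : n ≠ 0) : ∫ t, Real.cos (n * Real.pi * t) ∂lam = 0 := by
  rw [integral_lam]
  have hn' : (n * Real.pi : ℝ) ≠ 0 := mul_ne_zero (by exact_mod_cast hn) Real.pi_ne_zero
  rw [intervalIntegral.integral_comp_mul_left (fun t => Real.cos t) hn', integral_cos]
  simp [Real.sin_int_mul_pi]

lemma integral_eFun (k : ℕ) : ∫ t, eFun k t ∂lam = 0 := by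
  simp only [eFun]
  rw [integral_const_mul]
  have := integral_cos_mul_pi (k + 1) (by positivity)
  push_cast at this
  rw [this, mul_zero]

lemma integrable_lam_of_continuous {h : ℝ → ℝ} (hh : Continuous h) : Integrable h lam :=
  (hh.continuousOn.integrableOn_Icc (a := 0) (b := 1)).mono_set Ioo_subset_Icc_self

lemma integral_eFun_mul (j k : ℕ) :
    ∫ t, eFun j t * eFun k t ∂lam = if j = k then 1 else 0 := by
  have e : ∀ t, eFun j t * eFun k t = Real.cos (((j - k : ℤ) : ℝ) * Real.pi * t)
      + Real.cos (((j + k + 2 : ℤ) : ℝ) * Real.pi * t) := by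
    intro t
    simp only [eFun]
    rw [show √2 * Real.cos ((j + 1) * Real.pi * t) * (√2 * Real.cos ((k + 1) * Real.pi * t))
      = √2 * √2 * (Real.cos ((j + 1) * Real.pi * t) * Real.cos ((k + 1) * Real.pi * t)) by ring,
      Real.mul_self_sqrt (by norm_num)]
    have h1 := Real.cos_sub ((j + 1) * Real.pi * t) ((k + 1) * Real.pi * t)
    have h2 := Real.cos_add ((j + 1) * Real.pi * t) ((k + 1) * Real.pi * t)
    rw [show (((j - k : ℤ) : ℝ) * Real.pi * t) = (j + 1) * Real.pi * t - (k + 1) * Real.pi * t by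
      push_cast; ring, show (((j + k + 2 : ℤ) : ℝ) * Real.pi * t)
        = (j + 1) * Real.pi * t + (k + 1) * Real.pi * t by push_cast; ring, h1, h2]
    ring
  simp only [e]
  rw [integral_add (integrable_lam_of_continuous (by fun_prop))
    (integrable_lam_of_continuous (by fun_prop)), integral_cos_mul_pi (j + k + 2) (by positivity),
    add_zero]
  split_ifs with h
  · subst h; simp
  · exact integral_cos_mul_pi _ (by rw [sub_ne_zero]; exact_mod_cast h)

lemma fBasis_apply (k : ℕ) (y : X) : fBasis k y = freq k * ∫ t, eFun k t * y.toL2 t ∂lam := by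
  rw [fBasis, _root_.smul_apply, ofL2_apply, smul_eq_mul, freq]
  congr 1
  exact integral_congr_ae (by filter_upwards [eL2_ae k] with t ht; rw [ht])

lemma inner_U_eq (u v : U) : inner ℝ u v = u (B.symm v) := by
  change inner ℝ ((InnerProductSpace.toDual ℝ X).symm u) _ = _
  rw [InnerProductSpace.toDual_symm_apply]
  rfl

/-- `Binv u` is the functional induced by the function `B.symm u`. The relation `Binv_fBasis` thus
gives the action of this function on `X`, and together with its zero mean this determines it. -/
lemma B_symm_fBasis_ae (k : ℕ) :
    (B.symm (fBasis k)).toL2 =ᵐ[lam] fun t => (freq k)⁻¹ * eFun k t := by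
  have h1 := Binv_fBasis k
  have hf := freq_pos k
  have hint : Integrable (fun t => (freq k)⁻¹ * eFun k t) lam :=
    integrable_lam_of_continuous ((continuous_eFun k).const_mul _)
  have h2 : ∀ y : X, ∫ t, (B.symm (fBasis k)).toL2 t * y.toL2 t ∂lam
      = ∫ t, ((freq k)⁻¹ * eFun k t) * y.toL2 t ∂lam := by
    intro y
    have h3 : Binv (fBasis k) y = ∫ t, (B.symm (fBasis k)).toL2 t * y.toL2 t ∂lam :=
      ofL2_apply _ _
    rw [← h3, h1, _root_.smul_apply, fBasis_apply, smul_eq_mul, ← mul_assoc]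
    simp only [mul_assoc]
    rw [integral_const_mul, ← mul_assoc]
    congr 1
    rw [mul_comm Real.pi, ← freq]
    field_simp
  have h4 := ae_eq_zero_of_forall_X ((L2.integrable (B.symm (fBasis k)).toL2).sub hint)
    (by
      simp only [Pi.sub_apply]
      rw [integral_sub (L2.integrable _) hint, X.integral_eq_zero, integral_const_mul,
        integral_eFun]
      simp)
    (fun y => by
      simp only [Pi.sub_apply, sub_mul]
      rw [integral_sub (X.integrable_mul (L2.integrable _) y) (X.integrable_mul hint y), h2 y,
        sub_self])
  filter_upwards [h4] with t ht
  exact sub_eq_zero.mp ht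

lemma orthonormal_fBasis : Orthonormal ℝ fBasis := by
  rw [orthonormal_iff_ite]
  intro j k
  rw [inner_U_eq, fBasis_apply,
    integral_congr_ae (g := fun t => (freq k)⁻¹ * (eFun j t * eFun k t))
      (by filter_upwards [B_symm_fBasis_ae k] with t ht; rw [ht]; ring),
    integral_const_mul, integral_eFun_mul]
  split_ifs with h
  · subst h
    have := (freq_pos j).ne'
    field_simp
  · simp

/-- The product-to-sum formula trades a factor `cos (π t)` for a shift of the frequency by one in
either direction. The case with vanishing frequency then gives orthogonality to all powers of `cos
(π t)`. -/
lemma integral_mul_cos_pow {x : ℝ → ℝ} (hx : Integrable x lam) (h0 : ∫ t, x t ∂lam = 0)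
    (h : ∀ k : ℕ, ∫ t, x t * Real.cos ((k + 1) * Real.pi * t) ∂lam = 0) (j : ℕ) :
    ∀ k : ℕ, ∫ t, x t * (Real.cos (Real.pi * t) ^ j * Real.cos (k * Real.pi * t)) ∂lam = 0 := by
  induction j with
  | zero =>
    intro k
    rcases k with _ | k
    · simpa using h0
    · simpa using h k
  | succ j ih =>
    intro k
    rcases k with _ | k
    · have := ih 1
      simpa [pow_succ] using this
    · have e : ∀ t, x t * (Real.cos (Real.pi * t) ^ (j + 1)
            * Real.cos (((k + 1 : ℕ) : ℝ) * Real.pi * t))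
          = 2⁻¹ * (x t * (Real.cos (Real.pi * t) ^ j
              * Real.cos (((k + 2 : ℕ) : ℝ) * Real.pi * t)))
            + 2⁻¹ * (x t * (Real.cos (Real.pi * t) ^ j * Real.cos ((k : ℝ) * Real.pi * t))) := by
        intro t
        have h1 := Real.cos_add (((k + 1 : ℕ) : ℝ) * Real.pi * t) (Real.pi * t)
        have h2 := Real.cos_sub (((k + 1 : ℕ) : ℝ) * Real.pi * t) (Real.pi * t)
        rw [show ((k + 2 : ℕ) : ℝ) * Real.pi * t
            = ((k + 1 : ℕ) : ℝ) * Real.pi * t + Real.pi * t by push_cast; ring,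
          show (k : ℝ) * Real.pi * t = ((k + 1 : ℕ) : ℝ) * Real.pi * t - Real.pi * t by
            push_cast; ring, h1, h2]
        ring
      simp only [e]
      rw [integral_add
        ((integrable_mul_of_continuous hx (by fun_prop)).const_mul _)
        ((integrable_mul_of_continuous hx (by fun_prop)).const_mul _), integral_const_mul,
        integral_const_mul, ih, ih]
      simp

/-- On `(0,1)` every test function is a continuous function of `cos (π t)`, so Weierstrass
approximates it uniformly by polynomials in `cos (π t)`; uniform approximation is enough against an
`L¹` function. -/
lemma ae_eq_zero_of_cos {x : ℝ → ℝ} (hx : Integrable x lam) (h0 : ∫ t, x t ∂lam = 0)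
    (h : ∀ k : ℕ, ∫ t, x t * Real.cos ((k + 1) * Real.pi * t) ∂lam = 0) : x =ᵐ[lam] 0 := by
  have hpoly : ∀ P : Polynomial ℝ, ∫ t, x t * P.eval (Real.cos (Real.pi * t)) ∂lam = 0 := by
    intro P
    simp only [Polynomial.eval_eq_sum_range, Finset.mul_sum]
    rw [integral_finsetSum]
    · refine Finset.sum_eq_zero fun j _ => ?_
      have := integral_mul_cos_pow hx h0 h j 0
      simp only [Nat.cast_zero, zero_mul, Real.cos_zero, mul_one] at this
      have e : ∀ t, x t * (P.coeff j * Real.cos (Real.pi * t) ^ j)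
        = P.coeff j * (x t * Real.cos (Real.pi * t) ^ j) := fun t => by ring
      simp only [e]
      rw [integral_const_mul, this, mul_zero]
    · intro j _
      exact integrable_mul_of_continuous hx (by fun_prop)
  refine ae_eq_zero_of_forall_test hx fun w hw _ _ => ?_
  by_contra hne
  set I : ℝ := ∫ t, |x t| ∂lam with hI
  have hI0 : 0 ≤ I := integral_nonneg fun t => abs_nonneg _
  have hpos : 0 < |∫ t, x t * w t ∂lam| := abs_pos.mpr hne
  obtain ⟨P, hP⟩ := exists_polynomial_near_of_continuousOn (-1) 1
    (fun s => w (Real.arccos s / Real.pi))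
    (hw.continuous.comp (Real.continuous_arccos.div_const _)).continuousOn
    -- With this tolerance the integral is at most `I / (I + 1)` times itself in absolute value, a
    -- contradiction; the `+ 1` also covers `I = 0`.
    (|∫ t, x t * w t ∂lam| / (I + 1)) (by positivity)
  have hPi := integrable_mul_of_continuous hx
    (by fun_prop : Continuous fun t => P.eval (Real.cos (Real.pi * t)))
  have hwi := integrable_mul_of_continuous hx hw.continuous
  have h1 : ‖∫ t, x t * w t ∂lam‖ ≤ |∫ t, x t * w t ∂lam| / (I + 1) * I := by
    conv_lhs => rw [← sub_zero (∫ t, x t * w t ∂lam), ← hpoly P, ← integral_sub hwi hPi]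
    rw [hI, ← integral_const_mul]
    refine norm_integral_le_of_norm_le (hx.abs.const_mul _) ?_
    filter_upwards [ae_restrict_mem measurableSet_Ioo] with t ht
    have h2 := hP (Real.cos (Real.pi * t)) ⟨Real.neg_one_le_cos _, Real.cos_le_one _⟩
    rw [Real.arccos_cos (by have := Real.pi_pos; nlinarith [ht.1])
      (by have := Real.pi_pos; nlinarith [ht.2]), mul_div_cancel_left₀ _ Real.pi_ne_zero] at h2
    rw [← mul_sub, norm_mul, mul_comm, Real.norm_eq_abs, Real.norm_eq_abs, abs_sub_comm]
    exact mul_le_mul_of_nonneg_right h2.le (abs_nonneg _)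
  rw [Real.norm_eq_abs, div_mul_eq_mul_div, le_div_iff₀ (by positivity)] at h1
  nlinarith

lemma eq_zero_of_inner_fBasis {u : U} (h : ∀ k, inner ℝ (fBasis k) u = 0) : u = 0 := by
  set x : X := B.symm u with hx
  have h1 : ∀ k : ℕ, ∫ t, x.toL2 t * Real.cos ((k + 1) * Real.pi * t) ∂lam = 0 := by
    intro k
    have h2 := h k
    rw [inner_U_eq, fBasis_apply] at h2
    have h3 := (mul_eq_zero.mp h2).resolve_left (freq_pos k).ne'
    have e : ∀ t, eFun k t * (B.symm u).toL2 t
        = √2 * (x.toL2 t * Real.cos ((k + 1) * Real.pi * t)) := fun t => by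
      rw [eFun]; ring
    simp only [e] at h3
    rw [integral_const_mul] at h3
    exact (mul_eq_zero.mp h3).resolve_left (by positivity)
  have h2 := ae_eq_zero_of_cos (L2.integrable x.toL2) x.integral_eq_zero h1
  have h3 : x.weakDeriv =ᵐ[lam] 0 := by
    refine ae_eq_zero_of_forall_test (L2.integrable _) fun w hw hwc hws => ?_
    have h4 := x.isWeakDeriv w hw hwc hws
    rw [integral_eq_zero_of_ae (by filter_upwards [h2] with t ht; rw [ht]; simp)] at h4
    linarith
  have h5 : x.weakDeriv = 0 := Lp.ext (h3.trans (Lp.coeFn_zero ℝ 2 lam).symm)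
  have h6 : x = 0 := by
    rw [← norm_eq_zero, X.norm_eq, h5, norm_zero]
  rw [hx] at h6
  simpa using h6

/-- The orthonormal basis `fBasis` as a Hilbert basis. -/
def fHilbert : HilbertBasis ℕ ℝ U :=
  HilbertBasis.mkOfOrthogonalEqBot orthonormal_fBasis (by
    rw [eq_bot_iff]
    intro u hu
    rw [Submodule.mem_orthogonal] at hu
    exact eq_zero_of_inner_fBasis fun k => hu _ (Submodule.subset_span ⟨k, rfl⟩))

lemma hasSum_fBasis (u : U) : HasSum (fun k => (inner ℝ (fBasis k) u : ℝ) • fBasis k) u := by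
  have h := fHilbert.hasSum_repr u
  have e : ⇑fHilbert = fBasis := HilbertBasis.coe_mkOfOrthogonalEqBot _ _
  simpa only [fHilbert.repr_apply_apply, e] using h

instance : SecondCountableTopology U := by
  have h1 : TopologicalSpace.IsSeparable (univ : Set U) := by
    have h2 := ((countable_range fHilbert).isSeparable.span (R := ℝ)).closure
    rwa [← Submodule.topologicalClosure_coe, fHilbert.dense_span, Submodule.top_coe] at h2
  have : TopologicalSpace.SeparableSpace U := TopologicalSpace.isSeparable_univ_iff.mp h1
  have : TopologicalSpace.SeparableSpace X :=
    B.symm.surjective.denseRange.separableSpace B.symm.continuous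
  have : SecondCountableTopology X := UniformSpace.secondCountable_of_separable X
  exact B.symm.toHomeomorph.secondCountableTopology

end CahnHilliard

/-! ### Gaussian mode sums and their almost everywhere limit. -/

namespace CahnHilliard
open GaussianSobolev

lemma eig_eq (k : ℕ) : eig k = (freq k) ^ (-4 : ℝ) := by
  rw [eig, freq, Real.rpow_neg (by positivity), one_div, mul_comm Real.pi]
  norm_cast

lemma eig_pos (k : ℕ) : 0 < eig k := by unfold eig; positivity

lemma one_le_freq (k : ℕ) : 1 ≤ freq k := by
  have h1 := Real.pi_gt_three
  have h2 : (0 : ℝ) ≤ k := k.cast_nonneg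
  unfold freq
  nlinarith

lemma eig_le_one (k : ℕ) : eig k ≤ 1 := by
  rw [eig_eq]
  exact Real.rpow_le_one_of_one_le_of_nonpos (one_le_freq k) (by norm_num)

lemma eig_rpow_pos (θ : ℝ) (k : ℕ) : 0 < eig k ^ θ := Real.rpow_pos_of_pos (eig_pos k) θ

lemma eig_rpow_le_one {θ : ℝ} (hθ : 0 ≤ θ) (k : ℕ) : eig k ^ θ ≤ 1 :=
  Real.rpow_le_one (eig_pos k).le (eig_le_one k) hθ

/-- The terms are `freq k ^ (2 - 4 * s)`, with exponent below `-1`. It is used with `s = α₁` for the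
variance of the mode sums and with `s = 2 * α` for the gradient, which explains the thresholds `3/4`
and `3/8`. -/
lemma summable_freq_sq_mul_eig {s : ℝ} (hs : 3 / 4 < s) :
    Summable fun k => freq k ^ 2 * eig k ^ s := by
  have h1 : ∀ k : ℕ, freq k ^ 2 * eig k ^ s
      = ((k + 1 : ℕ) : ℝ) ^ (2 - 4 * s) * Real.pi ^ (2 - 4 * s) := by
    intro k
    rw [eig_eq, ← Real.rpow_mul (freq_pos k).le, ← Real.rpow_natCast (freq k) 2,
      ← Real.rpow_add (freq_pos k), freq, ← Real.mul_rpow (by positivity) Real.pi_pos.le]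
    push_cast
    congr 1
    ring
  simp only [h1]
  refine Summable.mul_right _ ?_
  exact (summable_nat_add_iff 1).mpr (Real.summable_nat_rpow.mpr (by linarith))

/-- The finite sum `∑ k ∈ s, (f_k, u) f_k(t)`. -/
def modeSum (s : Finset ℕ) (q : U × ℝ) : ℝ :=
  ∑ k ∈ s, freq k * eFun k q.2 * inner ℝ (fBasis k) q.1

/-- The representing vector of `u ↦ modeSum s (u, t)`. -/
def modeVec (s : Finset ℕ) (t : ℝ) : U := ∑ k ∈ s, (freq k * eFun k t) • fBasis k

lemma modeSum_eq_inner (s : Finset ℕ) (u : U) (t : ℝ) :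
    modeSum s (u, t) = inner ℝ (modeVec s t) u := by
  refine Eq.trans (Finset.sum_congr rfl fun k _ => ?_)
    (sum_inner (𝕜 := ℝ) s (fun k => (freq k * eFun k t) • fBasis k) u).symm
  exact (real_inner_smul_left (fBasis k) u (freq k * eFun k t)).symm

lemma inner_fBasis_modeVec (s : Finset ℕ) (t : ℝ) {k : ℕ} (hk : k ∈ s) :
    inner ℝ (fBasis k) (modeVec s t) = freq k * eFun k t := by
  rw [modeVec, orthonormal_fBasis.inner_right_sum _ hk]

lemma measurable_modeSum (s : Finset ℕ) : Measurable (modeSum s) := by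
  unfold modeSum
  have := fun k => (continuous_eFun k).measurable
  fun_prop

lemma continuous_modeSum_right (s : Finset ℕ) (u : U) : Continuous fun t => modeSum s (u, t) := by
  unfold modeSum
  have := continuous_eFun
  fun_prop

lemma Qpow_fBasis (θ : ℝ) (k : ℕ) : Qpow θ (fBasis k) = eig k ^ θ • fBasis k := by
  rw [Qpow, diagPow, tsum_eq_single k]
  · rw [real_inner_self_eq_norm_sq, orthonormal_fBasis.1 k]; simp
  · intro j hj
    rw [orthonormal_fBasis.2 hj]; simp

variable {μ : Measure U} {α₁ : ℝ}

lemma covarianceBilin_fBasis (hμ : IsCenteredGaussian μ (Qpow α₁)) (k : ℕ) (y : U) :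
    covarianceBilin μ (fBasis k) y = eig k ^ α₁ * inner ℝ (fBasis k) y := by
  rw [hμ.cov_eq, Qpow_fBasis]
  exact real_inner_smul_left (fBasis k) y (eig k ^ α₁)

lemma covarianceBilin_modeVec_le (hμ : IsCenteredGaussian μ (Qpow α₁)) (s : Finset ℕ) (t : ℝ) :
    covarianceBilin μ (modeVec s t) (modeVec s t)
      ≤ 2 * ∑ k ∈ s, freq k ^ 2 * eig k ^ α₁ := by
  have h1 : covarianceBilin μ (modeVec s t) (modeVec s t)
      = ∑ k ∈ s, freq k * eFun k t * (eig k ^ α₁ * (freq k * eFun k t)) := by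
    refine (map_sum (covarianceBilin μ (modeVec s t)) (fun k => (freq k * eFun k t) • fBasis k)
      s).trans (Finset.sum_congr rfl fun k hk => ?_)
    rw [map_smul, covarianceBilin_comm, covarianceBilin_fBasis hμ,
      inner_fBasis_modeVec s t hk, smul_eq_mul]
  rw [h1, Finset.mul_sum]
  refine Finset.sum_le_sum fun k _ => ?_
  have h2 : eFun k t ^ 2 ≤ 2 := by
    rw [← sq_abs, ← Real.sq_sqrt (by norm_num : (0 : ℝ) ≤ 2)]
    exact pow_le_pow_left₀ (abs_nonneg _) (abs_eFun_le k t) 2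
  have h3 : 0 ≤ freq k ^ 2 * eig k ^ α₁ := mul_nonneg (sq_nonneg _) (eig_rpow_pos _ _).le
  nlinarith [mul_le_mul_of_nonneg_left h2 h3]

lemma eLpNorm_gaussianReal_zero (v : ℝ≥0) (r : ℝ≥0∞) :
    eLpNorm id r (gaussianReal 0 v)
      = ENNReal.ofReal (√v) * eLpNorm id r (gaussianReal 0 1) := by
  have h1 := gaussianReal_map_const_mul (μ := 0) (v := 1) (√v)
  have h2 : NNReal.mk (√(v : ℝ) ^ 2) (sq_nonneg _) * 1 = v := by
    ext; simp
  rw [mul_zero, h2] at h1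
  rw [← h1, eLpNorm_map_measure aestronglyMeasurable_id (by fun_prop)]
  have h3 : (id ∘ fun x : ℝ => √v * x) = √(v : ℝ) • id := by ext; simp
  rw [h3, eLpNorm_const_smul]
  congr 1
  rw [Real.enorm_eq_ofReal (Real.sqrt_nonneg _)]

/-- For fixed `t` the mode sum is a centered Gaussian variable, so its `L^r` norm is the standard
deviation times a universal constant. The variance bound is uniform in `t` because the cosines are
bounded, and integration over the probability space `(0,1)` preserves the estimate. -/
lemma eLpNorm_modeSum_le (hμ : IsCenteredGaussian μ (Qpow α₁)) (s : Finset ℕ) {r : ℝ} (hr : 1 ≤ r) :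
    eLpNorm (modeSum s) (ENNReal.ofReal r) (μ.prod lam)
      ≤ ENNReal.ofReal (√(2 * ∑ k ∈ s, freq k ^ 2 * eig k ^ α₁))
        * eLpNorm id (ENNReal.ofReal r) (gaussianReal 0 1) := by
  have := hμ.isGaussian
  have hr0 : 0 < r := by linarith
  have hrt : ENNReal.ofReal r ≠ 0 := by simpa using hr0
  set K := ENNReal.ofReal (√(2 * ∑ k ∈ s, freq k ^ 2 * eig k ^ α₁))
        * eLpNorm id (ENNReal.ofReal r) (gaussianReal 0 1) with hK
  have ht : ∀ t, eLpNorm (fun u => modeSum s (u, t)) (ENNReal.ofReal r) μ ≤ K := by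
    intro t
    have h1 := map_inner_eq_gaussianReal hμ.mean_zero (modeVec s t)
    simp only [modeSum_eq_inner]
    have h2 : eLpNorm (fun u => (inner ℝ (modeVec s t) u : ℝ)) (ENNReal.ofReal r) μ
        = eLpNorm id (ENNReal.ofReal r) (μ.map fun u => (inner ℝ (modeVec s t) u : ℝ)) := by
      rw [eLpNorm_map_measure aestronglyMeasurable_id (by fun_prop)]
      rfl
    rw [h2, h1, eLpNorm_gaussianReal_zero, hK]
    gcongr
    rw [Real.coe_toNNReal']
    exact max_le (covarianceBilin_modeVec_le hμ s t) (by
      have := fun k => (eig_rpow_pos α₁ k).le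
      exact mul_nonneg (by norm_num) (Finset.sum_nonneg fun k _ => mul_nonneg (sq_nonneg _) (this k)))
  have hm := measurable_modeSum s
  rw [eLpNorm_eq_lintegral_rpow_enorm_toReal hrt ENNReal.ofReal_ne_top,
    ENNReal.toReal_ofReal hr0.le, one_div, ENNReal.rpow_inv_le_iff hr0,
    lintegral_prod_symm _ (hm.enorm.pow_const r).aemeasurable]
  calc ∫⁻ t, ∫⁻ u, ‖modeSum s (u, t)‖ₑ ^ r ∂μ ∂lam ≤ ∫⁻ t, K ^ r ∂lam := by
        refine lintegral_mono fun t => ?_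
        have h3 := ht t
        rw [eLpNorm_eq_lintegral_rpow_enorm_toReal hrt ENNReal.ofReal_ne_top,
          ENNReal.toReal_ofReal hr0.le, one_div, ENNReal.rpow_inv_le_iff hr0] at h3
        exact h3
    _ = K ^ r := by simp

end CahnHilliard

/-- The dominating function is the sum of the absolute values, which lies in `L^r` by Minkowski and
Fatou and forces absolute convergence almost everywhere. -/
lemma exists_dominated_limit_of_summable_eLpNorm {α : Type*} [MeasurableSpace α] {ν : Measure α}
    {r : ℝ≥0∞} (hr : 1 ≤ r) {D : ℕ → α → ℝ} (hD : ∀ j, AEStronglyMeasurable (D j) ν)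
    (hs : ∑' j, eLpNorm (D j) r ν ≠ ⊤) :
    ∃ Z Y : α → ℝ, AEStronglyMeasurable Z ν ∧ MemLp Y r ν ∧
      (∀ᵐ q ∂ν, ∀ n, |∑ j ∈ Finset.range n, D j q| ≤ Y q) ∧
      ∀ᵐ q ∂ν, Tendsto (fun n => ∑ j ∈ Finset.range n, D j q) atTop (𝓝 (Z q)) := by
  have hsum := summable_norm_of_tsum_eLpNorm_ne_top hr hD hs
  have hZ : ∀ᵐ q ∂ν, Tendsto (fun n => ∑ j ∈ Finset.range n, D j q) atTop (𝓝 (∑' j, D j q)) := by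
    filter_upwards [hsum] with q hq
    exact hq.of_norm.hasSum.tendsto_sum_nat
  have hY : ∀ᵐ q ∂ν, Tendsto (fun n => ∑ j ∈ Finset.range n, ‖D j q‖) atTop
      (𝓝 (∑' j, ‖D j q‖)) := by
    filter_upwards [hsum] with q hq
    exact hq.hasSum.tendsto_sum_nat
  have hYm : ∀ n, AEStronglyMeasurable (fun q => ∑ j ∈ Finset.range n, ‖D j q‖) ν := fun n =>
    Finset.aestronglyMeasurable_fun_sum _ fun j _ => (hD j).norm
  refine ⟨fun q => ∑' j, D j q, fun q => ∑' j, ‖D j q‖,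
    aestronglyMeasurable_of_tendsto_ae atTop
      (fun n => Finset.aestronglyMeasurable_fun_sum _ fun j _ => hD j) hZ,
    ⟨aestronglyMeasurable_of_tendsto_ae atTop hYm hY, ?_⟩, ?_, hZ⟩
  · refine (Lp.eLpNorm_lim_le_liminf_eLpNorm hYm _ hY).trans_lt (lt_of_le_of_lt ?_ hs.lt_top)
    refine liminf_le_of_le (by isBoundedDefault) fun c hc => ?_
    obtain ⟨n, hn⟩ := hc.exists
    refine hn.trans ?_
    have h1 := eLpNorm_sum_le (μ := ν) (s := Finset.range n) (p := r)
      (f := fun j q => ‖D j q‖) (fun j _ => (hD j).norm) hr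
    have e : (∑ j ∈ Finset.range n, fun q => ‖D j q‖) = fun q => ∑ j ∈ Finset.range n, ‖D j q‖ := by
      ext q; simp
    rw [e] at h1
    refine h1.trans ?_
    simp only [eLpNorm_norm]
    exact ENNReal.sum_le_tsum _
  · filter_upwards [hsum] with q hq n
    refine (Finset.abs_sum_le_sum_abs _ _).trans ?_
    exact hq.sum_le_tsum _ fun j _ => abs_nonneg _

/-- The rate `1 / 4` for variances becomes `1 / 2` for `L^r` norms after the square root, hence a
summable series of blocks. The first block starts at `0` and need not be small; the constant `C`
absorbs it. -/
lemma exists_fast_blocks {v : ℕ → ℝ} (hv : Summable v) (hv0 : ∀ k, 0 ≤ v k) :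
    ∃ (N : ℕ → ℕ) (C : ℝ), N 0 = 0 ∧ StrictMono N ∧ 0 ≤ C ∧
      ∀ j, ∑ k ∈ Finset.Ico (N j) (N (j + 1)), v k ≤ C * (1 / 4) ^ j := by
  have htail := tendsto_sum_nat_add v
  have hex : ∀ j : ℕ, ∃ M, ∀ n ≥ M, ∑' k, v (k + n) < (1 / 4 : ℝ) ^ j := fun j =>
    eventually_atTop.mp (htail.eventually_lt_const (by positivity))
  choose M hM using hex
  -- The partial sums guarantee `N (j + 1) ≥ M (j + 1)`, and the extra `1` makes `N` strictly
  -- increasing.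
  let N : ℕ → ℕ := fun j => ∑ i ∈ Finset.range j, (M (i + 1) + 1)
  have hN : ∀ j, N (j + 1) = N j + (M (j + 1) + 1) := fun j => Finset.sum_range_succ _ _
  have hico : ∀ m n, ∑ k ∈ Finset.Ico m n, v k ≤ ∑' k, v (k + m) := by
    intro m n
    rw [Finset.sum_Ico_eq_sum_range]
    simp only [add_comm m]
    exact ((summable_nat_add_iff m).mpr hv).sum_le_tsum _ fun k _ => hv0 _
  have hT : 0 ≤ ∑' k, v k := tsum_nonneg hv0
  refine ⟨N, 1 + ∑' k, v k, by simp [N], strictMono_nat_of_lt_succ fun j => by rw [hN]; omega,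
    by linarith, fun j => ?_⟩
  refine (hico _ _).trans ?_
  rcases j with _ | j
  · simp [N]
  · refine (hM (j + 1) (N (j + 1)) (by rw [hN]; omega)).le.trans ?_
    exact le_mul_of_one_le_left (by positivity) (by linarith)

namespace CahnHilliard
open GaussianSobolev
variable {μ : Measure U} {α₁ : ℝ}

lemma exists_process (hα₁ : 3 / 4 < α₁) (hμ : IsCenteredGaussian μ (Qpow α₁)) {r : ℝ} (hr : 1 ≤ r) :
    ∃ (N : ℕ → ℕ) (Z Y : U × ℝ → ℝ), StrictMono N ∧ AEStronglyMeasurable Z (μ.prod lam) ∧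
      MemLp Y (ENNReal.ofReal r) (μ.prod lam) ∧
      (∀ᵐ q ∂(μ.prod lam), ∀ n, |modeSum (Finset.range (N n)) q| ≤ Y q) ∧
      ∀ᵐ q ∂(μ.prod lam),
        Tendsto (fun n => modeSum (Finset.range (N n)) q) atTop (𝓝 (Z q)) := by
  obtain ⟨N, C, hN0, hN, hC, hb⟩ := exists_fast_blocks (summable_freq_sq_mul_eig hα₁)
    fun k => mul_nonneg (sq_nonneg _) (eig_rpow_pos α₁ k).le
  have hsum : ∀ n q, ∑ j ∈ Finset.range n, modeSum (Finset.Ico (N j) (N (j + 1))) q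
      = modeSum (Finset.range (N n)) q := by
    intro n q
    induction n with
    | zero => simp [hN0, modeSum]
    | succ n ih =>
      rw [Finset.sum_range_succ, ih]
      exact Finset.sum_range_add_sum_Ico _ (hN.monotone n.le_succ)
  set m := eLpNorm id (ENNReal.ofReal r) (gaussianReal 0 1) with hm
  have hmt : m ≠ ⊤ := (memLp_id_gaussianReal' _ ENNReal.ofReal_ne_top).2.ne
  have hD : ∀ j, eLpNorm (modeSum (Finset.Ico (N j) (N (j + 1)))) (ENNReal.ofReal r) (μ.prod lam)
      ≤ ENNReal.ofReal (√(2 * C) * (1 / 2) ^ j) * m := by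
    intro j
    refine (eLpNorm_modeSum_le hμ _ hr).trans ?_
    gcongr
    rw [Real.sqrt_le_left (by positivity), mul_pow, Real.sq_sqrt (by positivity), ← pow_mul,
      mul_comm j 2, pow_mul]
    have := hb j
    norm_num at this ⊢
    linarith
  have hfin : ∑' j, eLpNorm (modeSum (Finset.Ico (N j) (N (j + 1)))) (ENNReal.ofReal r)
      (μ.prod lam) ≠ ⊤ := by
    refine ne_top_of_le_ne_top ?_ (ENNReal.tsum_le_tsum hD)
    rw [ENNReal.tsum_mul_right]
    refine ENNReal.mul_ne_top ?_ hmt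
    exact (summable_geometric_two.mul_left _).tsum_ofReal_ne_top
  obtain ⟨Z, Y, h1, h2, h3, h4⟩ := exists_dominated_limit_of_summable_eLpNorm
    (by rwa [ENNReal.one_le_ofReal]) (fun j => (measurable_modeSum _).aestronglyMeasurable) hfin
  simp only [hsum] at h3 h4
  exact ⟨N, Z, Y, hN, h1, h2, h3, h4⟩

lemma integral_modeSum_mul (s : Finset ℕ) (u : U) (y : X) :
    ∫ t, modeSum s (u, t) * y.toL2 t ∂lam = ∑ k ∈ s, inner ℝ (fBasis k) u * fBasis k y := by
  simp only [modeSum, Finset.sum_mul]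
  rw [integral_finsetSum]
  · refine Finset.sum_congr rfl fun k _ => ?_
    have e : ∀ t, freq k * eFun k t * inner ℝ (fBasis k) u * y.toL2 t
        = (inner ℝ (fBasis k) u * freq k) * (eFun k t * y.toL2 t) := fun t => by ring
    simp only [e]
    rw [integral_const_mul, fBasis_apply, mul_assoc]
  · intro k _
    exact X.integrable_mul (integrable_lam_of_continuous
      (((continuous_eFun k).const_mul _).mul continuous_const)) y

lemma integral_modeSum (s : Finset ℕ) (u : U) : ∫ t, modeSum s (u, t) ∂lam = 0 := by
  simp only [modeSum]
  rw [integral_finsetSum]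
  · refine Finset.sum_eq_zero fun k _ => ?_
    rw [integral_mul_const, integral_const_mul, integral_eFun]
    simp
  · intro k _
    exact integrable_lam_of_continuous (((continuous_eFun k).const_mul _).mul continuous_const)

lemma tendsto_sum_inner_fBasis (u : U) (y : X) :
    Tendsto (fun n => ∑ k ∈ Finset.range n, inner ℝ (fBasis k) u * fBasis k y) atTop
      (𝓝 (u y)) := by
  have h := (((ContinuousLinearMap.apply ℝ ℝ y).hasSum (hasSum_fBasis u))).tendsto_sum_nat
  simpa using h

/-- Dominated convergence transfers the zero mean and the pairings with `y ∈ X` from the mode sums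
to `x`, while the same pairings converge to `u y` by the basis expansion in `U`. -/
lemma isIdentified_of_limit {p : ℝ} {u : U} {x Y : ℝ → ℝ} {N : ℕ → ℕ} (hN : StrictMono N)
    (hp : 1 ≤ p) (hx : AEStronglyMeasurable x lam) (hY : MemLp Y (ENNReal.ofReal p) lam)
    (hb : ∀ᵐ t ∂lam, ∀ n, |modeSum (Finset.range (N n)) (u, t)| ≤ Y t)
    (hlim : ∀ᵐ t ∂lam, Tendsto (fun n => modeSum (Finset.range (N n)) (u, t)) atTop (𝓝 (x t))) :
    IsIdentified p x u := by
  have hYi : Integrable Y lam := hY.integrable (by rwa [ENNReal.one_le_ofReal])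
  refine ⟨hY.mono hx ?_, ?_, fun y => ?_⟩
  · filter_upwards [hb, hlim] with t h1 h2
    refine (le_of_tendsto h2.norm (Eventually.of_forall h1)).trans (le_abs_self _)
  · have h1 := tendsto_integral_of_dominated_convergence Y
      (fun n => (continuous_modeSum_right (Finset.range (N n)) u).aestronglyMeasurable) hYi
      (fun n => hb.mono fun t ht => ht n) hlim
    simp only [integral_modeSum] at h1
    exact tendsto_nhds_unique h1 tendsto_const_nhds
  · have h1 : Tendsto (fun n => ∫ t, modeSum (Finset.range (N n)) (u, t) * y.toL2 t ∂lam) atTop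
        (𝓝 (∫ t, x t * y.toL2 t ∂lam)) := by
      refine tendsto_integral_of_dominated_convergence (fun t => ‖Y t * y.toL2 t‖)
        (fun n => (continuous_modeSum_right (Finset.range (N n)) u).aestronglyMeasurable.mul
          (Lp.aestronglyMeasurable _)) (X.integrable_mul hYi y).norm
        (fun n => hb.mono fun t ht => ?_) (hlim.mono fun t ht => ht.mul_const _)
      rw [norm_mul, norm_mul]
      exact mul_le_mul_of_nonneg_right ((ht n).trans (le_abs_self _)) (norm_nonneg _)
    simp only [integral_modeSum_mul] at h1
    exact tendsto_nhds_unique ((tendsto_sum_inner_fBasis u y).comp hN.tendsto_atTop) h1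

end CahnHilliard

/-! ### Square-integrable functions on a product space. -/

lemma eLpNorm_integral_abs_le {α β : Type*} [MeasurableSpace α] [MeasurableSpace β] {μ : Measure α}
    {ν : Measure β} [SFinite μ] [IsProbabilityMeasure ν] {f : α × β → ℝ}
    (hf : AEStronglyMeasurable f (μ.prod ν)) :
    eLpNorm (fun u => ∫ t, |f (u, t)| ∂ν) 2 μ ≤ eLpNorm f 2 (μ.prod ν) := by
  have h2 : (2 : ℝ≥0∞) ≠ 0 := by norm_num
  have h2t : (2 : ℝ≥0∞) ≠ ⊤ := by norm_num
  have h0 : (0 : ℝ) < 2 := by norm_num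
  rw [eLpNorm_eq_lintegral_rpow_enorm_toReal h2 h2t, eLpNorm_eq_lintegral_rpow_enorm_toReal h2 h2t,
    ENNReal.toReal_ofNat]
  refine ENNReal.rpow_le_rpow ?_ (by norm_num)
  rw [lintegral_prod _ (hf.enorm.pow_const 2)]
  refine lintegral_mono_ae ?_
  filter_upwards [hf.prodMk_left] with u hu
  have h1 : ‖∫ t, |f (u, t)| ∂ν‖ₑ ≤ eLpNorm (fun t => f (u, t)) 1 ν := by
    rw [eLpNorm_one_eq_lintegral_enorm]
    refine (enorm_integral_le_lintegral_enorm _).trans (le_of_eq ?_)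
    refine lintegral_congr fun t => ?_
    rw [Real.enorm_eq_ofReal_abs, Real.enorm_eq_ofReal_abs, abs_abs]
  have h3 := h1.trans (eLpNorm_le_eLpNorm_of_exponent_le (q := 2) one_le_two hu)
  rw [eLpNorm_eq_lintegral_rpow_enorm_toReal h2 h2t, ENNReal.toReal_ofNat, one_div,
    ENNReal.le_rpow_inv_iff h0] at h3
  exact h3

lemma memLp_integral_abs {α β : Type*} [MeasurableSpace α] [MeasurableSpace β] {μ : Measure α}
    {ν : Measure β} [SFinite μ] [IsProbabilityMeasure ν] {f : α × β → ℝ}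
    (hf : MemLp f 2 (μ.prod ν)) : MemLp (fun u => ∫ t, |f (u, t)| ∂ν) 2 μ :=
  ⟨AEStronglyMeasurable.integral_prod_right' (f := fun q => |f q|) hf.1.norm,
    (eLpNorm_integral_abs_le hf.1).trans_lt hf.2⟩

lemma tendsto_eLpNorm_two_of_dominated {α : Type*} [MeasurableSpace α] {ν : Measure α}
    {f : ℕ → α → ℝ} {g W : α → ℝ} (hf : ∀ j, AEStronglyMeasurable (f j) ν) (hW : MemLp W 2 ν)
    (hb : ∀ j, ∀ᵐ q ∂ν, |f j q| ≤ W q)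
    (hlim : ∀ᵐ q ∂ν, Tendsto (fun j => f j q) atTop (𝓝 (g q))) :
    Tendsto (fun j => eLpNorm (fun q => f j q - g q) 2 ν) atTop (𝓝 0) := by
  have hg : AEStronglyMeasurable g ν := aestronglyMeasurable_of_tendsto_ae atTop hf hlim
  have hbg : ∀ᵐ q ∂ν, |g q| ≤ W q := by
    filter_upwards [hlim, ae_all_iff.mpr hb] with q h1 h2
    exact le_of_tendsto h1.abs (Eventually.of_forall h2)
  have h2 : (2 : ℝ≥0∞) ≠ 0 := by norm_num
  have h2t : (2 : ℝ≥0∞) ≠ ⊤ := by norm_num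
  simp only [eLpNorm_eq_lintegral_rpow_enorm_toReal h2 h2t, ENNReal.toReal_ofNat]
  have h0 : (0 : ℝ≥0∞) = 0 ^ (1 / (2 : ℝ)) := by simp
  rw [h0]
  refine (ENNReal.continuous_rpow_const.tendsto 0).comp ?_
  have hz : ∫⁻ _ : α, (0 : ℝ≥0∞) ∂ν = 0 := lintegral_zero
  rw [← hz]
  have hW2 := (hW.const_mul 2).2
  refine tendsto_lintegral_of_dominated_convergence' (fun q => ‖2 * W q‖ₑ ^ (2 : ℝ))
    (fun j => ((hf j).sub hg).enorm.pow_const 2) (fun j => ?_) ?_ ?_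
  · filter_upwards [hb j, hbg] with q h3 h4
    refine ENNReal.rpow_le_rpow ?_ (by norm_num)
    rw [enorm_le_iff_norm_le]
    refine (norm_sub_le _ _).trans ?_
    rw [Real.norm_eq_abs, Real.norm_eq_abs, Real.norm_eq_abs]
    linarith [le_abs_self (2 * W q)]
  · rw [eLpNorm_eq_lintegral_rpow_enorm_toReal h2 h2t, ENNReal.toReal_ofNat] at hW2
    exact ((ENNReal.rpow_lt_top_iff_of_pos (by norm_num)).mp hW2).ne
  · filter_upwards [hlim] with q h3
    have h4 : Tendsto (fun j => f j q - g q) atTop (𝓝 0) := by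
      simpa using h3.sub_const (g q)
    have h5 := (ENNReal.continuous_rpow_const (y := 2)).tendsto _ |>.comp (h4.enorm)
    simpa [Function.comp_def] using h5

lemma memLp_one_add_abs_rpow {α : Type*} [MeasurableSpace α] {ν : Measure α} [IsFiniteMeasure ν]
    {Y : α → ℝ} {p : ℝ} (hp : 0 < p) (hY : MemLp Y (ENNReal.ofReal (2 * p)) ν) :
    MemLp (fun q => (1 + |Y q|) ^ p) 2 ν := by
  have h1 : MemLp (fun q => 1 + |Y q|) (ENNReal.ofReal (2 * p)) ν :=
    (memLp_const (1 : ℝ)).add hY.norm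
  have h2 := h1.norm_rpow_div (ENNReal.ofReal p)
  rw [ENNReal.toReal_ofReal hp.le, ← ENNReal.ofReal_div_of_pos hp, mul_div_cancel_right₀ _ hp.ne',
    ENNReal.ofReal_ofNat] at h2
  refine h2.ae_eq (Eventually.of_forall fun q => ?_)
  change ‖1 + |Y q|‖ ^ p = (1 + |Y q|) ^ p
  rw [Real.norm_of_nonneg (by positivity)]

/-! ### Convergence of compositions with the mode sums. -/

namespace CahnHilliard
open GaussianSobolev

/-- The partial sums of the expansion of `u` along `N` converge to `Z` and are dominated by
`Y ∈ L^{2p}`. -/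
structure IsModeLimit (μ : Measure U) (p : ℝ) (N : ℕ → ℕ) (Z Y : U × ℝ → ℝ) : Prop where
  one_le : 1 ≤ p
  strictMono : StrictMono N
  aestronglyMeasurable : AEStronglyMeasurable Z (μ.prod lam)
  memLp : MemLp Y (ENNReal.ofReal (2 * p)) (μ.prod lam)
  bound : ∀ᵐ q ∂(μ.prod lam), ∀ n, |modeSum (Finset.range (N n)) q| ≤ Y q
  tendsto : ∀ᵐ q ∂(μ.prod lam),
    Tendsto (fun n => modeSum (Finset.range (N n)) q) atTop (𝓝 (Z q))

namespace IsModeLimit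

variable {μ : Measure U} [IsProbabilityMeasure μ] {p : ℝ} {N : ℕ → ℕ} {Z Y : U × ℝ → ℝ}

lemma memLp_weight (h : IsModeLimit μ p N Z Y) (C : ℝ) :
    MemLp (fun q => C * (1 + |Y q|) ^ p) 2 (μ.prod lam) :=
  (memLp_one_add_abs_rpow (by linarith [h.one_le]) h.memLp).const_mul C

omit [IsProbabilityMeasure μ] in
lemma abs_le (h : IsModeLimit μ p N Z Y) : ∀ᵐ q ∂(μ.prod lam), |Z q| ≤ Y q := by
  filter_upwards [h.bound, h.tendsto] with q h1 h2
  exact le_of_tendsto h2.abs (Eventually.of_forall h1)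

omit [IsProbabilityMeasure μ] in
lemma growth_le (h : IsModeLimit μ p N Z Y) {C x y : ℝ} (hC : 0 ≤ C) (hxy : |x| ≤ y) :
    C * (1 + |x|) ^ p ≤ C * (1 + |y|) ^ p :=
  mul_le_mul_of_nonneg_left (Real.rpow_le_rpow (by positivity) (by linarith [le_abs_self y])
    (by linarith [h.one_le])) hC

lemma memLp_comp (h : IsModeLimit μ p N Z Y) {g : ℝ → ℝ} (hg : Continuous g) {C : ℝ}
    (hb : ∀ t, |g t| ≤ C * (1 + |t|) ^ p) : MemLp (fun q => g (Z q)) 2 (μ.prod lam) := by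
  have hC : 0 ≤ C := by simpa using (abs_nonneg _).trans (hb 0)
  refine (h.memLp_weight C).mono (hg.comp_aestronglyMeasurable h.aestronglyMeasurable) ?_
  filter_upwards [h.abs_le] with q hq
  exact ((hb _).trans (h.growth_le hC hq)).trans (le_abs_self _)

lemma memLp_comp_modeSum (h : IsModeLimit μ p N Z Y) {g : ℝ → ℝ} (hg : Continuous g) {C : ℝ}
    (hb : ∀ t, |g t| ≤ C * (1 + |t|) ^ p) (n : ℕ) :
    MemLp (fun q => g (modeSum (Finset.range (N n)) q)) 2 (μ.prod lam) := by
  have hC : 0 ≤ C := by simpa using (abs_nonneg _).trans (hb 0)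
  refine (h.memLp_weight C).mono
    (hg.comp_aestronglyMeasurable (measurable_modeSum _).aestronglyMeasurable) ?_
  filter_upwards [h.bound] with q hq
  exact ((hb _).trans (h.growth_le hC (hq n))).trans (le_abs_self _)

/-- Function and truncation vary together here, hence the hypothesis on moving points; the companion
`tendsto_eLpNorm_modeSum` keeps the truncation fixed and serves the inner limit in the convex
approximation. -/
lemma tendsto_eLpNorm (h : IsModeLimit μ p N Z Y) {g : ℕ → ℝ → ℝ} {φ : ℝ → ℝ}
    (hg : ∀ j, Continuous (g j)) {C : ℝ} (hb : ∀ j t, |g j t| ≤ C * (1 + |t|) ^ p)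
    (hlim : ∀ (x : ℝ) (xs : ℕ → ℝ), Tendsto xs atTop (𝓝 x) →
      Tendsto (fun j => g j (xs j)) atTop (𝓝 (φ x))) :
    Tendsto (fun j => eLpNorm (fun q => g j (modeSum (Finset.range (N j)) q) - φ (Z q)) 2
      (μ.prod lam)) atTop (𝓝 0) := by
  have hC : 0 ≤ C := by simpa using (abs_nonneg _).trans (hb 0 0)
  refine tendsto_eLpNorm_two_of_dominated
    (f := fun j q => g j (modeSum (Finset.range (N j)) q))
    (fun j => (h.memLp_comp_modeSum (hg j) (hb j) j).1) (h.memLp_weight C) (fun j => ?_) ?_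
  · filter_upwards [h.bound] with q hq
    exact (hb j _).trans (h.growth_le hC (hq j))
  · filter_upwards [h.tendsto] with q hq
    exact hlim _ _ hq

lemma tendsto_eLpNorm_modeSum (h : IsModeLimit μ p N Z Y) {g : ℕ → ℝ → ℝ} {φ : ℝ → ℝ}
    (hg : ∀ j, Continuous (g j)) {C : ℝ} (hb : ∀ j t, |g j t| ≤ C * (1 + |t|) ^ p)
    (hlim : ∀ t, Tendsto (fun j => g j t) atTop (𝓝 (φ t))) (n : ℕ) :
    Tendsto (fun j => eLpNorm (fun q => g j (modeSum (Finset.range (N n)) q)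
      - φ (modeSum (Finset.range (N n)) q)) 2 (μ.prod lam)) atTop (𝓝 0) := by
  have hC : 0 ≤ C := by simpa using (abs_nonneg _).trans (hb 0 0)
  refine tendsto_eLpNorm_two_of_dominated
    (f := fun j q => g j (modeSum (Finset.range (N n)) q))
    (fun j => (h.memLp_comp_modeSum (hg j) (hb j) n).1) (h.memLp_weight C) (fun j => ?_)
    (Eventually.of_forall fun q => hlim _)
  filter_upwards [h.bound] with q hq
  exact (hb j _).trans (h.growth_le hC (hq n))

lemma ae_isIdentified (h : IsModeLimit μ p N Z Y) :
    ∀ᵐ u ∂μ, IsIdentified p (fun t => Z (u, t)) u := by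
  have hp := h.one_le
  have h1 : ∀ᵐ u ∂μ, MemLp (fun t => Y (u, t)) (ENNReal.ofReal p) lam := by
    have h2 : MemLp Y (ENNReal.ofReal p) (μ.prod lam) :=
      h.memLp.mono_exponent (ENNReal.ofReal_le_ofReal (by linarith))
    have hp0 : ENNReal.ofReal p ≠ 0 := by
      rw [Ne, ENNReal.ofReal_eq_zero]; linarith
    -- Fubini is applied to the integrable function `|Y| ^ p`, which puts almost every slice of `Y`
    -- in `L^p`.
    have h3 := h2.integrable_norm_rpow hp0 ENNReal.ofReal_ne_top
    filter_upwards [h3.prod_right_ae, h.memLp.1.prodMk_left] with u h4 h5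
    exact (integrable_norm_rpow_iff h5 hp0 ENNReal.ofReal_ne_top).mp h4
  filter_upwards [h1, h.aestronglyMeasurable.prodMk_left, Measure.ae_ae_of_ae_prod h.bound,
    Measure.ae_ae_of_ae_prod h.tendsto] with u h2 h3 h4 h5
  exact isIdentified_of_limit h.strictMono hp h3 h2 h4 h5

lemma ae_Phi1_eq (h : IsModeLimit μ p N Z Y) (φ : ℝ → ℝ) :
    ∀ᵐ u ∂μ, Phi1 φ p u = ((∫ t, φ (Z (u, t)) ∂lam : ℝ) : EReal) := by
  filter_upwards [h.ae_isIdentified] with u hu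
  exact Phi1_eq_of_isIdentified φ h.one_le hu

end IsModeLimit

lemma exists_isModeLimit {μ : Measure U} {α₁ : ℝ} (hα₁ : 3 / 4 < α₁)
    (hμ : IsCenteredGaussian μ (Qpow α₁)) {p : ℝ} (hp : 1 ≤ p) :
    ∃ N Z Y, IsModeLimit μ p N Z Y := by
  obtain ⟨N, Z, Y, h1, h2, h3, h4, h5⟩ := exists_process hα₁ hμ (r := 2 * p) (by linarith)
  exact ⟨N, Z, Y, hp, h1, h2, h3, h4, h5⟩

end CahnHilliard

/-! ### Finite-dimensional potentials, their gradients, and the smoothing effect of `Q^α`. -/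

namespace GaussianSobolev

lemma norm_tsum_smul_sub_sq {H : Type*} [NormedAddCommGroup H] [InnerProductSpace ℝ H]
    [CompleteSpace H] {b : ℕ → H} (hb : Orthonormal ℝ b) {a c : ℕ → ℝ}
    (ha : Summable fun k => a k ^ 2) (hc : Summable fun k => c k ^ 2) :
    ‖∑' k, a k • b k - ∑' k, c k • b k‖ ^ 2 = ∑' k, (a k - c k) ^ 2 := by
  rw [← (summable_smul_of_orthonormal hb ha).tsum_sub (summable_smul_of_orthonormal hb hc)]
  simp only [← sub_smul]
  refine norm_tsum_smul_of_orthonormal hb (Summable.of_nonneg_of_le (fun _ => sq_nonneg _)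
    (fun k => ?_) ((ha.add hc).mul_left 2))
  nlinarith [sq_nonneg (a k + c k)]

end GaussianSobolev

namespace CahnHilliard
open GaussianSobolev

/-- The finite-dimensional potential `u ↦ ∫ f(u_s)`, where `u_s` is the part of `u` in the modes
`s`. -/
def avg (f : ℝ → ℝ) (s : Finset ℕ) (u : U) : ℝ := ∫ t, f (modeSum s (u, t)) ∂lam

/-- The `k`-th coordinate of the element of `U` that represents `v ↦ ∫ g v`. -/
def modeCoeff (g : ℝ → ℝ) (k : ℕ) : ℝ := freq k * ∫ t, g t * eFun k t ∂lam

/-- The gradient of `avg f s`, for `g = f'`. -/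
def avgGrad (g : ℝ → ℝ) (s : Finset ℕ) (u : U) : U :=
  ∑ k ∈ s, modeCoeff (fun t => g (modeSum s (u, t))) k • fBasis k

lemma integrable_comp_modeSum {f : ℝ → ℝ} (hf : Continuous f) (s : Finset ℕ) (u : U) :
    Integrable (fun t => f (modeSum s (u, t))) lam :=
  integrable_lam_of_continuous (hf.comp (continuous_modeSum_right s u))

lemma continuous_modeVec (s : Finset ℕ) : Continuous (modeVec s) := by
  unfold modeVec
  have := continuous_eFun
  fun_prop

lemma norm_modeVec_le (s : Finset ℕ) (t : ℝ) : ‖modeVec s t‖ ≤ ∑ k ∈ s, freq k * √2 := by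
  refine (norm_sum_le s fun k => (freq k * eFun k t) • fBasis k).trans
    (Finset.sum_le_sum fun k _ => ?_)
  refine (norm_smul_le (freq k * eFun k t) (fBasis k)).trans ?_
  have h1 : ‖fBasis k‖ = 1 := orthonormal_fBasis.1 k
  rw [h1, mul_one, norm_mul, Real.norm_eq_abs, Real.norm_eq_abs, abs_of_pos (freq_pos k)]
  exact mul_le_mul_of_nonneg_left (abs_eFun_le k t) (freq_pos k).le

lemma inner_avgGrad {g : ℝ → ℝ} (hg : Continuous g) (s : Finset ℕ) (u v : U) :
    inner ℝ (avgGrad g s u) v = ∫ t, g (modeSum s (u, t)) * inner ℝ (modeVec s t) v ∂lam := by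
  simp only [← modeSum_eq_inner, modeSum, Finset.mul_sum]
  rw [integral_finsetSum]
  · refine (sum_inner (𝕜 := ℝ) s (fun k => modeCoeff (fun t => g (modeSum s (u, t))) k • fBasis k)
      v).trans (Finset.sum_congr rfl fun k _ => ?_)
    refine (real_inner_smul_left (fBasis k) v _).trans ?_
    rw [modeCoeff, ← integral_const_mul, ← integral_mul_const]
    exact integral_congr_ae (Eventually.of_forall fun t => by simp only [modeSum]; ring)
  · intro k _
    exact integrable_lam_of_continuous ((hg.comp (continuous_modeSum_right s u)).mul
      (((continuous_eFun k).const_mul _).mul continuous_const))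

lemma hasFDerivAt_comp_modeSum {f : ℝ → ℝ} (hf : Differentiable ℝ f) (s : Finset ℕ) (t : ℝ) (u : U) :
    HasFDerivAt (fun v => f (modeSum s (v, t)))
      (deriv f (modeSum s (u, t)) • innerSL ℝ (modeVec s t)) u := by
  simp only [modeSum_eq_inner]
  exact (hf _).hasDerivAt.comp_hasFDerivAt u (innerSL ℝ (modeVec s t)).hasFDerivAt

/-- For fixed `t` the mode sum is the inner product with `modeVec s t`, whose norm is bounded in
`t`; with `f'` bounded, differentiation under the integral applies. -/
lemma hasGradientAt_avg {f : ℝ → ℝ} (hf : ContDiff ℝ 1 f) {M : ℝ} (hM : ∀ t, |deriv f t| ≤ M)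
    (s : Finset ℕ) (u : U) : HasGradientAt (avg f s) (avgGrad (deriv f) s u) u := by
  have hd := hf.differentiable one_ne_zero
  have hc := hf.continuous_deriv le_rfl
  have hfd : ∀ t v, fderiv ℝ (fun v => f (modeSum s (v, t))) v
      = deriv f (modeSum s (v, t)) • innerSL ℝ (modeVec s t) := fun t v =>
    (hasFDerivAt_comp_modeSum hd s t v).fderiv
  have hcw : Continuous fun t => (innerSL ℝ (modeVec s t) : U →L[ℝ] ℝ) :=
    (innerSL ℝ (E := U)).continuous.comp (continuous_modeVec s)
  have hM0 : 0 ≤ M := (abs_nonneg _).trans (hM 0)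
  rw [hasGradientAt_iff_hasFDerivAt]
  refine hasFDerivAt_integral_of_bounded (g := fun t v => f (modeSum s (v, t)))
    (C := M * ∑ k ∈ s, freq k * √2)
    (fun t v => (hasFDerivAt_comp_modeSum hd s t v).differentiableAt)
    (fun v => (integrable_comp_modeSum hf.continuous s v).1) (integrable_comp_modeSum hf.continuous s u)
    ?_ (fun t v => ?_) (fun v => ?_)
  · simp only [hfd]
    exact ((hc.comp (continuous_modeSum_right s u)).smul hcw).aestronglyMeasurable
  · rw [hfd, norm_smul, innerSL_apply_norm]
    exact mul_le_mul (hM _) (norm_modeVec_le s t) (norm_nonneg (modeVec s t)) hM0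
  · simp only [hfd]
    exact inner_avgGrad hc s u v

/-- The mode sum at `t` is a linear functional `w t` of the first `n` coordinates, continuous and
bounded in `t`. -/
lemma isSmoothCylinder_avg {f : ℝ → ℝ} (hf : ContDiff ℝ ∞ f)
    (hb : ∀ k : ℕ, ∃ C, ∀ x, ‖iteratedFDeriv ℝ k f x‖ ≤ C) (n : ℕ) :
    IsSmoothCylinder fBasis (avg f (Finset.range n)) := by
  let w : ℝ → (Fin n → ℝ) →L[ℝ] ℝ := fun t =>
    ∑ i : Fin n, (freq i * eFun i t) • ContinuousLinearMap.proj (R := ℝ) i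
  have hw : Continuous w := by
    have := continuous_eFun
    fun_prop
  have hW : ∀ t, ‖w t‖ ≤ ∑ i : Fin n, freq i * √2 := by
    intro t
    refine (norm_sum_le Finset.univ fun i : Fin n => (freq i * eFun i t) •
      (ContinuousLinearMap.proj i : (Fin n → ℝ) →L[ℝ] ℝ)).trans (Finset.sum_le_sum fun i _ => ?_)
    refine (norm_smul_le (freq i * eFun i t)
      (ContinuousLinearMap.proj i : (Fin n → ℝ) →L[ℝ] ℝ)).trans ?_
    have h1 : ‖(ContinuousLinearMap.proj (R := ℝ) i : (Fin n → ℝ) →L[ℝ] ℝ)‖ ≤ 1 :=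
      ContinuousLinearMap.opNorm_le_bound _ zero_le_one fun z => by
        simpa using norm_le_pi_norm z i
    rw [norm_mul, Real.norm_eq_abs, Real.norm_eq_abs, abs_of_pos (freq_pos i)]
    refine (mul_le_of_le_one_right (mul_nonneg (freq_pos i).le (abs_nonneg _)) h1).trans ?_
    exact mul_le_mul_of_nonneg_left (abs_eFun_le i t) (freq_pos i).le
  obtain ⟨h1, h2⟩ := contDiff_integral_comp_dual (ν := lam) hf hb hw hW
  refine ⟨n, _, h1, h2, funext fun u => ?_⟩
  refine integral_congr_ae (Eventually.of_forall fun t => ?_)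
  simp only [modeSum, Finset.sum_range]
  simp [w]

/-- `Q^α` applied to the functional `v ↦ ∫ g v`. -/
def smoothed (α : ℝ) (g : ℝ → ℝ) : U := ∑' k, (eig k ^ α * modeCoeff g k) • fBasis k

lemma abs_modeCoeff_le {g : ℝ → ℝ} (hg : Integrable g lam) (k : ℕ) :
    |modeCoeff g k| ≤ freq k * (√2 * ∫ t, |g t| ∂lam) := by
  rw [modeCoeff, abs_mul, abs_of_pos (freq_pos k)]
  refine mul_le_mul_of_nonneg_left ?_ (freq_pos k).le
  rw [← integral_const_mul]
  refine norm_integral_le_of_norm_le (f := fun t => g t * eFun k t) (hg.abs.const_mul √2)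
    (Eventually.of_forall fun t => ?_)
  rw [norm_mul, mul_comm]
  exact mul_le_mul_of_nonneg_right (abs_eFun_le k t) (norm_nonneg _)

lemma sq_eig_mul_modeCoeff_le (α : ℝ) {g : ℝ → ℝ} (hg : Integrable g lam) (k : ℕ) :
    (eig k ^ α * modeCoeff g k) ^ 2
      ≤ freq k ^ 2 * eig k ^ (2 * α) * (2 * (∫ t, |g t| ∂lam) ^ 2) := by
  have h1 : (modeCoeff g k) ^ 2 ≤ (freq k * (√2 * ∫ t, |g t| ∂lam)) ^ 2 := by
    rw [← sq_abs]
    exact pow_le_pow_left₀ (abs_nonneg _) (abs_modeCoeff_le hg k) 2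
  rw [mul_pow, mul_pow, Real.sq_sqrt (by norm_num)] at h1
  have h2 : (eig k ^ α) ^ 2 = eig k ^ (2 * α) := by
    rw [← Real.rpow_natCast, ← Real.rpow_mul (eig_pos k).le, mul_comm]; norm_cast
  rw [mul_pow, h2]
  have h3 := (eig_rpow_pos (2 * α) k).le
  nlinarith [mul_le_mul_of_nonneg_left h1 h3]

variable {α : ℝ}

lemma summable_sq_eig_mul_modeCoeff (hα : 3 / 8 < α) {g : ℝ → ℝ} (hg : Integrable g lam) :
    Summable fun k => (eig k ^ α * modeCoeff g k) ^ 2 :=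
  Summable.of_nonneg_of_le (fun _ => sq_nonneg _) (sq_eig_mul_modeCoeff_le α hg)
    ((summable_freq_sq_mul_eig (by linarith)).mul_right _)

lemma inner_smoothed (hα : 3 / 8 < α) {g : ℝ → ℝ} (hg : Integrable g lam) (i : ℕ) :
    inner ℝ (fBasis i) (smoothed α g) = eig i ^ α * modeCoeff g i :=
  inner_tsum_smul_of_orthonormal (H := U) orthonormal_fBasis (summable_sq_eig_mul_modeCoeff hα hg) i

/-- Only the `L¹` norm of `g` enters: each cosine coefficient is bounded by it, and the weights
`freq k ^ 2 * eig k ^ (2 * α)` are summable. -/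
lemma norm_smoothed_le (hα : 3 / 8 < α) {g : ℝ → ℝ} (hg : Integrable g lam) :
    ‖smoothed α g‖ ≤ √(2 * ∑' k, freq k ^ 2 * eig k ^ (2 * α)) * ∫ t, |g t| ∂lam := by
  have hI : 0 ≤ ∫ t, |g t| ∂lam := integral_nonneg fun t => abs_nonneg _
  have hs := summable_freq_sq_mul_eig (s := 2 * α) (by linarith)
  have hK : 0 ≤ ∑' k, freq k ^ 2 * eig k ^ (2 * α) :=
    tsum_nonneg fun k => mul_nonneg (sq_nonneg _) (eig_rpow_pos _ _).le
  refine abs_le_of_sq_le_sq' ?_ (by positivity) |>.2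
  refine (norm_tsum_smul_of_orthonormal (H := U) orthonormal_fBasis
    (summable_sq_eig_mul_modeCoeff hα hg)).trans_le ?_
  refine ((summable_sq_eig_mul_modeCoeff hα hg).tsum_le_tsum (sq_eig_mul_modeCoeff_le α hg)
    (hs.mul_right _)).trans_eq ?_
  rw [tsum_mul_right, mul_pow, Real.sq_sqrt (by positivity)]
  ring

lemma modeCoeff_sub {g h : ℝ → ℝ} (hg : Integrable g lam) (hh : Integrable h lam) (k : ℕ) :
    modeCoeff (fun t => g t - h t) k = modeCoeff g k - modeCoeff h k := by
  simp only [modeCoeff, sub_mul]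
  rw [integral_sub (integrable_mul_of_continuous hg (continuous_eFun k))
    (integrable_mul_of_continuous hh (continuous_eFun k)), mul_sub]

lemma inner_fBasis_avgGrad (g : ℝ → ℝ) (n : ℕ) (u : U) (k : ℕ) :
    inner ℝ (fBasis k) (avgGrad g (Finset.range n) u)
      = if k < n then modeCoeff (fun t => g (modeSum (Finset.range n) (u, t))) k else 0 := by
  split_ifs with hk
  · rw [avgGrad, orthonormal_fBasis.inner_right_sum _ (Finset.mem_range.mpr hk)]
  · refine (inner_sum (𝕜 := ℝ) (Finset.range n) _ (fBasis k)).trans (Finset.sum_eq_zero ?_)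
    intro j hj
    refine (real_inner_smul_right (fBasis k) (fBasis j) _).trans ?_
    rw [orthonormal_fBasis.2 (by rintro rfl; exact hk (Finset.mem_range.mp hj)), mul_zero]

/-- The tail of the series `∑ k, freq k ^ 2 * eig k ^ (2 * α)`. -/
def eigTail (α : ℝ) (n : ℕ) : ℝ := ∑' k, if k < n then 0 else freq k ^ 2 * eig k ^ (2 * α)

lemma summable_eigTail (hα : 3 / 8 < α) (n : ℕ) :
    Summable fun k => if k < n then 0 else freq k ^ 2 * eig k ^ (2 * α) := by
  have hs := summable_freq_sq_mul_eig (s := 2 * α) (by linarith)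
  have h0 := fun k => mul_nonneg (sq_nonneg (freq k)) (eig_rpow_pos (2 * α) k).le
  refine hs.of_nonneg_of_le (fun k => ?_) fun k => ?_ <;> split_ifs <;> simp [h0]

lemma eigTail_nonneg (α : ℝ) (n : ℕ) : 0 ≤ eigTail α n := by
  refine tsum_nonneg fun k => ?_
  have := mul_nonneg (sq_nonneg (freq k)) (eig_rpow_pos (2 * α) k).le
  split_ifs <;> simp [this]

lemma tendsto_eigTail (hα : 3 / 8 < α) : Tendsto (eigTail α) atTop (𝓝 0) := by
  have hs := summable_freq_sq_mul_eig (s := 2 * α) (by linarith)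
  have h0 := fun k => mul_nonneg (sq_nonneg (freq k)) (eig_rpow_pos (2 * α) k).le
  have h := tendsto_tsum_of_dominated_convergence (𝓕 := atTop)
    (f := fun n k => if k < n then 0 else freq k ^ 2 * eig k ^ (2 * α)) (g := fun _ => (0 : ℝ)) hs
    (fun k => tendsto_const_nhds.congr' ((eventually_gt_atTop k).mono fun n hn => by simp [hn]))
    (Eventually.of_forall fun n k => by
      rw [Real.norm_of_nonneg] <;> split_ifs <;> simp [h0])
  rw [tsum_zero] at h
  exact h

/-- Split the coordinates at `n`. Below `n` both come from integrals, and their difference is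
controlled by the `L¹` distance of the integrands; from `n` on the finite-dimensional gradient
vanishes, leaving the tail of the series for `g`. -/
lemma norm_Qpow_avgGrad_sub_le (hα : 3 / 8 < α) {f g : ℝ → ℝ} {n : ℕ} {u : U} (hf : Continuous f)
    (hg : Integrable g lam) :
    ‖Qpow α (avgGrad f (Finset.range n) u) - smoothed α g‖
      ≤ √(2 * ∑' k, freq k ^ 2 * eig k ^ (2 * α))
          * (∫ t, |f (modeSum (Finset.range n) (u, t)) - g t| ∂lam)
        + √(2 * eigTail α n) * ∫ t, |g t| ∂lam := by
  set F : ℝ → ℝ := fun t => f (modeSum (Finset.range n) (u, t)) with hF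
  have hFi : Integrable F lam := integrable_comp_modeSum hf _ u
  have hDi : Integrable (fun t => F t - g t) lam := hFi.sub hg
  set A := ∫ t, |F t - g t| ∂lam with hA
  set I := ∫ t, |g t| ∂lam with hI
  have hA0 : 0 ≤ A := integral_nonneg fun t => abs_nonneg _
  have hI0 : 0 ≤ I := integral_nonneg fun t => abs_nonneg _
  have hs := summable_freq_sq_mul_eig (s := 2 * α) (by linarith)
  have ht := summable_eigTail hα n
  have hK : 0 ≤ ∑' k, freq k ^ 2 * eig k ^ (2 * α) :=
    tsum_nonneg fun k => mul_nonneg (sq_nonneg _) (eig_rpow_pos _ _).le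
  have hτ := eigTail_nonneg α n
  set a : ℕ → ℝ := fun k => eig k ^ α * inner ℝ (fBasis k) (avgGrad f (Finset.range n) u) with ha
  set c : ℕ → ℝ := fun k => eig k ^ α * modeCoeff g k with hc
  have has : Summable fun k => a k ^ 2 := summable_diagPow_coeff (H := U) orthonormal_fBasis
    (fun k => (eig_pos k).le) eig_le_one (by linarith) _
  have hcs : Summable fun k => c k ^ 2 := summable_sq_eig_mul_modeCoeff hα hg
  have hle : ∀ k, (a k - c k) ^ 2 ≤ freq k ^ 2 * eig k ^ (2 * α) * (2 * A ^ 2)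
      + (if k < n then 0 else freq k ^ 2 * eig k ^ (2 * α)) * (2 * I ^ 2) := by
    intro k
    have h0 := mul_nonneg (sq_nonneg (freq k)) (eig_rpow_pos (2 * α) k).le
    simp only [ha, hc, inner_fBasis_avgGrad]
    split_ifs with hk
    · rw [← mul_sub, ← modeCoeff_sub hFi hg, zero_mul, add_zero]
      exact sq_eig_mul_modeCoeff_le α hDi k
    · rw [mul_zero, zero_sub, neg_sq]
      have := sq_eig_mul_modeCoeff_le α hg k
      have h3 : 0 ≤ freq k ^ 2 * eig k ^ (2 * α) * (2 * A ^ 2) := mul_nonneg h0 (by positivity)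
      linarith
  have hRs := (hs.mul_right (2 * A ^ 2)).add (ht.mul_right (2 * I ^ 2))
  have hds : Summable fun k => (a k - c k) ^ 2 :=
    Summable.of_nonneg_of_le (fun _ => sq_nonneg _) hle hRs
  refine abs_le_of_sq_le_sq' ?_ (by positivity) |>.2
  refine (norm_tsum_smul_sub_sq (H := U) orthonormal_fBasis has hcs).trans_le ?_
  refine (hds.tsum_le_tsum hle hRs).trans ?_
  rw [(hs.mul_right _).tsum_add (ht.mul_right _), tsum_mul_right, tsum_mul_right]
  change _ + eigTail α n * _ ≤ _
  have h1 : (√(2 * ∑' k, freq k ^ 2 * eig k ^ (2 * α))) ^ 2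
    = 2 * ∑' k, freq k ^ 2 * eig k ^ (2 * α) := Real.sq_sqrt (by positivity)
  have h2 : (√(2 * eigTail α n)) ^ 2 = 2 * eigTail α n := Real.sq_sqrt (by positivity)
  -- The estimates bound the square of the norm by a sum of two squares; adding the nonnegative
  -- cross term makes it the square of the asserted bound.
  have h3 : 0 ≤ (√(2 * ∑' k, freq k ^ 2 * eig k ^ (2 * α)) * A) * (√(2 * eigTail α n) * I) := by
    positivity
  rw [add_sq, mul_pow, mul_pow, h1, h2]
  linarith

end CahnHilliard

/-! ### Polynomial growth of `φ` and its derivative. -/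

section Growth

variable {φ : ℝ → ℝ} {p A : ℝ}

/-- The weight `1 + |t|` is at least `1`, so its powers increase with the exponent; this is why all
later growth bounds are expressed through it. -/
lemma abs_le_of_growth (hp : 1 ≤ p) (hA : 0 ≤ A) {t d : ℝ} (h : |d| ≤ A * (1 + |t| ^ (p - 1))) :
    |d| ≤ 2 * A * (1 + |t|) ^ (p - 1) := by
  have h1 : |t| ^ (p - 1) ≤ (1 + |t|) ^ (p - 1) :=
    Real.rpow_le_rpow (abs_nonneg _) (by linarith) (by linarith)
  have h2 : 1 ≤ (1 + |t|) ^ (p - 1) :=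
    Real.one_le_rpow (by linarith [abs_nonneg t]) (by linarith)
  nlinarith

lemma abs_sub_le_of_deriv_growth (hφ : Differentiable ℝ φ) (hp : 1 ≤ p) (hA : 0 ≤ A)
    (h : ∀ t, |deriv φ t| ≤ A * (1 + |t|) ^ (p - 1)) (t : ℝ) :
    |φ t - φ 0| ≤ A * (1 + |t|) ^ p := by
  have h1 : ∀ x ∈ uIcc 0 t, ‖deriv φ x‖ ≤ A * (1 + |t|) ^ (p - 1) := by
    intro x hx
    have hx' : |x| ≤ |t| := by simpa using abs_sub_left_of_mem_uIcc hx
    exact (h x).trans (mul_le_mul_of_nonneg_left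
      (Real.rpow_le_rpow (by positivity) (by linarith) (by linarith)) hA)
  have h2 := (convex_uIcc 0 t).norm_image_sub_le_of_norm_deriv_le (fun x _ => hφ x) h1
    left_mem_uIcc right_mem_uIcc
  rw [sub_zero, Real.norm_eq_abs, Real.norm_eq_abs] at h2
  refine h2.trans ?_
  have h3 : (1 + |t|) ^ p = (1 + |t|) ^ (p - 1) * (1 + |t|) := by
    rw [← Real.rpow_add_one (by positivity)]; simp
  have h4 : 0 ≤ A * (1 + |t|) ^ (p - 1) := by positivity
  rw [h3, ← mul_assoc]
  exact mul_le_mul_of_nonneg_left (by linarith) h4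

lemma exists_growth_bound (hφ : Differentiable ℝ φ) (hp : 1 ≤ p) (hA : 0 ≤ A)
    (h : ∀ t, |deriv φ t| ≤ A * (1 + |t|) ^ (p - 1)) :
    ∃ C, ∀ t, |φ t| ≤ C * (1 + |t|) ^ p ∧ |deriv φ t| ≤ C * (1 + |t|) ^ p := by
  refine ⟨|φ 0| + A, fun t => ⟨?_, ?_⟩⟩
  · have h1 := abs_sub_le_of_deriv_growth hφ hp hA h t
    have h2 : 1 ≤ (1 + |t|) ^ p := Real.one_le_rpow (by linarith [abs_nonneg t]) (by linarith)
    have h3 : |φ t| ≤ |φ t - φ 0| + |φ 0| := by simpa using abs_add_le (φ t - φ 0) (φ 0)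
    nlinarith [abs_nonneg (φ 0)]
  · have h1 : (1 + |t|) ^ (p - 1) ≤ (1 + |t|) ^ p :=
      Real.rpow_le_rpow_of_exponent_le (by linarith [abs_nonneg t]) (by linarith)
    have h2 : 0 ≤ |φ 0| * (1 + |t|) ^ p := by positivity
    nlinarith [h t, mul_le_mul_of_nonneg_left h1 hA]

end Growth

/-! ### From `L¹` bounds in `t` to `L²` bounds in `u`. -/

lemma eLpNorm_le_of_norm_le_integral_abs {α β E : Type*} [MeasurableSpace α] [MeasurableSpace β]
    [NormedAddCommGroup E] {μ : Measure α} {ν : Measure β} [SFinite μ] [IsProbabilityMeasure ν]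
    {F : α → E} {f g : α × β → ℝ} {K L : ℝ} (hK : 0 ≤ K) (hL : 0 ≤ L)
    (hf : AEStronglyMeasurable f (μ.prod ν)) (hg : AEStronglyMeasurable g (μ.prod ν))
    (h : ∀ᵐ u ∂μ, ‖F u‖ ≤ K * (∫ t, |f (u, t)| ∂ν) + L * ∫ t, |g (u, t)| ∂ν) :
    eLpNorm F 2 μ ≤ ENNReal.ofReal K * eLpNorm f 2 (μ.prod ν)
      + ENNReal.ofReal L * eLpNorm g 2 (μ.prod ν) := by
  have hm : ∀ {g : α × β → ℝ}, AEStronglyMeasurable g (μ.prod ν) →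
      AEStronglyMeasurable (fun u => ∫ t, |g (u, t)| ∂ν) μ := fun {g} hg =>
    AEStronglyMeasurable.integral_prod_right' (f := fun q => |g q|) hg.norm
  have hc : ∀ {c : ℝ} {g : α × β → ℝ}, 0 ≤ c → AEStronglyMeasurable g (μ.prod ν) →
      eLpNorm (fun u => c * ∫ t, |g (u, t)| ∂ν) 2 μ
        ≤ ENNReal.ofReal c * eLpNorm g 2 (μ.prod ν) := by
    intro c g hc hg
    refine (eLpNorm_const_smul_le (c := c) (f := fun u => ∫ t, |g (u, t)| ∂ν)).trans ?_
    rw [Real.enorm_eq_ofReal hc]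
    exact mul_le_mul_right (eLpNorm_integral_abs_le hg) _
  refine (eLpNorm_mono_ae_real h).trans ?_
  refine (eLpNorm_add_le ((hm hf).const_mul K) ((hm hg).const_mul _) one_le_two).trans ?_
  exact add_le_add (hc hK hf) (hc hL hg)

lemma tendsto_eLpNorm_of_norm_le_integral_abs {α β E : Type*} [MeasurableSpace α]
    [MeasurableSpace β] [NormedAddCommGroup E] {μ : Measure α} {ν : Measure β} [SFinite μ]
    [IsProbabilityMeasure ν] {F : ℕ → α → E} {f : ℕ → α × β → ℝ} {g : α × β → ℝ} {K : ℝ} {L : ℕ → ℝ}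
    (hK : 0 ≤ K) (hL : ∀ j, 0 ≤ L j) (hL0 : Tendsto L atTop (𝓝 0))
    (hf : ∀ j, AEStronglyMeasurable (f j) (μ.prod ν)) (hg : MemLp g 2 (μ.prod ν))
    (hf0 : Tendsto (fun j => eLpNorm (f j) 2 (μ.prod ν)) atTop (𝓝 0))
    (h : ∀ j, ∀ᵐ u ∂μ, ‖F j u‖ ≤ K * (∫ t, |f j (u, t)| ∂ν) + L j * ∫ t, |g (u, t)| ∂ν) :
    Tendsto (fun j => eLpNorm (F j) 2 μ) atTop (𝓝 0) := by
  refine tendsto_of_tendsto_of_tendsto_of_le_of_le tendsto_const_nhds ?_ (fun _ => zero_le)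
    fun j => eLpNorm_le_of_norm_le_integral_abs hK (hL j) (hf j) hg.1 (h j)
  have h1 := ENNReal.Tendsto.const_mul (a := ENNReal.ofReal K) hf0 (Or.inr ENNReal.ofReal_ne_top)
  have h2 := ENNReal.Tendsto.mul_const (b := eLpNorm g 2 (μ.prod ν)) (ENNReal.tendsto_ofReal hL0)
    (Or.inr hg.2.ne)
  simpa using h1.add h2

lemma memLp_of_norm_le_integral_abs {α β E : Type*} [MeasurableSpace α] [MeasurableSpace β]
    [NormedAddCommGroup E] {μ : Measure α} {ν : Measure β} [SFinite μ] [IsProbabilityMeasure ν]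
    {F : α → E} {g : α × β → ℝ} {K : ℝ} (hF : AEStronglyMeasurable F μ) (hg : MemLp g 2 (μ.prod ν))
    (h : ∀ᵐ u ∂μ, ‖F u‖ ≤ K * ∫ t, |g (u, t)| ∂ν) : MemLp F 2 μ :=
  ((memLp_integral_abs hg).const_mul K).mono hF (h.mono fun _ hu => hu.trans (le_abs_self _))

/-! ### The Sobolev gradient of the potential. -/

namespace CahnHilliard
open GaussianSobolev

instance : IsProbabilityMeasure lam := ⟨by simp⟩

variable {μ : Measure U} [IsProbabilityMeasure μ] {p α : ℝ} {N : ℕ → ℕ} {Z Y : U × ℝ → ℝ}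

omit [IsProbabilityMeasure μ] in
lemma aestronglyMeasurable_modeCoeff {g : U × ℝ → ℝ} (hg : AEStronglyMeasurable g (μ.prod lam))
    (k : ℕ) : AEStronglyMeasurable (fun u => modeCoeff (fun t => g (u, t)) k) μ := by
  refine AEStronglyMeasurable.const_mul ?_ (freq k)
  refine AEStronglyMeasurable.integral_prod_right' (f := fun q : U × ℝ => g q * eFun k q.2) ?_
  exact hg.mul ((continuous_eFun k).comp continuous_snd).aestronglyMeasurable

lemma aestronglyMeasurable_smoothed (hα : 3 / 8 < α) {g : U × ℝ → ℝ}
    (hg : Integrable g (μ.prod lam)) :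
    AEStronglyMeasurable (fun u => smoothed α fun t => g (u, t)) μ := by
  refine aestronglyMeasurable_of_tendsto_ae atTop
    (f := fun n u => ∑ k ∈ Finset.range n,
      (eig k ^ α * modeCoeff (fun t => g (u, t)) k) • fBasis k) (fun n => ?_) ?_
  · exact Finset.aestronglyMeasurable_fun_sum _ fun k _ =>
      ((aestronglyMeasurable_modeCoeff hg.1 k).const_mul _).smul_const _
  · filter_upwards [hg.prod_right_ae] with u hu
    exact (summable_smul_of_orthonormal (H := U) orthonormal_fBasis
      (summable_sq_eig_mul_modeCoeff hα hu)).hasSum.tendsto_sum_nat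

lemma memLp_smoothed (hα : 3 / 8 < α) {g : U × ℝ → ℝ} (hg : MemLp g 2 (μ.prod lam)) :
    MemLp (fun u => smoothed α fun t => g (u, t)) 2 μ := by
  have hgi := hg.integrable one_le_two
  refine memLp_of_norm_le_integral_abs (E := U)
    (F := fun u => smoothed α fun t => g (u, t)) (aestronglyMeasurable_smoothed hα hgi) hg
    (K := √(2 * ∑' k, freq k ^ 2 * eig k ^ (2 * α))) ?_
  filter_upwards [hgi.prod_right_ae] with u hu
  exact norm_smoothed_le hα hu

/-- The approximants `avg (f j) (Finset.range (N j))` smooth and truncate simultaneously. The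
gradient error is an `L¹` distance, which vanishes in `L²` by domination, plus a tail factor times a
fixed `L²` function. -/
lemma IsModeLimit.isSobolevGrad (h : IsModeLimit μ p N Z Y) (hα : 3 / 8 < α) {φ : ℝ → ℝ}
    (hφ : ContDiff ℝ 1 φ) {C : ℝ}
    (hb : ∀ t, |φ t| ≤ C * (1 + |t|) ^ p ∧ |deriv φ t| ≤ C * (1 + |t|) ^ p) :
    IsSobolevGrad μ fBasis (Qpow α) (Phi1 φ p)
      fun u => smoothed α fun t => deriv φ (Z (u, t)) := by
  have hp := h.one_le
  obtain ⟨f, hf, hfb, ⟨C', hC'⟩, hlim⟩ := exists_smooth_approx hφ (by linarith)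
    (fun t => (hb t).1) (fun t => (hb t).2)
  have hf1 : ∀ j, ContDiff ℝ 1 (f j) := fun j => (hf j).of_le (by simp)
  have hdc : ∀ j, Continuous (deriv (f j)) := fun j => (hf1 j).continuous_deriv le_rfl
  have hφ' : Continuous (deriv φ) := hφ.continuous_deriv le_rfl
  have hdb : ∀ j, ∃ M, ∀ t, |deriv (f j) t| ≤ M := by
    intro j
    obtain ⟨M, hM⟩ := hfb j 1
    refine ⟨M, fun t => ?_⟩
    have h1 := hM t
    rw [norm_iteratedFDeriv_eq_norm_iteratedDeriv, iteratedDeriv_one] at h1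
    exact h1
  have hZ := h.memLp_comp hφ.continuous fun t => (hb t).1
  have hZ' := h.memLp_comp hφ' fun t => (hb t).2
  have hm : ∀ j, AEStronglyMeasurable
      (fun q => f j (modeSum (Finset.range (N j)) q) - φ (Z q)) (μ.prod lam) := fun j =>
    (h.memLp_comp_modeSum (hf1 j).continuous (fun t => (hC' j t).1) j).1.sub hZ.1
  have hm' : ∀ j, AEStronglyMeasurable
      (fun q => deriv (f j) (modeSum (Finset.range (N j)) q) - deriv φ (Z q)) (μ.prod lam) := fun j =>
    (h.memLp_comp_modeSum (hdc j) (fun t => (hC' j t).2) j).1.sub hZ'.1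
  refine ⟨memLp_smoothed hα hZ', fun u => ∫ t, φ (Z (u, t)) ∂lam, ?_, h.ae_Phi1_eq φ,
    fun j => avg (f j) (Finset.range (N j)), fun j => isSmoothCylinder_avg (hf j) (hfb j) _, ?_, ?_⟩
  · refine (memLp_integral_abs hZ).mono
      (AEStronglyMeasurable.integral_prod_right' (f := fun q => φ (Z q)) hZ.1)
      (Eventually.of_forall fun u => ?_)
    exact (norm_integral_le_integral_norm _).trans (le_abs_self _)
  · have h1 := h.tendsto_eLpNorm (fun j => (hf1 j).continuous) (fun j t => (hC' j t).1)
      fun x xs hx => (hlim x xs hx).1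
    refine tendsto_of_tendsto_of_tendsto_of_le_of_le tendsto_const_nhds h1 (fun _ => zero_le)
      fun j => ?_
    refine (eLpNorm_mono_ae_real ?_).trans (eLpNorm_integral_abs_le (hm j))
    filter_upwards [(hZ.integrable one_le_two).prod_right_ae] with u hu
    rw [avg, ← integral_sub (integrable_comp_modeSum (hf1 j).continuous _ _) hu]
    exact norm_integral_le_integral_norm _
  · have h1 := h.tendsto_eLpNorm hdc (fun j t => (hC' j t).2) fun x xs hx => (hlim x xs hx).2
    have hgrad : ∀ j u, gradient (avg (f j) (Finset.range (N j))) u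
        = avgGrad (deriv (f j)) (Finset.range (N j)) u := fun j u =>
      (hasGradientAt_avg (hf1 j) (hdb j).choose_spec _ u).gradient
    have hL : Tendsto (fun j => √(2 * eigTail α (N j))) atTop (𝓝 0) := by
      have h4 := ((tendsto_eigTail hα).comp h.strictMono.tendsto_atTop).const_mul 2
      have h5 := (Real.continuous_sqrt.tendsto _).comp h4
      simpa [Function.comp_def] using h5
    refine tendsto_eLpNorm_of_norm_le_integral_abs (E := U)
      (K := √(2 * ∑' k, freq k ^ 2 * eig k ^ (2 * α))) (L := fun j => √(2 * eigTail α (N j)))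
      (Real.sqrt_nonneg _) (fun _ => Real.sqrt_nonneg _) hL hm' hZ' h1 fun j => ?_
    filter_upwards [(hZ'.integrable one_le_two).prod_right_ae] with u hu
    rw [hgrad]
    exact norm_Qpow_avgGrad_sub_le hα (hdc j) hu

end CahnHilliard

/-! ### Convex approximation and the essential bound on the gradient. -/

lemma tendsto_eLpNorm_of_tendsto_eLpNorm_sub {α E : Type*} [MeasurableSpace α]
    [NormedAddCommGroup E] {μ : Measure α} {q : ℝ≥0∞} (hq : 1 ≤ q) {D : ℕ → α → E} {F : α → E}
    (hD : ∀ m, AEStronglyMeasurable (D m) μ) (hF : AEStronglyMeasurable F μ)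
    (h : Tendsto (fun m => eLpNorm (fun x => D m x - F x) q μ) atTop (𝓝 0)) :
    Tendsto (fun m => eLpNorm (D m) q μ) atTop (𝓝 (eLpNorm F q μ)) := by
  have h1 := ENNReal.Tendsto.sub (tendsto_const_nhds (x := eLpNorm F q μ)) h
    (Or.inr ENNReal.zero_ne_top)
  have h2 := (tendsto_const_nhds (x := eLpNorm F q μ)).add h
  rw [tsub_zero] at h1
  rw [add_zero] at h2
  refine tendsto_of_tendsto_of_tendsto_of_le_of_le h1 h2 (fun m => ?_) fun m => ?_
  · rw [tsub_le_iff_right]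
    have h3 := eLpNorm_sub_le (hD m) ((hD m).sub hF) hq
    have e : D m - (D m - F) = F := sub_sub_cancel _ _
    rw [e] at h3
    exact h3
  · have h3 := eLpNorm_add_le hF ((hD m).sub hF) hq
    have e : F + (D m - F) = D m := add_sub_cancel _ _
    rw [e] at h3
    exact h3

namespace CahnHilliard
open GaussianSobolev

lemma convexOn_avg {f : ℝ → ℝ} (hf : ConvexOn ℝ univ f) (hc : Continuous f) (s : Finset ℕ) :
    ConvexOn ℝ univ (avg f s) := by
  refine ⟨convex_univ, fun u _ v _ a b ha hb hab => ?_⟩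
  have h1 : ∀ t, modeSum s (a • u + b • v, t) = a • modeSum s (u, t) + b • modeSum s (v, t) := by
    intro t
    simp only [modeSum_eq_inner]
    refine (inner_add_right (𝕜 := ℝ) (modeVec s t) (a • u) (b • v)).trans ?_
    exact congrArg₂ (· + ·) (real_inner_smul_right (modeVec s t) u a)
      (real_inner_smul_right (modeVec s t) v b)
  have hu := (integrable_comp_modeSum hc s u).const_mul a
  have hv := (integrable_comp_modeSum hc s v).const_mul b
  simp only [avg, smul_eq_mul]
  rw [← integral_const_mul, ← integral_const_mul, ← integral_add hu hv]
  refine integral_mono (integrable_comp_modeSum hc s _) (hu.add hv) fun t => ?_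
  simp only [h1]
  exact hf.2 (mem_univ _) (mem_univ _) ha hb hab

/-- Jensen's inequality, since the mode sums have mean zero. With `f 0 = φ 0`, the value of the
potential at `u = 0`, this keeps the approximants above the infimum. -/
lemma le_avg {f : ℝ → ℝ} (hf : ConvexOn ℝ univ f) (hc : Continuous f) (s : Finset ℕ) (u : U) :
    f 0 ≤ avg f s u := by
  have h := hf.map_integral_le hc.continuousOn isClosed_univ (μ := lam)
    (f := fun t => modeSum s (u, t)) (Eventually.of_forall fun _ => mem_univ _)
    (integrable_lam_of_continuous (continuous_modeSum_right s u)) (integrable_comp_modeSum hc s u)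
  rwa [integral_modeSum] at h

lemma iInf_Phi1_le (φ : ℝ → ℝ) {p : ℝ} (hp : 1 ≤ p) : ⨅ u, Phi1 φ p u ≤ (φ 0 : EReal) := by
  refine (iInf_le _ 0).trans ?_
  rw [Phi1_eq_of_isIdentified φ hp (x := fun _ => 0) ⟨MemLp.zero, by simp, fun y => by simp⟩]
  simp

lemma bot_lt_iInf_Phi1 {φ : ℝ → ℝ} (hφ : BddBelow (range φ)) (p : ℝ) :
    ⊥ < ⨅ u, Phi1 φ p u := by
  obtain ⟨c, hc⟩ := hφ
  -- The `0` covers representatives whose composition with `φ` is not integrable, where the integral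
  -- takes its default value.
  refine (EReal.bot_lt_coe (min c 0)).trans_le (le_iInf fun u => ?_)
  unfold Phi1
  split_ifs with h
  · rw [EReal.coe_le_coe_iff]
    by_cases hi : Integrable (fun t => φ (h.choose t)) lam
    · refine (min_le_left c 0).trans ?_
      have h1 := integral_mono (integrable_const c) hi fun t => hc (mem_range_self _)
      simpa using h1
    · rw [integral_undef hi]
      exact min_le_right c 0
  · exact le_top

lemma lipschitzWith_avgGrad {g : ℝ → ℝ} {K : ℝ≥0} (hg : LipschitzWith K g) (s : Finset ℕ) :
    ∃ K' : ℝ≥0, LipschitzWith K' (avgGrad g s) := by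
  set W := ∑ k ∈ s, freq k * √2
  have hW : 0 ≤ W := Finset.sum_nonneg fun k _ => mul_nonneg (freq_pos k).le (Real.sqrt_nonneg _)
  refine ⟨(W * (K * W)).toNNReal, LipschitzWith.of_dist_le_mul fun u v => ?_⟩
  rw [Real.coe_toNNReal _ (by positivity), dist_eq_norm, dist_eq_norm]
  have hsub : ∀ t, |g (modeSum s (u, t)) - g (modeSum s (v, t))| ≤ K * W * ‖u - v‖ := by
    intro t
    refine (hg.norm_sub_le _ _).trans ?_
    rw [mul_assoc]
    refine mul_le_mul_of_nonneg_left ?_ K.2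
    have e : modeSum s (u, t) - modeSum s (v, t) = inner ℝ (modeVec s t) (u - v) := by
      rw [modeSum_eq_inner, modeSum_eq_inner]
      exact (inner_sub_right (𝕜 := ℝ) (modeVec s t) u v).symm
    rw [e]
    exact (norm_inner_le_norm (𝕜 := ℝ) (modeVec s t) (u - v)).trans
      (mul_le_mul_of_nonneg_right (norm_modeVec_le s t) (norm_nonneg (u - v)))
  have hu := integrable_comp_modeSum hg.continuous s u
  have hv := integrable_comp_modeSum hg.continuous s v
  have hI : ∫ t, |g (modeSum s (u, t)) - g (modeSum s (v, t))| ∂lam ≤ K * W * ‖u - v‖ := by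
    have h1 := integral_mono (hu.sub hv).abs (integrable_const (K * W * ‖u - v‖)) hsub
    simpa using h1
  have e : avgGrad g s u - avgGrad g s v = ∑ k ∈ s,
      modeCoeff (fun t => g (modeSum s (u, t)) - g (modeSum s (v, t))) k • fBasis k := by
    refine (Finset.sum_sub_distrib (fun k => modeCoeff (fun t => g (modeSum s (u, t))) k • fBasis k)
      fun k => modeCoeff (fun t => g (modeSum s (v, t))) k • fBasis k).symm.trans
        (Finset.sum_congr rfl fun k _ => ?_)
    rw [modeCoeff_sub hu hv]
    exact (sub_smul _ _ (fBasis k)).symm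
  rw [e]
  refine (norm_sum_le s fun k =>
    modeCoeff (fun t => g (modeSum s (u, t)) - g (modeSum s (v, t))) k • fBasis k).trans ?_
  rw [mul_assoc, Finset.sum_mul]
  refine Finset.sum_le_sum fun k _ => ?_
  refine (norm_smul_le (modeCoeff (fun t => g (modeSum s (u, t)) - g (modeSum s (v, t))) k)
    (fBasis k)).trans ?_
  have h1 : ‖fBasis k‖ = 1 := orthonormal_fBasis.1 k
  rw [h1, mul_one, mul_assoc]
  refine (abs_modeCoeff_le (hu.sub hv) k).trans ?_
  exact mul_le_mul_of_nonneg_left (mul_le_mul_of_nonneg_left hI (Real.sqrt_nonneg _))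
    (freq_pos k).le

lemma tendsto_avg {f : ℕ → ℝ → ℝ} {φ : ℝ → ℝ} {C p : ℝ} (hp : 0 ≤ p) (hf : ∀ m, Continuous (f m))
    (hb : ∀ m t, |f m t| ≤ C * (1 + |t|) ^ p)
    (hlim : ∀ t, Tendsto (fun m => f m t) atTop (𝓝 (φ t))) (s : Finset ℕ) (u : U) :
    Tendsto (fun m => avg (f m) s u) atTop (𝓝 (avg φ s u)) := by
  refine tendsto_integral_of_dominated_convergence
    (fun t => C * (1 + |modeSum s (u, t)|) ^ p)
    (fun m => (integrable_comp_modeSum (hf m) s u).1) ?_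
    (fun m => Eventually.of_forall fun t => hb m _) (Eventually.of_forall fun t => hlim _)
  exact integrable_lam_of_continuous ((continuous_const.add
    (continuous_modeSum_right s u).abs).rpow_const (fun _ => Or.inr hp) |>.const_mul C)

variable {μ : Measure U} [IsProbabilityMeasure μ] {p α : ℝ} {N : ℕ → ℕ} {Z Y : U × ℝ → ℝ}

lemma IsModeLimit.ae_tendsto_avg (h : IsModeLimit μ p N Z Y) {φ : ℝ → ℝ} (hφ : Continuous φ)
    {C : ℝ} (hb : ∀ t, |φ t| ≤ C * (1 + |t|) ^ p) :
    ∀ᵐ u ∂μ, Tendsto (fun n => avg φ (Finset.range (N n)) u) atTop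
      (𝓝 (∫ t, φ (Z (u, t)) ∂lam)) := by
  have hC : 0 ≤ C := by simpa using (abs_nonneg _).trans (hb 0)
  filter_upwards [((h.memLp_weight C).integrable one_le_two).prod_right_ae,
    Measure.ae_ae_of_ae_prod h.bound, Measure.ae_ae_of_ae_prod h.tendsto] with u h1 h2 h3
  refine tendsto_integral_of_dominated_convergence _
    (fun n => (integrable_comp_modeSum hφ _ u).1) h1 (fun n => ?_) ?_
  · filter_upwards [h2] with t ht
    exact (hb _).trans (h.growth_le hC (ht n))
  · filter_upwards [h3] with t ht
    exact (hφ.tendsto _).comp ht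

lemma eLpNorm_const_mul_modeCoeff_le (c : ℝ) {g : U × ℝ → ℝ} (hg : MemLp g 2 (μ.prod lam)) (k : ℕ) :
    eLpNorm (fun u => c * modeCoeff (fun t => g (u, t)) k) 2 μ
      ≤ ENNReal.ofReal (|c| * (freq k * √2)) * eLpNorm g 2 (μ.prod lam) := by
  have hk := (freq_pos k).le
  have h := eLpNorm_le_of_norm_le_integral_abs (E := ℝ) (K := |c| * (freq k * √2)) (L := 0)
    (F := fun u => c * modeCoeff (fun t => g (u, t)) k) (by positivity) le_rfl hg.1 hg.1 ?_
  · simpa using h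
  · filter_upwards [(hg.integrable one_le_two).prod_right_ae] with u hu
    rw [zero_mul, add_zero, norm_mul, mul_assoc, mul_assoc]
    exact mul_le_mul_of_nonneg_left (abs_modeCoeff_le hu k) (norm_nonneg _)

section Gaussian

variable {α₁ : ℝ} {φ : ℝ → ℝ} {C : ℝ}

/-- Compare `G` with the explicit gradient for the exponent `1`, one admissible choice above `3/8`.
The eigenvalues `ev` are left free so that the result covers powers of both `Q` and `Q₁`, without
requiring `θ` itself to exceed a threshold. -/
lemma ae_inner_fBasis_eq (hμ : IsCenteredGaussian μ (Qpow α₁)) (h : IsModeLimit μ p N Z Y)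
    (hφ : ContDiff ℝ 1 φ)
    (hb : ∀ t, |φ t| ≤ C * (1 + |t|) ^ p ∧ |deriv φ t| ≤ C * (1 + |t|) ^ p) {ev : ℕ → ℝ}
    (hev0 : ∀ k, 0 < ev k) (hev1 : ∀ k, ev k ≤ 1) {θ : ℝ} (hθ : 0 ≤ θ) {G : U → U}
    (hG : IsSobolevGrad μ fBasis (diagPow fBasis ev θ) (Phi1 φ p) G) :
    ∀ᵐ u ∂μ, Integrable (fun t => deriv φ (Z (u, t))) lam ∧ ∀ i, inner ℝ (fBasis i) (G u)
      = ev i ^ θ * modeCoeff (fun t => deriv φ (Z (u, t))) i := by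
  have := hμ.isGaussian
  have hα : (3 : ℝ) / 8 < 1 := by norm_num
  have hZ' := h.memLp_comp (hφ.continuous_deriv le_rfl) fun t => (hb t).2
  have h1 : ∀ᵐ u ∂μ, ∀ i, (ev i ^ θ)⁻¹ * inner ℝ (fBasis i) (G u) = (eig i ^ (1 : ℝ))⁻¹ *
      inner ℝ (fBasis i) (smoothed 1 fun t => deriv φ (Z (u, t))) := ae_all_iff.mpr fun i =>
    IsSobolevGrad.inner_ae_eq (H := U) hμ.mean_zero orthonormal_fBasis hev0 hev1 eig_pos eig_le_one
      hθ zero_le_one hG (h.isSobolevGrad hα hφ hb) (l := (eig i ^ α₁).toNNReal)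
      (Real.toNNReal_pos.mpr (eig_rpow_pos α₁ i)).ne' fun y => by
        rw [Real.coe_toNNReal _ (eig_rpow_pos α₁ i).le]
        exact covarianceBilin_fBasis hμ i y
  filter_upwards [h1, (hZ'.integrable one_le_two).prod_right_ae] with u h2 h3
  refine ⟨h3, fun i => ?_⟩
  have h4 := h2 i
  rw [inner_smoothed hα h3, inv_mul_cancel_left₀ (eig_rpow_pos 1 i).ne'] at h4
  rw [← h4, mul_inv_cancel_left₀ (Real.rpow_pos_of_pos (hev0 i) θ).ne']

/-- All coordinates of `G` agree with those of the explicit gradient, so completeness of the basis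
gives equality almost everywhere, and the `L¹` norm in `norm_smoothed_le` is at most `M`. -/
lemma memLp_top_of_isSobolevGrad (hμ : IsCenteredGaussian μ (Qpow α₁)) (h : IsModeLimit μ p N Z Y)
    (hφ : ContDiff ℝ 1 φ)
    (hb : ∀ t, |φ t| ≤ C * (1 + |t|) ^ p ∧ |deriv φ t| ≤ C * (1 + |t|) ^ p) {M : ℝ}
    (hM : ∀ t, |deriv φ t| ≤ M) (hα : 3 / 8 < α) {G : U → U}
    (hG : IsSobolevGrad μ fBasis (Qpow α) (Phi1 φ p) G) : MemLp G ⊤ μ := by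
  refine memLp_top_of_bound hG.1.1 (√(2 * ∑' k, freq k ^ 2 * eig k ^ (2 * α)) * M) ?_
  filter_upwards [ae_inner_fBasis_eq hμ h hφ hb eig_pos eig_le_one (by linarith) hG]
    with u ⟨hu, hi⟩
  have e : G u = smoothed α fun t => deriv φ (Z (u, t)) := by
    refine sub_eq_zero.mp (eq_zero_of_inner_fBasis fun k => ?_)
    refine (inner_sub_right (𝕜 := ℝ) (fBasis k) (G u) _).trans ?_
    rw [hi k, inner_smoothed hα hu, sub_self]
  rw [e]
  refine (norm_smoothed_le hα hu).trans (mul_le_mul_of_nonneg_left ?_ (Real.sqrt_nonneg _))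
  have h1 := integral_mono hu.abs (integrable_const M) fun t => hM _
  simpa using h1

lemma exists_tendsto_eLpNorm_inner (hμ : IsCenteredGaussian μ (Qpow α₁))
    (h : IsModeLimit μ p N Z Y) (hφ : ContDiff ℝ 1 φ)
    (hb : ∀ t, |φ t| ≤ C * (1 + |t|) ^ p ∧ |deriv φ t| ≤ C * (1 + |t|) ^ p)
    {g : ℕ → ℝ → ℝ} (hg : ∀ m, Continuous (g m)) {C' : ℝ}
    (hgb : ∀ m t, |g m t| ≤ C' * (1 + |t|) ^ p)
    (hlim : ∀ t, Tendsto (fun m => g m t) atTop (𝓝 (deriv φ t))) {ev : ℕ → ℝ}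
    (hev0 : ∀ k, 0 < ev k) (hev1 : ∀ k, ev k ≤ 1) {θ : ℝ} (hθ : 0 ≤ θ) {G : U → U}
    (hG : IsSobolevGrad μ fBasis (diagPow fBasis ev θ) (Phi1 φ p) G) (i : ℕ) :
    ∃ c : ℕ → ℝ≥0∞, (∀ n, Tendsto (fun m => eLpNorm (fun u => (inner ℝ
        (diagPow fBasis ev θ (avgGrad (g m) (Finset.range (N n)) u) - G u) (fBasis i) : ℝ)) 2 μ)
          atTop (𝓝 (c n))) ∧ Tendsto c atTop (𝓝 0) := by
  have hφ' := hφ.continuous_deriv le_rfl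
  have hZ' := h.memLp_comp hφ' fun t => (hb t).2
  have hS := h.memLp_comp_modeSum hφ' fun t => (hb t).2
  have hgS := fun n m => h.memLp_comp_modeSum (hg m) (hgb m) n
  -- The `i`-th coordinate of the gradient error with `f` in place of the derivative; the mode `i`
  -- is absent from the truncation when `i ≥ N n`.
  set D : (ℝ → ℝ) → ℕ → U → ℝ := fun f n u => ev i ^ θ *
    ((if i < N n then modeCoeff (fun t => f (modeSum (Finset.range (N n)) (u, t))) i else 0)
      - modeCoeff (fun t => deriv φ (Z (u, t))) i) with hDdef
  have hDm : ∀ {f : ℝ → ℝ} n, AEStronglyMeasurable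
      (fun q => f (modeSum (Finset.range (N n)) q)) (μ.prod lam) →
      AEStronglyMeasurable (D f n) μ := by
    intro f n hf
    refine AEStronglyMeasurable.const_mul (AEStronglyMeasurable.sub ?_
      (aestronglyMeasurable_modeCoeff hZ'.1 i)) _
    split_ifs
    · exact aestronglyMeasurable_modeCoeff hf i
    · exact aestronglyMeasurable_const
  have hDeq : ∀ m n, eLpNorm (fun u => (inner ℝ
        (diagPow fBasis ev θ (avgGrad (g m) (Finset.range (N n)) u) - G u) (fBasis i) : ℝ)) 2 μ
      = eLpNorm (D (g m) n) 2 μ := by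
    intro m n
    refine eLpNorm_congr_ae ?_
    filter_upwards [ae_inner_fBasis_eq hμ h hφ hb hev0 hev1 hθ hG] with u ⟨_, hu⟩
    refine (real_inner_comm (fBasis i) _).trans ?_
    refine (inner_sub_right (𝕜 := ℝ) (fBasis i) _ (G u)).trans ?_
    rw [hu i]
    simp only [hDdef]
    rw [mul_sub, ← inner_fBasis_avgGrad (g m) (N n) u i]
    exact congrArg (· - _) (inner_diagPow (H := U) orthonormal_fBasis (fun k => (hev0 k).le) hev1 hθ
      (avgGrad (g m) (Finset.range (N n)) u) i)
  -- For fixed `n` the inner limit only replaces `g m` by `φ'` inside the truncation, so it is the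
  -- norm of the pure truncation error.
  refine ⟨fun n => eLpNorm (D (deriv φ) n) 2 μ, fun n => ?_, ?_⟩
  · simp only [hDeq]
    refine tendsto_eLpNorm_of_tendsto_eLpNorm_sub one_le_two (fun m => hDm n (hgS n m).1)
      (hDm n (hS n).1) ?_
    have h1 := ENNReal.Tendsto.const_mul (a := ENNReal.ofReal (|ev i ^ θ| * (freq i * √2)))
      (h.tendsto_eLpNorm_modeSum hg hgb hlim n) (Or.inr ENNReal.ofReal_ne_top)
    rw [mul_zero] at h1
    refine tendsto_of_tendsto_of_tendsto_of_le_of_le tendsto_const_nhds h1 (fun _ => zero_le)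
      fun m => ?_
    refine le_trans (eLpNorm_mono_ae_real (Eventually.of_forall fun u => ?_))
      ((eLpNorm_norm _).trans_le (eLpNorm_const_mul_modeCoeff_le (ev i ^ θ)
        ((hgS n m).sub (hS n)) i))
    have e := modeCoeff_sub (integrable_comp_modeSum (hg m) (Finset.range (N n)) u)
      (integrable_comp_modeSum hφ' (Finset.range (N n)) u) i
    simp only [Pi.sub_apply, e, hDdef, ← mul_sub, sub_sub_sub_cancel_right]
    split_ifs
    · exact le_rfl
    · rw [sub_self, mul_zero, norm_zero]
      exact norm_nonneg _
  · have h1 := ENNReal.Tendsto.const_mul (a := ENNReal.ofReal (|ev i ^ θ| * (freq i * √2)))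
      (h.tendsto_eLpNorm (fun _ => hφ') (fun _ t => (hb t).2)
        fun x xs hx => (hφ'.tendsto x).comp hx) (Or.inr ENNReal.ofReal_ne_top)
    rw [mul_zero] at h1
    refine tendsto_of_tendsto_of_tendsto_of_le_of_le' tendsto_const_nhds h1
      (Eventually.of_forall fun _ => zero_le) ?_
    filter_upwards [eventually_gt_atTop i] with n hn
    refine (eLpNorm_congr_ae ?_).trans_le (eLpNorm_const_mul_modeCoeff_le (ev i ^ θ)
        ((hS n).sub hZ') i)
    filter_upwards [(hZ'.integrable one_le_two).prod_right_ae] with u hu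
    have e := modeCoeff_sub (integrable_comp_modeSum hφ' (Finset.range (N n)) u) hu i
    simp only [Pi.sub_apply, e, hDdef]
    -- A strictly increasing `N` satisfies `n ≤ N n`, so for `n > i` the mode `i` is present.
    rw [if_pos (hn.trans_le (h.strictMono.le_apply))]

/-- The index `n` truncates the modes and `m` regularises `φ`. Precomposition with a linear
truncation and averaging preserve convexity, and the bounded Lipschitz derivative of `f m` makes the
gradient on `U` Lipschitz. -/
lemma convexApproximable_Phi1 (hα₁ : 0 ≤ α₁) (hμ : IsCenteredGaussian μ (Qpow α₁))
    (h : IsModeLimit μ p N Z Y) (hφ : ContDiff ℝ 1 φ) (hbdd : BddBelow (range φ))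
    (hconv : ConvexOn ℝ univ φ)
    (hb : ∀ t, |φ t| ≤ C * (1 + |t|) ^ p ∧ |deriv φ t| ≤ C * (1 + |t|) ^ p) {A : ℝ}
    (hA : ∀ t, |deriv φ t| ≤ A * (1 + |t|) ^ (p - 1)) :
    ConvexApproximable μ fBasis (fun k => eig k ^ α₁) (Phi1 φ p) := by
  have hp := h.one_le
  obtain ⟨f, hf, hfc, hf0, hfb, hfL, ⟨C', hC'⟩, hlim, hlim'⟩ := exists_convex_approx hφ hconv hp hA
  have hgrad : ∀ m n, gradient (avg (f m) (Finset.range (N n)))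
      = avgGrad (deriv (f m)) (Finset.range (N n)) := fun m n => funext fun u =>
    (hasGradientAt_avg (hf m) (hfb m).choose_spec _ u).gradient
  refine ⟨bot_lt_iInf_Phi1 hbdd p, fun n => avg φ (Finset.range (N n)),
    fun m n => avg (f m) (Finset.range (N n)), fun n => convexOn_avg hconv hφ.continuous _,
    fun m n => convexOn_avg (hfc m) (hf m).continuous _, ?_, fun m n => ⟨fun u => ?_, ?_⟩, ?_⟩
  · filter_upwards [h.ae_Phi1_eq φ, h.ae_tendsto_avg hφ.continuous fun t => (hb t).1] with u h1 h2
    refine ⟨fun n => tendsto_avg (by linarith) (fun m => (hf m).continuous) (fun m t => (hC' m t).1)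
      hlim _ u, fun m n => ?_, ?_⟩
    · refine (iInf_Phi1_le φ hp).trans ?_
      rw [EReal.coe_le_coe_iff, ← hf0 m]
      exact le_avg (hfc m) (hf m).continuous _ u
    · rw [h1]
      exact (continuous_coe_real_ereal.tendsto _).comp h2
  · exact (hasGradientAt_avg (hf m) (hfb m).choose_spec _ u).differentiableAt
  · obtain ⟨K, hK⟩ := hfL m
    rw [hgrad]
    exact lipschitzWith_avgGrad hK _
  · intro θ hθ G hG i
    simp only [hgrad]
    exact exists_tendsto_eLpNorm_inner hμ h hφ hb (fun m => (hf m).continuous_deriv le_rfl)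
      (fun m t => (hC' m t).2) hlim' (eig_rpow_pos α₁) (eig_rpow_le_one hα₁) hθ hG i

end Gaussian

end CahnHilliard

end

theorem mainTheorem10
    (φ : ℝ → ℝ) (hφ : ContDiff ℝ 1 φ) (hφ_bdd : BddBelow (range φ))
    (p A₁ : ℝ) (hp : 1 ≤ p) (hA₁ : 0 < A₁)
    (hgrowth : ∀ t : ℝ, |deriv φ t| ≤ A₁ * (1 + |t| ^ (p - 1)))
    (α₁ : ℝ) (hα₁ : 3 / 4 < α₁)
    (μ₁ : Measure CahnHilliard.U)
    (hμ₁ : GaussianSobolev.IsCenteredGaussian μ₁ (CahnHilliard.Qpow α₁)) :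
    (∀ α : ℝ, 3 / 8 < α →
      GaussianSobolev.MemSobolev μ₁ CahnHilliard.fBasis (CahnHilliard.Qpow α)
        (CahnHilliard.Phi1 φ p)) ∧
    (ConvexOn ℝ univ φ →
      GaussianSobolev.ConvexApproximable μ₁ CahnHilliard.fBasis
        (fun k => CahnHilliard.eig k ^ α₁) (CahnHilliard.Phi1 φ p)) ∧
    ((∃ M : ℝ, ∀ t : ℝ, |deriv φ t| ≤ M) →
      ∀ α : ℝ, 3 / 8 < α → ∀ G : CahnHilliard.U → CahnHilliard.U,
        GaussianSobolev.IsSobolevGrad μ₁ CahnHilliard.fBasis (CahnHilliard.Qpow α)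
          (CahnHilliard.Phi1 φ p) G →
        MemLp G ⊤ μ₁) := by
  have := hμ₁.isGaussian
  obtain ⟨N, Z, Y, h⟩ := CahnHilliard.exists_isModeLimit hα₁ hμ₁ hp
  have hA : ∀ t, |deriv φ t| ≤ 2 * A₁ * (1 + |t|) ^ (p - 1) := fun t =>
    abs_le_of_growth hp hA₁.le (hgrowth t)
  obtain ⟨C, hb⟩ := exists_growth_bound (hφ.differentiable one_ne_zero) hp (by positivity) hA
  exact ⟨fun α hα => ⟨_, h.isSobolevGrad hα hφ hb⟩,
    fun hconv => CahnHilliard.convexApproximable_Phi1 (by linarith) hμ₁ h hφ hφ_bdd hconv hb hA,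
    fun ⟨M, hM⟩ α hα G hG => CahnHilliard.memLp_top_of_isSobolevGrad hμ₁ h hφ hb hM hα hG⟩
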